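/- Let $M$ be a (smooth, real) supermanifold of dimension $p|q$, and $\Pi T^*M$ its parity-reversed cotangent bundle with local coordinates $(x^a;x^*_a)$, $x^*_a$ having parity $\tilde a+1$, and $x^*_{a'}=\partial_{a'}x^a\,x^*_a$ under a change of coordinates. Let $\mathfrak A^k(M)$ be the space of functions on $\Pi T^*M$ that are homogeneous polynomials of degree $k$ in the fibre coordinates ($\mathfrak A^{-1}(M)=0$), and let $(\,\cdot\,,\cdot\,)$ be the canonical odd bracket, normalised on homogeneous functions by $$(f,g)=\sum_a\Big[(-1)^{\tilde a+\tilde a\tilde f}\,\frac{\partial f}{\partial x^*_a}\frac{\partial g}{\partial x^a}+(-1)^{\tilde a+(\tilde a+1)\tilde f}\,\frac{\partial f}{\partial x^a}\frac{\partial g}{\partial x^*_a}\Big]$$ (left derivatives). Let $\hat M$ be the space whose algebra of functions is the algebra of densities $\mathcal F(M)=\bigoplus_{\lambda\in\mathbb R}\mathcal F^\lambda(M)$, locally generated over $C^\infty(M)$ by the powers $t^\lambda$ of an even invertible element $t$ of weight $1$, where $t'=|\mathrm{Ber}(\partial x'/\partial x)|\,t$. On $\Pi T^*\hat M$ use the coordinates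 $(x^a,t;\hat x^*_a,w^*)$ with $w^*=t\,t^*$; apart from $t$ they have weight $0$, $w^*$ is invariant, and $$\hat x^*_{a'}=\partial_{a'}x^a\,\hat x^*_a+(-1)^{\tilde b'}\,\partial_{a'}\partial_{b'}x^a\;\partial_a x^{b'}\;w^*.$$ The functions on $\Pi T^*\hat M$ that are polynomial in the fibre coordinates $\hat x^*_a,w^*$ are graded by degree, weight and parity, and $\Pi T^*\hat M$ carries its own canonical odd bracket, given by the same formula in the coordinates $(x^a,t;\hat x^*_a,t^*)$. A function $S$ on $\Pi T^*\hat M$ lies above $s\in\mathfrak A^r(M)$ if the projection $t^*\mapsto0$ maps $S$ to $s$. Let $r\ge 0$ and let $s\in\mathfrak A^r(M)$ be an even $r$-ary Poisson bracket, i.e. $s$ is an even function and $(s,s)=0$. Then: 1. The local expressions $$\hat s=s(x,\hat x^*)+w^*\,(\Delta s)(x,\hat x^*),\qquad \Delta s=\sum_a(-1)^{\tilde a}\,\partial_{x^a}\partial_{x^*_a}s,$$ define a global function $\hat s$ on $\Pi T^*\hat M$ (the canonical lift of $s$). 2. For every odd $Q\in\mathfrak A^{r-1}(M)$ with $(s,Q)=0$,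 the local expressions $\hat s+Q(x,\hat x^*)\,w^*$ define a global function $\hat s+Qw^*$ on $\Pi T^*\hat M$, and $Q\mapsto \hat s+Q\,w^*$ is a bijection from $$\{Q\in\mathfrak A^{r-1}(M)\;:\;Q\text{ odd},\ (s,Q)=0\},$$ the odd part of $\mathrm{Ker}(s,\cdot)\cap\mathfrak A^{r-1}(M)$, onto the set of all functions $S$ on $\Pi T^*\hat M$ that lie above $s$, are Poisson, i.e. $(S,S)=0$, and have the same degree, weight and parity as $s$, i.e. are homogeneous of degree $r$ in the fibre coordinates, of weight $0$, and even. -/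

import Mathlib

open CategoryTheory TopologicalSpace Opposite
open scoped ContDiff

noncomputable section

namespace SuperGeom

/-! ### Grassmann algebras -/

/-- The Grassmann algebra `K[θ₀, …, θₙ₋₁]` on `n` anticommuting generators over a commutative
ring `K`. An element `f` stands for `∑ I, f I • θ^I`, where `θ^I` is the product of the `θᵢ`
with `i ∈ I`, in increasing order. -/
def Grass (n : ℕ) (K : Type*) : Type _ := Finset (Fin n) → K

namespace Grass

variable {n : ℕ} {K : Type*}

@[ext] theorem ext {f g : Grass n K} (h : ∀ I, f I = g I) : f = g := funext h

instance [AddCommGroup K] : AddCommGroup (Grass n K) :=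
  inferInstanceAs (AddCommGroup (Finset (Fin n) → K))

instance {k : Type*} [Semiring k] [AddCommGroup K] [Module k K] : Module k (Grass n K) :=
  inferInstanceAs (Module k (Finset (Fin n) → K))

@[simp] theorem add_apply [AddCommGroup K] (f g : Grass n K) (I : Finset (Fin n)) :
    (f + g) I = f I + g I := rfl

@[simp] theorem zero_apply [AddCommGroup K] (I : Finset (Fin n)) :
    (0 : Grass n K) I = 0 := rfl

@[simp] theorem smul_apply {k : Type*} [Semiring k] [AddCommGroup K] [Module k K] (c : k)
    (f : Grass n K) (I : Finset (Fin n)) : (c • f) I = c • f I := rfl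

/-- The number of transpositions needed to sort `θ^I θ^J`. -/
def inv (I J : Finset (Fin n)) : ℕ := ((I ×ˢ J).filter fun x => x.2 < x.1).card

theorem inv_union_left {I I' : Finset (Fin n)} (h : Disjoint I I') (J : Finset (Fin n)) :
    inv (I ∪ I') J = inv I J + inv I' J := by
  unfold inv
  rw [Finset.union_product, Finset.filter_union, Finset.card_union_of_disjoint]
  exact Finset.disjoint_filter_filter (Finset.disjoint_product.2 (Or.inl h))

theorem inv_union_right (I : Finset (Fin n)) {J J' : Finset (Fin n)} (h : Disjoint J J') :
    inv I (J ∪ J') = inv I J + inv I J' := by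
  unfold inv
  rw [Finset.product_union, Finset.filter_union, Finset.card_union_of_disjoint]
  exact Finset.disjoint_filter_filter (Finset.disjoint_product.2 (Or.inr h))

variable [CommRing K]

/-- The element `a • 1`. -/
def C (a : K) : Grass n K := fun I => if I = ∅ then a else 0

/-- The generator `θᵢ`. -/
def gen (i : Fin n) : Grass n K := fun I => if I = {i} then 1 else 0

instance : Mul (Grass n K) :=
  ⟨fun f g I => ∑ J ∈ I.powerset, (-1) ^ inv J (I \ J) * (f J * g (I \ J))⟩

instance : One (Grass n K) := ⟨C 1⟩

theorem mul_apply (f g : Grass n K) (I : Finset (Fin n)) :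
    (f * g) I = ∑ J ∈ I.powerset, (-1) ^ inv J (I \ J) * (f J * g (I \ J)) := rfl

theorem one_apply (I : Finset (Fin n)) : (1 : Grass n K) I = if I = ∅ then 1 else 0 := rfl

theorem C_mul_apply (a : K) (f : Grass n K) (I : Finset (Fin n)) : (C a * f : Grass n K) I = a * f I := by
  rw [mul_apply, Finset.sum_eq_single ∅]
  · simp [C, inv]
  · intro J _ hJ
    simp [C, hJ]
  · simp

theorem mul_C_apply (a : K) (f : Grass n K) (I : Finset (Fin n)) : (f * C a : Grass n K) I = a * f I := by
  rw [mul_apply, Finset.sum_eq_single I]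
  · simp [C, inv, mul_comm]
  · intro J hJ hne
    have h : I \ J ≠ ∅ := by
      intro h
      exact hne (Finset.Subset.antisymm (Finset.mem_powerset.1 hJ) (Finset.sdiff_eq_empty_iff_subset.1 h))
    simp [C, h]
  · simp

theorem mul_assoc' (f g h : Grass n K) : f * g * h = f * (g * h) := by
  ext S
  simp only [mul_apply, Finset.sum_mul, Finset.mul_sum, Finset.sum_sigma']
  refine Finset.sum_bij'
    (fun x _ => (⟨x.2, x.1 \ x.2⟩ : Sigma fun _ : Finset (Fin n) => Finset (Fin n)))
    (fun x _ => (⟨x.1 ∪ x.2, x.1⟩ : Sigma fun _ : Finset (Fin n) => Finset (Fin n)))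
    ?_ ?_ ?_ ?_ ?_
  · rintro ⟨I, J⟩ hx
    simp only [Finset.mem_sigma, Finset.mem_powerset] at hx ⊢
    exact ⟨hx.2.trans hx.1, Finset.sdiff_subset_sdiff hx.1 le_rfl⟩
  · rintro ⟨J, L⟩ hx
    simp only [Finset.mem_sigma, Finset.mem_powerset] at hx ⊢
    exact ⟨Finset.union_subset hx.1 (hx.2.trans Finset.sdiff_subset), Finset.subset_union_left⟩
  · rintro ⟨I, J⟩ hx
    simp only [Finset.mem_sigma, Finset.mem_powerset] at hx
    simp [Finset.union_sdiff_of_subset hx.2]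
  · rintro ⟨J, L⟩ hx
    simp only [Finset.mem_sigma, Finset.mem_powerset] at hx
    have hd : Disjoint L J := Finset.disjoint_of_subset_left hx.2 Finset.sdiff_disjoint
    simp [Finset.union_sdiff_cancel_left hd.symm]
  · rintro ⟨I, J⟩ hx
    simp only [Finset.mem_sigma, Finset.mem_powerset] at hx
    obtain ⟨hI, hJ⟩ := hx
    have e1 : (S \ J) \ (I \ J) = S \ I := by
      ext a
      have := @hJ a
      simp only [Finset.mem_sdiff]
      tauto
    have e2 : S \ J = (I \ J) ∪ (S \ I) := by
      ext a
      have h1 := @hJ a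
      have h2 := @hI a
      simp only [Finset.mem_sdiff, Finset.mem_union]
      tauto
    have d1 : Disjoint (I \ J) (S \ I) :=
      Finset.disjoint_of_subset_left Finset.sdiff_subset Finset.disjoint_sdiff
    have d2 : Disjoint J (I \ J) := Finset.disjoint_sdiff
    have k1 : inv I (S \ I) = inv J (S \ I) + inv (I \ J) (S \ I) := by
      rw [← inv_union_left d2, Finset.union_sdiff_of_subset hJ]
    have k2 : inv J (S \ J) = inv J (I \ J) + inv J (S \ I) := by
      rw [e2, inv_union_right _ d1]
    simp only [e1, k1, k2, pow_add]
    ring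

instance : Ring (Grass n K) where
  __ := (inferInstance : AddCommGroup (Grass n K))
  mul := (· * ·)
  one := 1
  left_distrib f g h := by
    ext I
    simp [mul_apply, mul_add, Finset.sum_add_distrib]
  right_distrib f g h := by
    ext I
    simp [mul_apply, add_mul, mul_add, Finset.sum_add_distrib]
  zero_mul f := by
    ext I
    simp [mul_apply]
  mul_zero f := by
    ext I
    simp [mul_apply]
  mul_assoc := mul_assoc'
  one_mul f := by
    ext I
    exact (C_mul_apply 1 f I).trans (one_mul _)
  mul_one f := by
    ext I
    exact (mul_C_apply 1 f I).trans (one_mul _)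

instance {k : Type*} [CommSemiring k] [Algebra k K] : Algebra k (Grass n K) :=
  Algebra.ofModule
    (fun c f g => by
      ext I
      simp [mul_apply, Finset.smul_sum])
    (fun c f g => by
      ext I
      simp [mul_apply, Finset.smul_sum])

/-- The parity involution `f ↦ (-1)^f f`. -/
def parity (f : Grass n K) : Grass n K := fun I => (-1) ^ I.card * f I

/-- The left derivative `∂/∂θᵢ`. -/
def leftDeriv (i : Fin n) (f : Grass n K) : Grass n K := fun I =>
  if i ∈ I then 0 else (-1) ^ (I.filter (· < i)).card * f (insert i I)

/-- `f` contains only products of an even number of generators. -/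
def IsEven (f : Grass n K) : Prop := ∀ I, f I ≠ 0 → Even I.card

/-- `f` contains only products of an odd number of generators. -/
def IsOdd (f : Grass n K) : Prop := ∀ I, f I ≠ 0 → Odd I.card

/-- Apply `φ` to every coefficient. -/
def map {L : Type*} (φ : K → L) (f : Grass n K) : Grass n L := fun I => φ (f I)

/-- The substitution `∑ f_I θ^I ↦ ∑ κ (f_I) Θ^I`. -/
def subst {B : Type*} [Ring B] (κ : K → B) (Θ : Fin n → B) (f : Grass n K) : B :=
  ∑ I : Finset (Fin n), κ (f I) * ((I.sort (· ≤ ·)).map Θ).prod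

end Grass

/-! ### Superdomains -/

section Domain

variable {p q : ℕ}

theorem extend_eq (V : Opens (Fin p → ℝ)) (f : V → ℝ) {x : Fin p → ℝ} (hx : x ∈ V) :
    Function.extend Subtype.val f 0 x = f ⟨x, hx⟩ :=
  Subtype.val_injective.extend_apply f 0 (⟨x, hx⟩ : V)

/-- The algebra `C^∞(V)` of smooth functions on an open set `V ⊆ ℝᵖ`. -/
def smoothSubalgebra (V : Opens (Fin p → ℝ)) : Subalgebra ℝ (V → ℝ) where
  carrier := {f | ContDiffOn ℝ ∞ (Function.extend Subtype.val f 0) V}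
  mul_mem' {f g} hf hg := (ContDiffOn.mul hf hg).congr fun x hx => by
    rw [extend_eq V _ hx, extend_eq V _ hx, extend_eq V _ hx, Pi.mul_apply]
  add_mem' {f g} hf hg := (ContDiffOn.add hf hg).congr fun x hx => by
    rw [extend_eq V _ hx, extend_eq V _ hx, extend_eq V _ hx, Pi.add_apply]
  algebraMap_mem' c := (contDiffOn_const (c := c)).congr fun x hx => by
    rw [extend_eq V _ hx]
    rfl

/-- `C^∞(V)` as a type. -/
abbrev Smooth (V : Opens (Fin p → ℝ)) : Type := smoothSubalgebra V

/-- A function on `V` which is the restriction of a function smooth on `V` is smooth. -/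
theorem mem_smooth {V : Opens (Fin p → ℝ)} {g : (Fin p → ℝ) → ℝ} (hg : ContDiffOn ℝ ∞ g V) :
    (fun x : V => g x) ∈ smoothSubalgebra V :=
  hg.congr fun _ hx => extend_eq V _ hx

namespace Smooth

/-- The coordinate function `xᵃ`. -/
def coord (V : Opens (Fin p → ℝ)) (a : Fin p) : Smooth V :=
  ⟨fun x => x.1 a, mem_smooth (g := fun y => y a) (contDiff_apply ℝ ℝ a).contDiffOn⟩

/-- Restriction of functions to a smaller open set. -/
def restrict {V V' : Opens (Fin p → ℝ)} (h : V' ≤ V) (f : Smooth V) : Smooth V' :=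
  ⟨fun x => f.1 ⟨x.1, h x.2⟩,
    (f.2.mono h).congr fun _ hx => (extend_eq V' _ hx).trans (extend_eq V _ (h hx)).symm⟩

/-- The partial derivative `∂/∂xᵃ`. -/
def pderiv {V : Opens (Fin p → ℝ)} (a : Fin p) (f : Smooth V) : Smooth V :=
  ⟨fun x => fderiv ℝ (Function.extend Subtype.val f.1 0) x (Pi.single a 1),
    mem_smooth (g := fun x => fderiv ℝ (Function.extend Subtype.val f.1 0) x (Pi.single a 1))
      ((f.2.fderiv_of_isOpen V.2 (by simp)).clm_apply contDiffOn_const)⟩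

open Classical in
/-- The function `|f|^μ`, for a nowhere vanishing smooth function `f` (and `1` otherwise). -/
def absRpow {V : Opens (Fin p → ℝ)} (f : Smooth V) (μ : ℝ) : Smooth V :=
  if h : ∀ x, f.1 x ≠ 0 then
    ⟨fun x => |f.1 x| ^ μ, by
      have h0 : ∀ x ∈ (V : Set (Fin p → ℝ)), Function.extend Subtype.val f.1 0 x ≠ 0 :=
        fun _ hx => by rw [extend_eq V f.1 hx]; exact h _
      have h1 : ContDiffOn ℝ ∞ (fun x => |Function.extend Subtype.val f.1 0 x| ^ μ) V :=
        ContDiffOn.rpow_const_of_ne (fun x hx => (f.2 x hx).abs (h0 x hx))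
          fun x hx => abs_ne_zero.2 (h0 x hx)
      exact h1.congr fun x hx => by rw [extend_eq V _ hx, extend_eq V f.1 hx]⟩
  else 1

end Smooth

/-- The superfunctions `C^∞(V) ⊗ Λ(ξ¹, …, ξ^q)` on the superdomain `V^{p|q}`. -/
abbrev SuperFun (q : ℕ) (V : Opens (Fin p → ℝ)) : Type := Grass q (Smooth V)

/-- The coordinates of a superdomain of dimension `p|q` are indexed by `Fin p ⊕ Fin q`, the even
ones `xᵃ` by `Sum.inl a`, the odd ones `ξ^α` by `Sum.inr α`. This is the parity of a
coordinate. -/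
def par : Fin p ⊕ Fin q → ℕ := Sum.elim (fun _ => 0) (fun _ => 1)

namespace SuperFun

variable {V : Opens (Fin p → ℝ)}

/-- The coordinates of a superdomain, as superfunctions. -/
def coord (q : ℕ) (V : Opens (Fin p → ℝ)) : Fin p ⊕ Fin q → SuperFun q V
  | Sum.inl a => Grass.C (Smooth.coord V a)
  | Sum.inr α => Grass.gen α

/-- The (left) partial derivatives along the coordinates of a superdomain. -/
def pderiv : Fin p ⊕ Fin q → SuperFun q V → SuperFun q V
  | Sum.inl a => Grass.map (Smooth.pderiv a)
  | Sum.inr α => Grass.leftDeriv α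

/-- Restriction to a smaller superdomain. -/
def restrict {V' : Opens (Fin p → ℝ)} (h : V' ≤ V) : SuperFun q V → SuperFun q V' :=
  Grass.map (Smooth.restrict h)

/-- The power `|g|^μ` of an even superfunction `g` with nowhere vanishing body `g₀`: with
`g = g₀ (1 + ν)`, `ν` nilpotent, it is `|g₀|^μ ∑ₖ (μ choose k) νᵏ`. -/
def absRpow (g : SuperFun q V) (μ : ℝ) : SuperFun q V :=
  Grass.C (Smooth.absRpow (g ∅) μ) *
    ∑ k ∈ Finset.range (q + 1),
      Ring.choose μ k • (Grass.C (Ring.inverse (g ∅)) * g - 1) ^ k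

end SuperFun

/-- The Leibniz determinant, of a matrix whose entries commute with each other. -/
def leibnizDet {B : Type*} [Ring B] {n : ℕ} (A : Matrix (Fin n) (Fin n) B) : B :=
  ∑ σ : Equiv.Perm (Fin n), ((Equiv.Perm.sign σ : ℤˣ) : ℤ) •
    (List.ofFn fun i => A i (σ i)).prod

/-- The Berezinian `det (A - B D⁻¹ C) (det D)⁻¹` of an even invertible supermatrix with blocks
`A`, `B`, `C`, `D`. -/
def berezinian {B : Type*} [Ring B] (J : Matrix (Fin p ⊕ Fin q) (Fin p ⊕ Fin q) B) : B :=
  leibnizDet (J.toBlocks₁₁ - J.toBlocks₁₂ * Ring.inverse J.toBlocks₂₂ * J.toBlocks₂₁) *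
    Ring.inverse (leibnizDet J.toBlocks₂₂)

/-! ### Fibrewise polynomial functions on odd cotangent bundles of superdomains -/

/-- The algebra `F[ξ*₁, …, ξ*_q] ⊗ Λ(θ₀, …, θₙ₋₁)`. -/
abbrev Fib (n q : ℕ) (F : Type*) [CommRing F] : Type _ := Grass n (MvPolynomial (Fin q) F)

namespace Fib

variable {n : ℕ} {F : Type*} [CommRing F]

/-- Apply an additive operator `D` on `F` to all coefficients in `F`. -/
def onCoeff {G : Type*} [CommRing G] (D : F → G) : Fib n q F → Fib n q G :=
  Grass.map fun P => ∑ m ∈ P.support, MvPolynomial.monomial m (D (P.coeff m))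

/-- The elements of `F`, as constants. -/
def base (f : F) : Fib n q F := Grass.C (MvPolynomial.C f)

/-- The substitution that replaces the elements of `F` through `κ`, the even generators
`ξ*_α` by `η α` and the odd generators `θᵢ` by `Θ i`. -/
def subst {B : Type*} [Ring B] (κ : F → B) (η : Fin q → B) (Θ : Fin n → B) :
    Fib n q F → B :=
  Grass.subst
    (fun P => ∑ m ∈ P.support, κ (P.coeff m) * (List.ofFn fun α => η α ^ m α).prod) Θ

/-- All terms of `f` have degree `k` in the fibre coordinates, which are the even generators
`ξ*_α` and the odd generators `θᵢ` with `q ≤ i`. -/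
def HasDegree (f : Fib n q F) (k : ℤ) : Prop :=
  ∀ (I : Finset (Fin n)) (m : Fin q →₀ ℕ), (f I).coeff m ≠ 0 →
    (((I.filter fun i : Fin n => q ≤ i.val).card + m.degree : ℕ) : ℤ) = k

end Fib

/-- The algebra of functions on `ΠT*V` that are polynomial in the fibre coordinates, for a
superdomain `V` of dimension `p|q`. Its odd generators are `ξ^α` (number `α`) and the
antimomenta `x*_a` (number `q + a`) of the even coordinates; the antimomenta `ξ*_α` of the odd
coordinates are even, and the polynomial variables. -/
abbrev CotFun (q : ℕ) (V : Opens (Fin p → ℝ)) : Type := Fib (q + p) q (Smooth V)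

/-- The algebra `⊕_λ C^∞(V) t^λ`, with real exponents `λ`. -/
abbrev DensityBase (V : Opens (Fin p → ℝ)) : Type := AddMonoidAlgebra (Smooth V) ℝ

/-- The algebra of functions on `ΠT*V̂` that are polynomial in the fibre coordinates, where `V̂`
is the space whose functions are the densities on `V`, in the coordinates
`(xᵃ, t; x̂*_a, w* = t t*)`. The odd generators are `ξ^α` (number `α`), `x̂*_a` (number `q + a`)
and `w*` (the last). -/
abbrev HatFun (q : ℕ) (V : Opens (Fin p → ℝ)) : Type := Fib (q + p + 1) q (DensityBase V)

/-- `(-1)^a` as a number. -/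
def sgn (a : Fin p ⊕ Fin q) : ℤ := (-1) ^ par a

namespace CotFun

variable {V : Opens (Fin p → ℝ)}

/-- The inclusion of the functions on the superdomain. -/
def ofBase : SuperFun q V → CotFun q V :=
  Grass.subst Fib.base fun α => Grass.gen (Fin.castAdd p α)

/-- The fibre coordinates `x*_a`. -/
def anti (q : ℕ) (V : Opens (Fin p → ℝ)) : Fin p ⊕ Fin q → CotFun q V
  | Sum.inl a => Grass.gen (Fin.natAdd q a)
  | Sum.inr α => Grass.C (MvPolynomial.X α)

/-- The left derivatives `∂/∂xᵃ`. -/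
def dx : Fin p ⊕ Fin q → CotFun q V → CotFun q V
  | Sum.inl a => Fib.onCoeff (Smooth.pderiv a)
  | Sum.inr α => Grass.leftDeriv (Fin.castAdd p α)

/-- The left derivatives `∂/∂x*_a`. -/
def dxs : Fin p ⊕ Fin q → CotFun q V → CotFun q V
  | Sum.inl a => Grass.leftDeriv (Fin.natAdd q a)
  | Sum.inr α => Grass.map (MvPolynomial.pderiv α)

/-- The canonical odd bracket. On a homogeneous `f` it is `(-1)^f` times the
Batalin-Vilkovisky bracket, that is
`(f, g) = ∑ₐ (-1)^{a + a f} (∂f/∂x*_a) (∂g/∂xᵃ) + (-1)^{a + (a+1) f} (∂f/∂xᵃ) (∂g/∂x*_a)`. -/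
def bracket (f g : CotFun q V) : CotFun q V :=
  ∑ a : Fin p ⊕ Fin q, sgn a •
    (dxs a (Grass.parity^[par a] f) * dx a g + dx a (Grass.parity^[par a + 1] f) * dxs a g)

/-- The divergence operator of the coordinate volume form, `∑ₐ (-1)^a ∂/∂xᵃ ∂/∂x*_a`. -/
def divergence (f : CotFun q V) : CotFun q V :=
  ∑ a : Fin p ⊕ Fin q, sgn a • dx a (dxs a f)

/-- Restriction to a smaller superdomain. -/
def restrict {V' : Opens (Fin p → ℝ)} (h : V' ≤ V) : CotFun q V → CotFun q V' :=
  Fib.onCoeff (Smooth.restrict h)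

end CotFun

namespace HatFun

variable {V : Opens (Fin p → ℝ)}

/-- The inclusion of the functions on the superdomain. -/
def ofBase : SuperFun q V → HatFun q V :=
  Grass.subst (fun c => Fib.base (AddMonoidAlgebra.single 0 c))
    fun α => Grass.gen (Fin.castSucc (Fin.castAdd p α))

/-- The fibre coordinates `x̂*_a`. -/
def anti (q : ℕ) (V : Opens (Fin p → ℝ)) : Fin p ⊕ Fin q → HatFun q V
  | Sum.inl a => Grass.gen (Fin.castSucc (Fin.natAdd q a))
  | Sum.inr α => Grass.C (MvPolynomial.X α)

/-- The fibre coordinate `w* = t t*`. -/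
def wStar (q : ℕ) (V : Opens (Fin p → ℝ)) : HatFun q V := Grass.gen (Fin.last (q + p))

/-- The element `t^μ`. -/
def tpow (q : ℕ) (V : Opens (Fin p → ℝ)) (μ : ℝ) : HatFun q V :=
  Fib.base (AddMonoidAlgebra.single μ 1)

/-- The map `s(x, x*) ↦ s(x, x̂*)`, given in coordinates. -/
def ofCot : CotFun q V → HatFun q V :=
  Fib.subst (fun c => Fib.base (AddMonoidAlgebra.single 0 c))
    (fun α => anti q V (Sum.inr α)) (fun i => Grass.gen (Fin.castSucc i))

/-- Apply an operator to each coefficient of each power of `t`. -/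
def onDensity {V' : Opens (Fin p → ℝ)} (D : ℝ → Smooth V → Smooth V')
    (f : DensityBase V) : DensityBase V' :=
  f.coeff.sum fun μ c => AddMonoidAlgebra.single μ (D μ c)

/-- The left derivatives `∂/∂xᵃ`. -/
def dx : Fin p ⊕ Fin q → HatFun q V → HatFun q V
  | Sum.inl a => Fib.onCoeff (onDensity fun _ => Smooth.pderiv a)
  | Sum.inr α => Grass.leftDeriv (Fin.castSucc (Fin.castAdd p α))

/-- The left derivatives `∂/∂x̂*_a`. -/
def dxs : Fin p ⊕ Fin q → HatFun q V → HatFun q V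
  | Sum.inl a => Grass.leftDeriv (Fin.castSucc (Fin.natAdd q a))
  | Sum.inr α => Grass.map (MvPolynomial.pderiv α)

/-- The left derivative `∂/∂w*`, at constant `t`. -/
def dw (f : HatFun q V) : HatFun q V := Grass.leftDeriv (Fin.last (q + p)) f

/-- The derivative `∂/∂t` in the coordinates `(t, t*)`, that is at constant `t* = t⁻¹ w*`. -/
def dt (f : HatFun q V) : HatFun q V :=
  tpow q V (-1) * (Fib.onCoeff (onDensity fun μ c => μ • c) f + wStar q V * dw f)

/-- The left derivative `∂/∂t*` in the coordinates `(t, t*)`. -/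
def dts (f : HatFun q V) : HatFun q V := tpow q V 1 * dw f

/-- The canonical odd bracket on `ΠT*V̂`: the same expression as before, in the coordinates
`(xᵃ, t; x̂*_a, t*)`. -/
def bracket (f g : HatFun q V) : HatFun q V :=
  ∑ a : Fin p ⊕ Fin q, sgn a •
      (dxs a (Grass.parity^[par a] f) * dx a g + dx a (Grass.parity^[par a + 1] f) * dxs a g)
    + (dts f * dt g + dt (Grass.parity f) * dts g)

/-- Restriction to a smaller superdomain. -/
def restrict {V' : Opens (Fin p → ℝ)} (h : V' ≤ V) : HatFun q V → HatFun q V' :=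
  Fib.onCoeff (onDensity fun _ => Smooth.restrict h)

/-- The projection `t* ↦ 0` to the functions on `ΠT*V` with values in densities. -/
def proj (f : HatFun q V) : Fib (q + p) q (DensityBase V) :=
  fun I => f (I.map Fin.castSuccEmb)

/-- All terms of `f` have weight `μ`. The weight of `t` is `1`, and all `xᵃ`, `x̂*_a` and `w*`
have weight `0`. -/
def HasWeight (f : HatFun q V) (μ : ℝ) : Prop :=
  ∀ (I : Finset (Fin (q + p + 1))) (m : Fin q →₀ ℕ) (ν : ℝ),
    ((f I).coeff m).coeff ν ≠ 0 → ν = μ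

end HatFun

end Domain

/-! ### Supermanifolds -/

/-- The open subset of `ℝᵖ` that corresponds to `W` under a chart. -/
def chartImage.{u} {p : ℕ} {X : TopCat.{u}} (e : OpenPartialHomeomorph X (Fin p → ℝ)) (W : Opens X) :
    Opens (Fin p → ℝ) :=
  ⟨e.target ∩ e.symm ⁻¹' W, e.isOpen_inter_preimage_symm W.2⟩

theorem chartImage_mono.{u} {p : ℕ} {X : TopCat.{u}} (e : OpenPartialHomeomorph X (Fin p → ℝ))
    {W W' : Opens X} (h : W' ≤ W) : chartImage e W' ≤ chartImage e W :=
  fun _ hx => ⟨hx.1, h hx.2⟩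

/-- A chart of a space with a sheaf `O` of superalgebras, graded by the parity involution `γ`:
an isomorphism of superalgebra sheaves from an open part of the space to a superdomain of
dimension `p|q`. -/
structure SuperChart.{u, v} (p q : ℕ) {X : TopCat.{u}} (O : TopCat.Presheaf (AlgCat.{v} ℝ) X)
    (γ : O ⟶ O) where
  /-- the underlying homeomorphism from an open subset of the space to an open subset of `ℝᵖ` -/
  map : OpenPartialHomeomorph X (Fin p → ℝ)
  /-- the isomorphism of sections over the open subsets of the source -/
  iso : ∀ W : Opens X, (W : Set X) ⊆ map.source →
    (O.obj (op W) ≃ₐ[ℝ] SuperFun q (chartImage map W))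
  iso_restrict : ∀ (W W' : Opens X) (hW : (W : Set X) ⊆ map.source) (h : W' ≤ W)
    (f : O.obj (op W)),
    iso W' (fun _ hx => hW (h hx)) ((O.map (homOfLE h).op).hom f) =
      SuperFun.restrict (chartImage_mono map h) (iso W hW f)
  iso_parity : ∀ (W : Opens X) (hW : (W : Set X) ⊆ map.source) (f : O.obj (op W)),
    iso W hW ((γ.app (op W)).hom f) = Grass.parity (iso W hW f)

/-- A smooth real supermanifold of dimension `p|q`: a Hausdorff second countable space with a
sheaf of superalgebras which is locally isomorphic to a superdomain of dimension `p|q`. The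
`ℤ/2`-grading of the sheaf is given by its parity involution. -/
structure Supermanifold.{u, v} (p q : ℕ) where
  /-- the underlying space -/
  X : TopCat.{u}
  t2 : T2Space X
  secondCountable : SecondCountableTopology X
  /-- the sheaf of superfunctions -/
  O : TopCat.Sheaf (AlgCat.{v} ℝ) X
  /-- the parity involution -/
  γ : O.presheaf ⟶ O.presheaf
  exists_chart : ∀ x : X, ∃ c : SuperChart p q O.presheaf γ, x ∈ c.map.source

namespace Supermanifold

universe u v

variable {p q : ℕ} (M : Supermanifold.{u, v} p q)

/-- The charts of `M`. -/
abbrev Chart := SuperChart p q M.O.presheaf M.γ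

variable {M}

namespace Chart

/-- The open subset of `ℝᵖ` that is the target of a chart. -/
def target (c : M.Chart) : Opens (Fin p → ℝ) := ⟨c.map.target, c.map.open_target⟩

/-- The common domain of two charts. -/
def overlap (c d : M.Chart) : Opens M.X :=
  ⟨c.map.source ∩ d.map.source, c.map.open_source.inter d.map.open_source⟩

/-- The overlap of two charts, in the coordinates of the first. -/
def left (c d : M.Chart) : Opens (Fin p → ℝ) := chartImage c.map (overlap c d)

/-- The overlap of two charts, in the coordinates of the second. -/
def right (c d : M.Chart) : Opens (Fin p → ℝ) := chartImage d.map (overlap c d)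

theorem left_le (c d : M.Chart) : left c d ≤ target c := fun _ hx => hx.1

theorem right_le (c d : M.Chart) : right c d ≤ target d := fun _ hx => hx.1

/-- The change of coordinates: it expresses in the chart `c` a superfunction on the overlap that
is given in the chart `d`. -/
def trans (c d : M.Chart) : SuperFun q (right c d) ≃ₐ[ℝ] SuperFun q (left c d) :=
  (d.iso (overlap c d) Set.inter_subset_right).symm.trans
    (c.iso (overlap c d) Set.inter_subset_left)

/-- The coordinate `a` of the chart `c`, as a superfunction in the chart `d`. -/
def coordLR (c d : M.Chart) (a : Fin p ⊕ Fin q) : SuperFun q (right c d) :=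
  (trans c d).symm (SuperFun.coord q (left c d) a)

/-- The coordinate `b` of the chart `d`, as a superfunction in the chart `c`. -/
def coordRL (c d : M.Chart) (b : Fin p ⊕ Fin q) : SuperFun q (left c d) :=
  trans c d (SuperFun.coord q (right c d) b)

/-- `∂_{b'} xᵃ`, expressed in the chart `c`, where `x` are the coordinates of `c` and `x'` those
of `d`. -/
def jac (c d : M.Chart) (b a : Fin p ⊕ Fin q) : SuperFun q (left c d) :=
  trans c d (SuperFun.pderiv b (coordLR c d a))

/-- `∑ (-1)^{e'} (∂_{b'} ∂_{e'} xᵃ) (∂_a x^{e'})`, expressed in the chart `c`: the logarithmic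
derivative along `x^{b'}` of the Berezinian of `∂x/∂x'`. -/
def logJac (c d : M.Chart) (b : Fin p ⊕ Fin q) : SuperFun q (left c d) :=
  ∑ e : Fin p ⊕ Fin q, ∑ a : Fin p ⊕ Fin q, sgn e •
    (trans c d (SuperFun.pderiv b (SuperFun.pderiv e (coordLR c d a))) *
      SuperFun.pderiv a (coordRL c d e))

/-- The Berezinian of `∂x'/∂x`, expressed in the chart `c`. -/
def ber (c d : M.Chart) : SuperFun q (left c d) :=
  berezinian (Matrix.of fun a b => SuperFun.pderiv a (coordRL c d b))

/-- The change of coordinates on `ΠT*M`, from the chart `d` to the chart `c`; its fibre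
coordinates transform as `x*_{b'} = ∑ (∂_{b'} xᵃ) x*_a`. -/
def cotTrans (c d : M.Chart) : CotFun q (right c d) → CotFun q (left c d) :=
  let anti' (b : Fin p ⊕ Fin q) : CotFun q (left c d) :=
    ∑ a : Fin p ⊕ Fin q, CotFun.ofBase (jac c d b a) * CotFun.anti q (left c d) a
  Fib.subst (fun f => CotFun.ofBase (trans c d (Grass.C f)))
    (fun α => anti' (Sum.inr α))
    (Fin.addCases (fun α => CotFun.ofBase (coordRL c d (Sum.inr α))) (fun a => anti' (Sum.inl a)))

/-- The change of coordinates on `ΠT*M̂`, from the chart `d` to the chart `c`: the density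
coordinate transforms as `t' = |Ber (∂x'/∂x)| t`, the fibre coordinates as
`x̂*_{b'} = ∑ (∂_{b'} xᵃ) x̂*_a + ∑ (-1)^{e'} (∂_{b'} ∂_{e'} xᵃ) (∂_a x^{e'}) w*`, and `w*` is
invariant. -/
def hatTrans (c d : M.Chart) : HatFun q (right c d) → HatFun q (left c d) :=
  let anti' (b : Fin p ⊕ Fin q) : HatFun q (left c d) :=
    ∑ a : Fin p ⊕ Fin q, HatFun.ofBase (jac c d b a) * HatFun.anti q (left c d) a +
      HatFun.ofBase (logJac c d b) * HatFun.wStar q (left c d)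
  Fib.subst
    (fun f => f.coeff.sum fun μ g =>
      HatFun.ofBase (trans c d (Grass.C g) * SuperFun.absRpow (ber c d) μ) *
        HatFun.tpow q (left c d) μ)
    (fun α => anti' (Sum.inr α))
    (Fin.lastCases (HatFun.wStar q (left c d))
      (Fin.addCases (fun α => HatFun.ofBase (coordRL c d (Sum.inr α)))
        (fun a => anti' (Sum.inl a))))

end Chart

variable (M)

/-- A function on `ΠT*M` that is polynomial in the fibre coordinates, given by its expressions
in all charts. -/
structure Cot where
  /-- the expression in a chart -/
  loc : ∀ c : M.Chart, CotFun q (Chart.target c)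
  compat : ∀ c d : M.Chart,
    Chart.cotTrans c d (CotFun.restrict (Chart.right_le c d) (loc d)) =
      CotFun.restrict (Chart.left_le c d) (loc c)

/-- A function on `ΠT*M̂` that is polynomial in the fibre coordinates, given by its expressions
in all charts of `M`. -/
structure Hat where
  /-- the expression in a chart -/
  loc : ∀ c : M.Chart, HatFun q (Chart.target c)
  compat : ∀ c d : M.Chart,
    Chart.hatTrans c d (HatFun.restrict (Chart.right_le c d) (loc d)) =
      HatFun.restrict (Chart.left_le c d) (loc c)

variable {M}

namespace Cot

/-- `s ∈ 𝔄^k(M)`: homogeneous of degree `k` in the fibre coordinates. -/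
def HasDegree (s : M.Cot) (k : ℤ) : Prop := ∀ c, Fib.HasDegree (s.loc c) k

/-- `s` is an even function. -/
def IsEven (s : M.Cot) : Prop := ∀ c, Grass.IsEven (s.loc c)

/-- `s` is an odd function. -/
def IsOdd (s : M.Cot) : Prop := ∀ c, Grass.IsOdd (s.loc c)

/-- `(s, u) = 0` for the canonical odd bracket. -/
def BracketZero (s u : M.Cot) : Prop := ∀ c, CotFun.bracket (s.loc c) (u.loc c) = 0

end Cot

namespace Hat

/-- `S ∈ 𝔄^k(M̂)`: homogeneous of degree `k` in the fibre coordinates. -/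
def HasDegree (S : M.Hat) (k : ℤ) : Prop := ∀ c, Fib.HasDegree (S.loc c) k

/-- `S` is an even function. -/
def IsEven (S : M.Hat) : Prop := ∀ c, Grass.IsEven (S.loc c)

/-- `S` has weight `μ`. -/
def HasWeight (S : M.Hat) (μ : ℝ) : Prop := ∀ c, HatFun.HasWeight (S.loc c) μ

/-- `(S, T) = 0` for the canonical odd bracket of `ΠT*M̂`. -/
def BracketZero (S T : M.Hat) : Prop := ∀ c, HatFun.bracket (S.loc c) (T.loc c) = 0

/-- `S` lies above `s`: the projection `t* ↦ 0` takes `S` to `s`. -/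
def LiesAbove (S : M.Hat) (s : M.Cot) : Prop :=
  ∀ c, HatFun.proj (S.loc c) = Fib.onCoeff (AddMonoidAlgebra.single 0) (s.loc c)

/-- `S` is the canonical lift of `s`, given in every chart by
`s(x, x̂*) + w* (Δ s)(x, x̂*)` with the coordinate divergence `Δ`. -/
def IsCanonicalLift (S : M.Hat) (s : M.Cot) : Prop :=
  ∀ c, S.loc c = HatFun.ofCot (s.loc c) +
    HatFun.wStar q (Chart.target c) * HatFun.ofCot (CotFun.divergence (s.loc c))

/-- `S = ŝ + Q w*`, where `Q w*` is given in every chart by `Q(x, x̂*) w*`. -/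
def IsShift (S ŝ : M.Hat) (Q : M.Cot) : Prop :=
  ∀ c, S.loc c = ŝ.loc c + HatFun.ofCot (Q.loc c) * HatFun.wStar q (Chart.target c)

end Hat

end Supermanifold

end SuperGeom

end

noncomputable section

namespace SuperGeom

variable {p q : ℕ}

/-! ### Signs and supercommutativity in Grassmann algebras -/

namespace Grass

variable {n : ℕ} {K : Type*}

/-! Since `w*` is odd, a function of weight zero on `ΠT*M̂` lying above `s` has in each chart a
unique form `s(x, x̂*) + g(x, x̂*) w*`, written `HatFun.norm s g` (`eq_norm_wCoeff`,
`norm_injective`). Everything reduces to two questions about the coefficient `g`: how it changes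
between charts, and when the bracket vanishes.

Gluing. Let `T` be the change of coordinates on `ΠT*M`. The image of `x̂*_b` is the image of `x*_b`
under `T` plus `L_b w*`, with `L_b` the logarithmic derivative of the Berezinian. As `w*` squares to
zero, the Taylor expansion in `w*` stops at first order: `norm f g` goes to `norm (T f) (T g +
parity (E f))`, where `E f = ∑ (-1)^b L_b T(∂f/∂x*_b)` is an odd derivation along `T` (`shift`,
`hat_subst_norm`). The same `E` measures the non-invariance of the coordinate divergence: `Δ T = T Δ
+ E` (`divergence_cotHom`). With `g = parity (Δ s) + Q`, where `w* Δs = parity (Δ s) w*`, the two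
defects cancel. So these local expressions are compatible exactly when the local `Q` are
(`hat_compat_iff`); `Q = 0` gives the canonical lift. The powers of the Berezinian play no role,
because the exponent is zero.

Bracket. For even `s` and odd `g`, the terms with `t` and `t*` contain `g * g = 0`, and the others
give `(s, s) + 2 (s, g) w*` (`bracket_norm`). The operator `Δ` generates the bracket, `Δ(fg) = Δf g
+ (-1)^f f Δg + (f, g)` (`divergence_mul`), and `Δ² = 0`. Applying `Δ` twice to `s * s` with `(s, s)
= 0` yields `(s, Δs) = 0` (`bracket_divergence_self`). Hence `(S, S) = 0` if and only if `(s, Q) =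
0`. Degree and parity of `S` translate directly into those of `Q`.

The analytic input is the chain rule for coordinate changes (`pderiv_hom`). These are given only as
abstract isomorphisms of algebras, so the chain rule rests on Hadamard's lemma: a derivation along
such a homomorphism that kills constants and coordinates is zero (`derivation_eq_zero`). -/

theorem inv_singleton_left (i : Fin n) (J : Finset (Fin n)) :
    inv {i} J = (J.filter (· < i)).card := by
  unfold inv
  rw [Finset.singleton_product, Finset.filter_map, Finset.card_map]
  rfl

theorem inv_singleton_right (J : Finset (Fin n)) (i : Fin n) :
    inv J {i} = (J.filter (i < ·)).card := by
  unfold inv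
  rw [Finset.product_singleton, Finset.filter_map, Finset.card_map]
  rfl

theorem card_filter_lt_add_card_filter_gt {i : Fin n} {J : Finset (Fin n)} (h : i ∉ J) :
    (J.filter (· < i)).card + (J.filter (i < ·)).card = J.card := by
  rw [← Finset.card_union_of_disjoint]
  · congr 1
    ext j
    simp only [Finset.mem_union, Finset.mem_filter]
    have : j ∈ J → j ≠ i := fun hj e => h (e ▸ hj)
    have := fun hj => lt_or_gt_of_ne (this hj)
    tauto
  · rw [Finset.disjoint_filter]
    intro j _ h1 h2
    exact lt_asymm h1 h2

/-- For disjoint sets each pair of `J × L` is an inversion in exactly one of the two orders. This is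
the sign rule behind supercommutativity. -/
theorem inv_add_inv {J L : Finset (Fin n)} (h : Disjoint J L) :
    inv J L + inv L J = J.card * L.card := by
  have : inv L J = ((J ×ˢ L).filter fun x => x.1 < x.2).card := by
    unfold inv
    refine Finset.card_bij (fun x _ => (x.2, x.1)) ?_ ?_ ?_
    · rintro ⟨a, b⟩ hx
      simp only [Finset.mem_filter, Finset.mem_product] at hx ⊢
      exact ⟨⟨hx.1.2, hx.1.1⟩, hx.2⟩
    · rintro ⟨a, b⟩ _ ⟨c, d⟩ _ e
      simp only [Prod.mk.injEq] at e
      simp [e.1, e.2]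
    · rintro ⟨a, b⟩ hx
      simp only [Finset.mem_filter, Finset.mem_product] at hx
      exact ⟨(b, a), by simp [hx.1.1, hx.1.2, hx.2], rfl⟩
  rw [this, inv, ← Finset.card_product, ← Finset.card_union_of_disjoint]
  · congr 1
    ext ⟨a, b⟩
    simp only [Finset.mem_union, Finset.mem_filter, Finset.mem_product]
    constructor
    · tauto
    · intro hx
      have : a ≠ b := fun e => Finset.disjoint_left.1 h hx.1 (e ▸ hx.2)
      have := lt_or_gt_of_ne this
      tauto
  · rw [Finset.disjoint_filter]
    intro j _ h1 h2
    exact lt_asymm h1 h2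

section Parity

variable [CommRing K]

/-- The constants as a ring homomorphism. -/
def CHom (n : ℕ) (K : Type*) [CommRing K] : K →+* Grass n K where
  toFun := C
  map_one' := rfl
  map_zero' := by ext I; simp [C]
  map_add' a b := by ext I; simp only [C, add_apply]; split_ifs <;> simp
  map_mul' a b := by
    ext I
    rw [C_mul_apply]
    simp [C]

@[simp] theorem CHom_apply (a : K) : CHom n K a = C a := rfl

theorem C_comm (a : K) (f : Grass n K) : C a * f = f * C a := by
  ext I
  rw [C_mul_apply, mul_C_apply]

/-- The parity involution as a ring homomorphism. -/
def parityHom (n : ℕ) (K : Type*) [CommRing K] : Grass n K →+* Grass n K where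
  toFun := parity
  map_one' := by
    ext I
    simp only [parity, one_apply]
    split_ifs with h <;> simp [h]
  map_zero' := by ext I; simp [parity]
  map_add' f g := by ext I; simp [parity, mul_add]
  map_mul' f g := by
    ext I
    simp only [parity, mul_apply, Finset.mul_sum]
    refine Finset.sum_congr rfl fun J hJ => ?_
    rw [← Finset.card_sdiff_add_card_eq_card (Finset.mem_powerset.1 hJ), pow_add]
    ring

@[simp] theorem parity_add (f g : Grass n K) : parity (f + g) = parity f + parity g :=
  map_add (parityHom n K) f g

@[simp] theorem parity_mul (f g : Grass n K) : parity (f * g) = parity f * parity g :=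
  map_mul (parityHom n K) f g

@[simp] theorem parity_zero : parity (0 : Grass n K) = 0 := map_zero (parityHom n K)

@[simp] theorem parity_zsmul (k : ℤ) (f : Grass n K) : parity (k • f) = k • parity f :=
  map_zsmul (parityHom n K) k f

@[simp] theorem parity_sum {ι : Type*} (s : Finset ι) (f : ι → Grass n K) :
    parity (∑ i ∈ s, f i) = ∑ i ∈ s, parity (f i) :=
  map_sum (parityHom n K) f s

@[simp] theorem parity_parity (f : Grass n K) : parity (parity f) = f := by
  ext I
  simp [parity, ← mul_assoc, ← mul_pow]

@[simp] theorem parity_C (a : K) : parity (C a : Grass n K) = C a := by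
  ext I
  simp only [parity, C]
  split_ifs with h <;> simp [h]

@[simp] theorem parity_gen (i : Fin n) : parity (gen i : Grass n K) = -gen i := by
  ext I
  change (-1) ^ I.card * gen i I = - gen i I
  simp only [gen]
  split_ifs with h <;> simp [h]

/-- `f` is homogeneous of parity `m`. -/
def HasPar (m : ℕ) (f : Grass n K) : Prop := parity f = (-1 : ℤ) ^ m • f

theorem hasPar_C (a : K) : HasPar 0 (C a : Grass n K) := by simp [HasPar]

theorem hasPar_gen (i : Fin n) : HasPar 1 (gen i : Grass n K) := by simp [HasPar]

theorem HasPar.mul {m k : ℕ} {f g : Grass n K} (hf : HasPar m f) (hg : HasPar k g) :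
    HasPar (m + k) (f * g) := by
  unfold HasPar at *
  rw [parity_mul, hf, hg, smul_mul_assoc, mul_smul_comm, smul_smul, pow_add]

theorem HasPar.add {m : ℕ} {f g : Grass n K} (hf : HasPar m f) (hg : HasPar m g) :
    HasPar m (f + g) := by
  unfold HasPar at *
  rw [parity_add, hf, hg, smul_add]

theorem HasPar.smul {m : ℕ} {f : Grass n K} (hf : HasPar m f) (k : ℤ) : HasPar m (k • f) := by
  unfold HasPar at *
  rw [parity_zsmul, hf, smul_comm]

theorem HasPar.sum {ι : Type*} {m : ℕ} {s : Finset ι} {f : ι → Grass n K}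
    (hf : ∀ i ∈ s, HasPar m (f i)) : HasPar m (∑ i ∈ s, f i) := by
  unfold HasPar at *
  rw [parity_sum, Finset.smul_sum]
  exact Finset.sum_congr rfl hf

theorem neg_one_pow_congr {m k : ℕ} (h : Even m ↔ Even k) : (-1 : ℤ) ^ m = (-1) ^ k := by
  rcases Nat.even_or_odd m with hm | hm
  · rw [hm.neg_one_pow, (h.1 hm).neg_one_pow]
  · rw [hm.neg_one_pow, (Nat.not_even_iff_odd.1 (mt h.2 (Nat.not_even_iff_odd.2 hm))).neg_one_pow]

theorem HasPar.congr {m k : ℕ} {f : Grass n K} (hf : HasPar m f) (h : Even m ↔ Even k) :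
    HasPar k f := by
  unfold HasPar at *
  rw [hf, neg_one_pow_congr h]

theorem HasPar.iterate {m : ℕ} {f : Grass n K} (hf : HasPar m f) (k : ℕ) :
    parity^[k] f = (-1 : ℤ) ^ (m * k) • f := by
  unfold HasPar at hf
  induction k with
  | zero => simp
  | succ k ih =>
    rw [Function.iterate_succ_apply', ih, parity_zsmul, hf, smul_smul, ← pow_add, Nat.mul_succ]

theorem parity_iterate_apply (m : ℕ) (f : Grass n K) (I : Finset (Fin n)) :
    parity^[m] f I = (-1) ^ (m * I.card) * f I := by
  induction m with
  | zero => simp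
  | succ m ih =>
    rw [Function.iterate_succ_apply', parity, ih, ← mul_assoc, ← pow_add]
    congr 2
    ring

/-- Real scalars exclude 2-torsion. This is what turns anticommutation into vanishing squares, kills
antisymmetric double sums, and removes the factor 2 in the bracket computations. -/
theorem eq_zero_of_eq_neg {R : Type*} [AddCommGroup R] [Module ℝ R] {x : R} (h : x = -x) :
    x = 0 := by
  have h2 : (2 : ℝ) • x = 0 := by rw [two_smul]; nth_rewrite 2 [h]; simp
  simpa using h2

variable [Algebra ℝ K]

theorem HasPar.even_add {m : ℕ} {f : Grass n K} (hf : HasPar m f) {I : Finset (Fin n)}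
    (h : f I ≠ 0) : Even (m + I.card) := by
  by_contra hodd
  rw [Nat.not_even_iff_odd] at hodd
  apply h
  apply eq_zero_of_eq_neg
  have h1 : (-1) ^ I.card * f I = (-1 : ℤ) ^ m • f I := congrFun hf I
  have h2 : (-1 : K) ^ m * ((-1) ^ I.card * f I) = (-1 : K) ^ m * ((-1 : ℤ) ^ m • f I) := by
    rw [h1]
  rw [← mul_assoc, ← pow_add, hodd.neg_one_pow, zsmul_eq_mul, ← mul_assoc] at h2
  push_cast at h2
  rw [← pow_add, Even.neg_one_pow ⟨m, rfl⟩] at h2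
  simpa using h2.symm

theorem hasPar_iff {m : ℕ} {f : Grass n K} :
    HasPar m f ↔ ∀ I, f I ≠ 0 → Even (m + I.card) := by
  refine ⟨fun h I hI => h.even_add hI, fun h => ?_⟩
  ext I
  change (-1) ^ I.card * f I = (-1 : ℤ) ^ m • f I
  by_cases hI : f I = 0
  · simp [hI]
  · rw [neg_one_pow_congr (Nat.even_add.1 (h I hI)), zsmul_eq_mul]
    push_cast
    rfl

theorem isEven_iff {f : Grass n K} : IsEven f ↔ HasPar 0 f := by
  rw [hasPar_iff]
  simp [IsEven]

theorem isOdd_iff {f : Grass n K} : IsOdd f ↔ HasPar 1 f := by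
  rw [hasPar_iff]
  refine forall_congr' fun I => forall_congr' fun _ => ?_
  rw [add_comm, Nat.even_add_one, Nat.not_even_iff_odd]

/-- A homogeneous element supercommutes with every element. -/
theorem HasPar.supercomm {m : ℕ} {f : Grass n K} (hf : HasPar m f) (g : Grass n K) :
    f * g = parity^[m] g * f := by
  ext I
  rw [mul_apply, mul_apply]
  refine Finset.sum_bij' (fun J _ => I \ J) (fun J _ => I \ J) ?_ ?_ ?_ ?_ ?_
  · intro J _; simp
  · intro J _; simp
  · intro J hJ; simp [Finset.mem_powerset.1 hJ]
  · intro J hJ; simp [Finset.mem_powerset.1 hJ]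
  · intro J hJ
    simp only [Finset.sdiff_sdiff_eq_self (Finset.mem_powerset.1 hJ), parity_iterate_apply]
    by_cases h : f J = 0
    · simp [h]
    have h1 := hf.even_add h
    have h2 := inv_add_inv (Finset.disjoint_sdiff (s := J) (t := I))
    -- The two inversion numbers add up to `J.card * (I \ J).card`, and `J.card` may be replaced by
    -- `m` because a nonzero coefficient `f J` forces them to have the same parity.
    have h3 : (-1 : K) ^ inv J (I \ J) = (-1) ^ inv (I \ J) J * (-1) ^ (m * (I \ J).card) := by
      have h4 : Even (inv J (I \ J) + (inv (I \ J) J + m * (I \ J).card)) := by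
        rw [← add_assoc, h2, ← add_mul, add_comm]
        exact h1.mul_right _
      have h5 := neg_one_pow_congr (Nat.even_add.1 h4)
      rw [← pow_add]
      exact_mod_cast congrArg (Int.cast : ℤ → K) h5
    rw [h3]
    ring

theorem HasPar.commute {f : Grass n K} (hf : HasPar 0 f) (g : Grass n K) : f * g = g * f :=
  hf.supercomm g

theorem HasPar.anticomm {f g : Grass n K} (hf : HasPar 1 f) (hg : HasPar 1 g) :
    f * g = -(g * f) := by
  have := hf.supercomm g
  unfold HasPar at hg
  rw [this, Function.iterate_one, hg]
  simp

theorem HasPar.mul_self {f : Grass n K} (hf : HasPar 1 f) : f * f = 0 :=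
  eq_zero_of_eq_neg (hf.anticomm hf)

end Parity

end Grass

namespace Grass

variable {n : ℕ} {K : Type*}

/-! ### Substitution homomorphisms -/

section Subst

variable {B : Type*} [Ring B] (Θ : Fin n → B)

/-- The ordered product `Θ^I`. -/
def ordProd (I : Finset (Fin n)) : B := ((I.sort (· ≤ ·)).map Θ).prod

@[simp] theorem ordProd_empty : ordProd Θ ∅ = 1 := by simp [ordProd]

theorem ordProd_insert {i : Fin n} {I : Finset (Fin n)} (h : ∀ j ∈ I, i < j) :
    ordProd Θ (insert i I) = Θ i * ordProd Θ I := by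
  unfold ordProd
  rw [Finset.sort_insert _ (fun j hj => (h j hj).le) (fun hi => lt_irrefl _ (h i hi))]
  simp

@[simp] theorem ordProd_singleton (i : Fin n) : ordProd Θ {i} = Θ i := by simp [ordProd]

variable {Θ}

/-- Sorting `Θ i` into place costs one sign for each smaller factor, and meeting itself gives zero.
The induction strips the least element, since that is the leftmost factor of the sorted product. -/
theorem mul_ordProd (h0 : ∀ i, Θ i * Θ i = 0) (h1 : ∀ i j, Θ i * Θ j = -(Θ j * Θ i))
    (i : Fin n) (J : Finset (Fin n)) :
    Θ i * ordProd Θ J =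
      if i ∈ J then 0 else (-1) ^ (J.filter (· < i)).card * ordProd Θ (insert i J) := by
  induction J using Finset.induction_on_min with
  | empty => simp
  | insert j J hj ih =>
    have hjJ : j ∉ J := fun h => lt_irrefl _ (hj j h)
    rw [ordProd_insert Θ hj]
    rcases lt_trichotomy i j with h | h | h
    · have hi : ∀ k ∈ insert j J, i < k := by
        intro k hk
        rcases Finset.mem_insert.1 hk with rfl | hk
        · exact h
        · exact h.trans (hj k hk)
      have hne : i ∉ insert j J := fun hh => lt_irrefl _ (hi i hh)
      have hf : (insert j J).filter (· < i) = ∅ := by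
        rw [Finset.filter_eq_empty_iff]
        exact fun k hk => (hi k hk).asymm
      rw [if_neg hne, hf, ordProd_insert Θ hi, ordProd_insert Θ hj]
      simp
    · subst h
      rw [← mul_assoc, h0]
      simp
    · rw [← mul_assoc, h1, neg_mul, mul_assoc, ih]
      by_cases hi : i ∈ J
      · simp [hi]
      · have hk : ∀ k ∈ insert i J, j < k := by
          intro k hk
          rcases Finset.mem_insert.1 hk with rfl | hk
          · exact h
          · exact hj k hk
        have hij : i ∉ insert j J := by simp [hi, h.ne']
        rw [if_neg hi, if_neg hij, Finset.insert_comm, ordProd_insert Θ hk, Finset.filter_insert,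
          if_pos h, Finset.card_insert_of_notMem (by simp [hjJ]), pow_succ]
        have hc : Commute (Θ j) ((-1) ^ (J.filter (· < i)).card) :=
          ((Commute.one_right _).neg_right).pow_right _
        rw [← mul_assoc, hc.eq]
        simp [mul_assoc]

theorem ordProd_mul_ordProd (h0 : ∀ i, Θ i * Θ i = 0) (h1 : ∀ i j, Θ i * Θ j = -(Θ j * Θ i))
    (I J : Finset (Fin n)) :
    ordProd Θ I * ordProd Θ J =
      if Disjoint I J then (-1) ^ inv I J * ordProd Θ (I ∪ J) else 0 := by
  induction I using Finset.induction_on_min with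
  | empty => simp [inv]
  | insert i I hi ih =>
    have hiI : i ∉ I := fun h => lt_irrefl _ (hi i h)
    rw [ordProd_insert Θ hi, mul_assoc, ih]
    by_cases hd : Disjoint I J
    · rw [if_pos hd]
      have hc : Commute (Θ i) ((-1) ^ inv I J) :=
        ((Commute.one_right _).neg_right).pow_right _
      rw [← mul_assoc, hc.eq, mul_assoc, mul_ordProd h0 h1]
      by_cases hiJ : i ∈ J
      · have : ¬ Disjoint (insert i I) J := by simp [hiJ]
        simp [hiJ]
      · have hd' : Disjoint (insert i I) J := by simp [hiJ, hd]
        rw [if_neg (by simp [hiI, hiJ]), if_pos hd', Finset.insert_union]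
        have hf : (I ∪ J).filter (· < i) = J.filter (· < i) := by
          rw [Finset.filter_union, Finset.filter_eq_empty_iff.2 fun k hk => (hi k hk).asymm]
          simp
        rw [hf, ← inv_singleton_left, ← mul_assoc, ← pow_add, Finset.insert_eq i I,
          inv_union_left (by simpa using hiI), add_comm]
    · have : ¬ Disjoint (insert i I) J := fun h => hd (by
        rw [Finset.disjoint_insert_left] at h; exact h.2)
      rw [if_neg hd, if_neg this, mul_zero]

theorem subst_eq_sum (κ : K → B) (f : Grass n K) :
    subst κ Θ f = ∑ I : Finset (Fin n), κ (f I) * ordProd Θ I := rfl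

variable [CommRing K]

/-- Central coefficients and anticommuting `Θ i` of square zero satisfy the defining relations of
the Grassmann algebra. In the product of the two sums, overlapping index pairs vanish, and a
disjoint pair corresponds to its union together with the first member as a subset. -/
theorem subst_mul (κ : K →+* B) (hκ : ∀ a b, κ a * b = b * κ a) (h0 : ∀ i, Θ i * Θ i = 0)
    (h1 : ∀ i j, Θ i * Θ j = -(Θ j * Θ i)) (f g : Grass n K) :
    subst κ Θ (f * g) = subst κ Θ f * subst κ Θ g := by
  simp only [subst_eq_sum]
  have e1 : ∀ I J : Finset (Fin n), κ (f I) * ordProd Θ I * (κ (g J) * ordProd Θ J) =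
      if Disjoint I J then κ ((-1) ^ inv I J * (f I * g J)) * ordProd Θ (I ∪ J) else 0 := by
    intro I J
    have : κ (f I) * ordProd Θ I * (κ (g J) * ordProd Θ J) =
        κ (f I) * κ (g J) * (ordProd Θ I * ordProd Θ J) := by
      rw [mul_assoc, ← mul_assoc (ordProd Θ I), ← hκ (g J)]
      simp only [mul_assoc]
    rw [this, ordProd_mul_ordProd h0 h1]
    split_ifs
    · rw [map_mul, map_mul, map_pow, map_neg, map_one]
      have hc : Commute (κ (f I) * κ (g J)) ((-1) ^ inv I J) :=
        ((Commute.one_right _).neg_right).pow_right _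
      rw [← mul_assoc, hc.eq]
    · simp
  rw [Finset.sum_mul_sum]
  simp only [e1, mul_apply, map_sum, Finset.sum_mul]
  rw [← Finset.sum_product', ← Finset.sum_filter, Finset.sum_sigma']
  refine Finset.sum_bij' (fun x _ => (x.2, x.1 \ x.2)) (fun x _ => ⟨x.1 ∪ x.2, x.1⟩) ?_ ?_ ?_ ?_ ?_
  · rintro ⟨I, J⟩ hx
    simp [Finset.disjoint_sdiff]
  · rintro ⟨I, J⟩ hx
    simp only [Finset.mem_sigma, Finset.mem_powerset, Finset.mem_univ, true_and]
    exact Finset.subset_union_left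
  · rintro ⟨I, J⟩ hx
    simp only [Finset.mem_sigma, Finset.mem_powerset, Finset.mem_univ, true_and] at hx
    simp [Finset.union_sdiff_of_subset hx]
  · rintro ⟨I, J⟩ hx
    simp only [Finset.mem_filter] at hx
    simp [Finset.union_sdiff_cancel_left hx.2]
  · rintro ⟨I, J⟩ hx
    simp only [Finset.mem_sigma, Finset.mem_powerset, Finset.mem_univ, true_and] at hx
    simp [Finset.union_sdiff_of_subset hx]

theorem subst_C (κ : K →+* B) (a : K) : subst κ Θ (C a) = κ a := by
  rw [subst_eq_sum, Finset.sum_eq_single ∅]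
  · simp [C]
  · intro I _ hI
    simp [C, hI]
  · simp

theorem subst_gen (κ : K →+* B) (i : Fin n) : subst κ Θ (gen i) = Θ i := by
  rw [subst_eq_sum, Finset.sum_eq_single {i}]
  · simp [gen]
  · intro I _ hI
    simp [gen, hI]
  · simp

/-- The substitution homomorphism. -/
def substHom (κ : K →+* B) (hκ : ∀ a b, κ a * b = b * κ a) (h0 : ∀ i, Θ i * Θ i = 0)
    (h1 : ∀ i j, Θ i * Θ j = -(Θ j * Θ i)) : Grass n K →+* B where
  toFun := subst κ Θ
  map_one' := (subst_C κ 1).trans κ.map_one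
  map_zero' := by simp [subst_eq_sum]
  map_add' f g := by simp [subst_eq_sum, add_mul, Finset.sum_add_distrib]
  map_mul' := subst_mul κ hκ h0 h1

end Subst

/-! ### The monomial basis -/

section Basis

variable [CommRing K]

/-- The monomial `θ^I`. -/
def mono (I : Finset (Fin n)) : Grass n K := fun J => if J = I then 1 else 0

theorem gen_mul_mono {i : Fin n} {I : Finset (Fin n)} (h : ∀ j ∈ I, i < j) :
    (gen i * mono I : Grass n K) = mono (insert i I) := by
  have hi : i ∉ I := fun hi => lt_irrefl _ (h i hi)
  ext J
  rw [mul_apply]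
  by_cases hJ : J = insert i I
  · subst hJ
    rw [Finset.sum_eq_single {i}]
    · have : insert i I \ {i} = I := by
        rw [Finset.insert_sdiff_of_mem _ (Finset.mem_singleton_self i)]
        simp [hi]
      rw [this, inv_singleton_left, Finset.filter_eq_empty_iff.2 fun k hk => (h k hk).asymm]
      simp [gen, mono]
    · intro L _ hL
      simp [gen, hL]
    · simp
  · rw [Finset.sum_eq_zero]
    · simp [mono, hJ]
    · intro L hL
      by_cases hL' : L = {i}
      · subst hL'
        have : J \ {i} ≠ I := by
          intro h
          apply hJ
          rw [← h]
          ext k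
          have := Finset.mem_powerset.1 hL (Finset.mem_singleton_self i)
          by_cases hk : k = i <;> simp [hk, this]
        simp [mono, this]
      · simp [gen, hL']

/-- An order embedding keeps the factors sorted, so no sign appears. -/
theorem ordProd_gen_comp {m : ℕ} (j : Fin m ↪o Fin n) (I : Finset (Fin m)) :
    ordProd (fun i => (gen (j i) : Grass n K)) I = mono (I.map j.toEmbedding) := by
  induction I using Finset.induction_on_min with
  | empty => rw [ordProd_empty, Finset.map_empty]; rfl
  | insert i I hi ih =>
    rw [ordProd_insert _ hi, ih, gen_mul_mono, Finset.map_insert]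
    · rfl
    · intro k hk
      obtain ⟨l, hl, rfl⟩ := Finset.mem_map.1 hk
      exact j.lt_iff_lt.2 (hi l hl)

theorem sum_apply {ι : Type*} (s : Finset ι) (f : ι → Grass n K) (I : Finset (Fin n)) :
    (∑ i ∈ s, f i) I = ∑ i ∈ s, f i I := Finset.sum_apply I s f

theorem eq_sum_C_mul_mono (f : Grass n K) : f = ∑ I, C (f I) * mono I := by
  ext J
  rw [sum_apply, Finset.sum_eq_single J]
  · simp [C_mul_apply, mono]
  · intro I _ hI
    simp [C_mul_apply, mono, hI.symm]
  · simp

/-- A property closed under sums and products holds if it holds for constants and generators. -/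
theorem induction_gen {P : Grass n K → Prop} (hC : ∀ a, P (C a)) (hgen : ∀ i, P (gen i))
    (hadd : ∀ f g, P f → P g → P (f + g)) (hmul : ∀ f g, P f → P g → P (f * g))
    (f : Grass n K) : P f := by
  have hmono : ∀ I : Finset (Fin n), P (mono I) := by
    intro I
    induction I using Finset.induction_on_min with
    | empty => exact hC 1
    | insert i I hi ih => rw [← gen_mul_mono hi]; exact hmul _ _ (hgen i) ih
  rw [eq_sum_C_mul_mono f]
  refine Finset.sum_induction _ P hadd ?_ fun I _ => hmul _ _ (hC _) (hmono I)
  have : (0 : Grass n K) = C 0 := ((CHom n K).map_zero).symm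
  rw [this]
  exact hC 0

end Basis

/-! ### Derivations along homomorphisms -/

section Der

variable {n' : ℕ} {K' : Type*} [CommRing K'] [CommRing K]

/-- `D` is a derivation of parity `m` along the map `T`. -/
structure IsDer (T : Grass n K → Grass n' K') (m : ℕ) (D : Grass n K → Grass n' K') : Prop where
  map_add : ∀ f g, D (f + g) = D f + D g
  map_mul : ∀ f g, D (f * g) = D f * T g + T (parity^[m] f) * D g

namespace IsDer

variable {T : Grass n K → Grass n' K'} {m : ℕ} {D D' : Grass n K → Grass n' K'}

theorem map_zero (h : IsDer T m D) : D 0 = 0 := by simpa using h.map_add 0 0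

theorem map_neg (h : IsDer T m D) (f : Grass n K) : D (-f) = -D f := by
  have := h.map_add f (-f)
  rw [add_neg_cancel, h.map_zero] at this
  exact (neg_eq_of_add_eq_zero_right this.symm).symm

/-- A derivation as an additive map. -/
def toAddHom (h : IsDer T m D) : Grass n K →+ Grass n' K' where
  toFun := D
  map_zero' := h.map_zero
  map_add' := h.map_add

theorem map_sum (h : IsDer T m D) {ι : Type*} (s : Finset ι) (f : ι → Grass n K) :
    D (∑ i ∈ s, f i) = ∑ i ∈ s, D (f i) := _root_.map_sum h.toAddHom f s

theorem map_zsmul (h : IsDer T m D) (k : ℤ) (f : Grass n K) : D (k • f) = k • D f :=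
  _root_.map_zsmul h.toAddHom k f

theorem add (h : IsDer T m D) (h' : IsDer T m D') : IsDer T m fun f => D f + D' f where
  map_add f g := by rw [h.map_add, h'.map_add]; abel
  map_mul f g := by rw [h.map_mul, h'.map_mul, add_mul, mul_add]; abel

theorem zero : IsDer T m fun _ => 0 := ⟨by simp, by simp⟩

theorem sum {ι : Type*} {s : Finset ι} {E : ι → Grass n K → Grass n' K'}
    (h : ∀ i ∈ s, IsDer T m (E i)) : IsDer T m fun f => ∑ i ∈ s, E i f := by
  classical
  induction s using Finset.induction_on with
  | empty => simpa using zero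
  | insert i s hi ih =>
    have := (h i (by simp)).add (ih fun j hj => h j (by simp [hj]))
    simpa [Finset.sum_insert hi] using this

theorem congr {k : ℕ} (h : IsDer T m D) (hk : Even m ↔ Even k) : IsDer T k D where
  map_add := h.map_add
  map_mul f g := by
    have : parity^[m] f = parity^[k] f := by
      ext I
      rw [parity_iterate_apply, parity_iterate_apply]
      congr 1
      have : Even (m * I.card) ↔ Even (k * I.card) := by simp [Nat.even_mul, hk]
      exact_mod_cast congrArg (Int.cast : ℤ → K) (neg_one_pow_congr this)
    rw [h.map_mul, this]

/-- Two derivations agree if they agree on constants and generators. -/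
theorem ext_gen (h : IsDer T m D) (h' : IsDer T m D') (hC : ∀ a, D (C a) = D' (C a))
    (hgen : ∀ i, D (gen i) = D' (gen i)) (f : Grass n K) : D f = D' f := by
  induction f using induction_gen with
  | hC a => exact hC a
  | hgen i => exact hgen i
  | hadd f g hf hg => rw [h.map_add, h'.map_add, hf, hg]
  | hmul f g hf hg => rw [h.map_mul, h'.map_mul, hf, hg]

/-- Commuting `c` past `T (parity^[l] f)` applies `k` further parity involutions, so parities add.
This is how vector fields with coefficients are built. -/
theorem mul_left [Algebra ℝ K'] (hT : ∀ f, T (parity f) = parity (T f)) {c : Grass n' K'} {k l : ℕ}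
    (hc : HasPar k c) (h : IsDer T l D) (hm : k + l = m) : IsDer T m fun f => c * D f where
  map_add f g := by rw [h.map_add, mul_add]
  map_mul f g := by
    have hT' : ∀ j, T (parity^[j] f) = parity^[j] (T f) := by
      intro j
      induction j with
      | zero => rfl
      | succ j ih => rw [Function.iterate_succ_apply', Function.iterate_succ_apply', hT, ih]
    rw [h.map_mul, mul_add, ← mul_assoc, ← mul_assoc, hT', hT', hc.supercomm (parity^[l] (T f)),
      ← Function.iterate_add_apply, hm, mul_assoc (parity^[m] (T f))]

/-- Precomposition with a homomorphism preserving the parity. -/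
theorem comp_hom {n₀ : ℕ} {K₀ : Type*} [CommRing K₀] {D : Grass n K → Grass n K}
    (h : IsDer id m D) (φ : Grass n₀ K₀ →+* Grass n K)
    (hφ : ∀ f, φ (parity f) = parity (φ f)) : IsDer φ m fun f => D (φ f) where
  map_add f g := by rw [RingHom.map_add, h.map_add]
  map_mul f g := by
    have : ∀ j, φ (parity^[j] f) = parity^[j] (φ f) := by
      intro j
      induction j with
      | zero => rfl
      | succ j ih => rw [Function.iterate_succ_apply', Function.iterate_succ_apply', hφ, ih]
    rw [RingHom.map_mul, h.map_mul, this]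
    rfl

/-- Composition with a homomorphism. -/
theorem hom_comp {D : Grass n K → Grass n K} (h : IsDer id m D) (φ : Grass n K →+* Grass n' K') :
    IsDer φ m fun f => φ (D f) where
  map_add f g := by rw [h.map_add, RingHom.map_add]
  map_mul f g := by rw [h.map_mul, RingHom.map_add, RingHom.map_mul, RingHom.map_mul]; rfl

end IsDer

/-! ### Left derivatives and coefficientwise derivations -/

theorem inv_insert_left {i : Fin n} {J : Finset (Fin n)} (hi : i ∉ J) (L : Finset (Fin n)) :
    inv (insert i J) L = (L.filter (· < i)).card + inv J L := by
  rw [Finset.insert_eq, inv_union_left (by simpa using hi), inv_singleton_left]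

theorem inv_insert_right {i : Fin n} (J : Finset (Fin n)) {L : Finset (Fin n)} (hi : i ∉ L) :
    inv J (insert i L) = (J.filter (i < ·)).card + inv J L := by
  rw [Finset.insert_eq, inv_union_right _ (by simpa using hi), inv_singleton_right]

theorem leftDeriv_mul (i : Fin n) (f g : Grass n K) :
    leftDeriv i (f * g) = leftDeriv i f * g + parity f * leftDeriv i g := by
  ext I
  rw [add_apply, mul_apply, mul_apply]
  have hsq : ∀ k : ℕ, (-1 : K) ^ k * (-1) ^ k = 1 := fun k => by
    rw [← mul_pow]; simp
  have key : ∀ I₀ : Finset (Fin n), i ∉ I₀ → ∀ J ∈ I₀.powerset, i ∉ J ∧ i ∉ I₀ \ J ∧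
      insert i I₀ \ J = insert i (I₀ \ J) ∧ insert i I₀ \ insert i J = I₀ \ J ∧
      (J.filter (· < i)).card + (J.filter (i < ·)).card = J.card ∧
      (I₀.filter (· < i)).card = (J.filter (· < i)).card + ((I₀ \ J).filter (· < i)).card := by
    intro I₀ hi J hJ
    rw [Finset.mem_powerset] at hJ
    have hiJ : i ∉ J := fun h => hi (hJ h)
    refine ⟨hiJ, by simp [hi], Finset.insert_sdiff_of_notMem _ hiJ, ?_,
      card_filter_lt_add_card_filter_gt hiJ, ?_⟩
    · rw [Finset.insert_sdiff_insert, Finset.sdiff_insert_of_notMem hi]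
    · rw [← Finset.card_union_of_disjoint, ← Finset.filter_union,
        Finset.union_sdiff_of_subset hJ]
      exact Finset.disjoint_filter_filter Finset.disjoint_sdiff
  by_cases hi : i ∈ I
  -- The left side has no monomial containing `θᵢ`. On the right, the term of the first product at
  -- `J` cancels that of the second at `insert i J`, for each `J ⊆ I₀`.
  · obtain ⟨I₀, hi₀, rfl⟩ : ∃ I₀, i ∉ I₀ ∧ I = insert i I₀ :=
      ⟨I.erase i, by simp, (Finset.insert_erase hi).symm⟩
    rw [Finset.sum_powerset_insert hi₀, Finset.sum_powerset_insert hi₀]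
    simp only [leftDeriv, parity, if_pos hi]
    rw [← Finset.sum_add_distrib, ← Finset.sum_add_distrib, ← Finset.sum_add_distrib, eq_comm]
    refine Finset.sum_eq_zero fun J hJ => ?_
    obtain ⟨h1, h2, h3, h4, h5, h6⟩ := key I₀ hi₀ J hJ
    rw [h3, h4, if_neg h1, if_neg h2, if_pos (Finset.mem_insert_self _ _),
      if_pos (Finset.mem_insert_self _ _), inv_insert_left h1, inv_insert_right J h2,
      Finset.card_insert_of_notMem h1, ← h5]
    simp only [pow_add, pow_one]
    linear_combination -((-1) ^ (J.filter (· < i)).card * (-1) ^ (J.filter (i < ·)).card *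
      (-1) ^ inv J (I₀ \ J) * f (insert i J) * g (insert i (I₀ \ J))) *
      hsq ((I₀ \ J).filter (· < i)).card
  · rw [leftDeriv, if_neg hi, mul_apply, Finset.sum_powerset_insert hi, ← Finset.sum_add_distrib,
      ← Finset.sum_add_distrib, Finset.mul_sum]
    refine Finset.sum_congr rfl fun J hJ => ?_
    obtain ⟨h1, h2, h3, h4, h5, h6⟩ := key I hi J hJ
    rw [h3, h4, inv_insert_left h1, inv_insert_right J h2, h6]
    simp only [leftDeriv, parity, if_neg h1, if_neg h2, ← h5, pow_add]
    linear_combination ((-1) ^ (J.filter (· < i)).card * (-1) ^ inv J (I \ J) *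
      f (insert i J) * g (I \ J)) * hsq ((I \ J).filter (· < i)).card

theorem isDer_leftDeriv (i : Fin n) : IsDer (n := n) (K := K) id 1 (leftDeriv i) where
  map_add f g := by
    ext I
    simp only [leftDeriv, add_apply]
    split_ifs <;> simp [mul_add]
  map_mul := leftDeriv_mul i

theorem map_mul_of_derivation {D : K → K} (h0 : ∀ a b, D (a + b) = D a + D b)
    (h1 : ∀ a b, D (a * b) = D a * b + a * D b) (f g : Grass n K) :
    map D (f * g) = map D f * g + f * map D g := by
  have h1' : D 1 = 0 := by simpa using h1 1 1
  have hz : D 0 = 0 := by simpa using h0 0 0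
  have hneg : ∀ a, D (-a) = - D a := fun a => by
    have := h0 a (-a)
    rw [add_neg_cancel, hz] at this
    exact (neg_eq_of_add_eq_zero_right this.symm).symm
  have hs : ∀ k a, D ((-1) ^ k * a) = (-1) ^ k * D a := by
    intro k a
    rcases neg_one_pow_eq_or K k with h | h <;> simp [h, hneg]
  have hsum : ∀ (s : Finset (Finset (Fin n))) (u : Finset (Fin n) → K),
      D (∑ i ∈ s, u i) = ∑ i ∈ s, D (u i) := fun s u =>
    map_sum (⟨⟨D, hz⟩, h0⟩ : K →+ K) u s
  ext I
  rw [add_apply, mul_apply, mul_apply, map, mul_apply, hsum, ← Finset.sum_add_distrib]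
  refine Finset.sum_congr rfl fun J _ => ?_
  rw [hs, h1]
  simp only [map]
  ring

theorem isDer_map {D : K → K} (h0 : ∀ a b, D (a + b) = D a + D b)
    (h1 : ∀ a b, D (a * b) = D a * b + a * D b) : IsDer (n := n) id 0 (map D) where
  map_add _ _ := funext fun _ => h0 _ _
  map_mul := map_mul_of_derivation h0 h1

theorem leftDeriv_C (i : Fin n) (a : K) : leftDeriv i (C a) = 0 := by
  ext I
  simp [leftDeriv, C]

theorem leftDeriv_gen (i j : Fin n) : leftDeriv i (gen j : Grass n K) = if i = j then 1 else 0 := by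
  ext I
  by_cases hij : i = j
  · subst hij
    rw [if_pos rfl, one_apply]
    simp only [leftDeriv, gen]
    by_cases hI : I = ∅
    · simp [hI]
    · rw [if_neg hI]
      split_ifs with h1 h2
      · rfl
      · exfalso
        apply hI
        rw [Finset.eq_empty_iff_forall_notMem]
        intro k hk
        have : k ∈ insert i I := Finset.mem_insert_of_mem hk
        rw [h2, Finset.mem_singleton] at this
        exact h1 (this ▸ hk)
      · simp
  · rw [if_neg hij]
    simp only [leftDeriv, gen, zero_apply]
    split_ifs with h1 h2
    · rfl
    · exfalso
      have : i ∈ insert i I := Finset.mem_insert_self _ _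
      rw [h2, Finset.mem_singleton] at this
      exact hij this
    · simp

theorem map_C {D : K → K'} (h : D 0 = 0) (a : K) : map D (C a : Grass n K) = C (D a) := by
  ext I
  simp only [map, C]
  split_ifs <;> simp [h]

theorem map_gen {D : K → K'} (h : D 0 = 0) (i : Fin n) :
    map D (gen i : Grass n K) = C (D 1) * gen i := by
  ext I
  rw [C_mul_apply]
  change D (gen i I) = _
  simp only [gen]
  split_ifs <;> simp [h]

/-! ### Commutation of the derivatives -/

theorem leftDeriv_leftDeriv (i j : Fin n) (f : Grass n K) :
    leftDeriv i (leftDeriv j f) = -leftDeriv j (leftDeriv i f) := by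
  wlog hij : i < j generalizing i j
  · rcases (not_lt.1 hij).eq_or_lt with rfl | h
    · ext I
      change leftDeriv j (leftDeriv j f) I = - leftDeriv j (leftDeriv j f) I
      simp [leftDeriv]
    · rw [this j i h, neg_neg]
  · ext I
    change leftDeriv i (leftDeriv j f) I = - leftDeriv j (leftDeriv i f) I
    simp only [leftDeriv, Finset.mem_insert, hij.ne, hij.ne', false_or]
    by_cases hi : i ∈ I
    · simp [hi]
    by_cases hj : j ∈ I
    · simp [hj]
    rw [if_neg hi, if_neg hj, if_neg hj, if_neg hi, Finset.filter_insert, Finset.filter_insert,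
      if_pos hij, if_neg hij.asymm, Finset.card_insert_of_notMem (by simp [hi]),
      Finset.insert_comm]
    ring

theorem leftDeriv_map {D : K → K'} (h0 : D 0 = 0) (hneg : ∀ a, D (-a) = -D a) (i : Fin n)
    (f : Grass n K) : leftDeriv i (map D f) = map D (leftDeriv i f) := by
  ext I
  simp only [map, leftDeriv]
  split_ifs
  · simp [h0]
  · rcases Nat.even_or_odd (I.filter (· < i)).card with he | he
    · simp [he.neg_one_pow]
    · simp [he.neg_one_pow, hneg]

theorem parity_leftDeriv (i : Fin n) (f : Grass n K) :
    parity (leftDeriv i f) = -leftDeriv i (parity f) := by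
  ext I
  change (-1) ^ I.card * leftDeriv i f I = -leftDeriv i (parity f) I
  simp only [leftDeriv, parity]
  split_ifs with h
  · simp
  · rw [Finset.card_insert_of_notMem h]
    ring

theorem parity_map {D : K → K'} (hneg : ∀ a, D (-a) = -D a) (f : Grass n K) :
    parity (map D f) = map D (parity f) := by
  ext I
  simp only [map, parity]
  rcases Nat.even_or_odd I.card with he | he
  · simp [he.neg_one_pow]
  · simp [he.neg_one_pow, hneg]

end Der

end Grass

/-! ### Partial derivatives of smooth functions -/

namespace Smooth

variable {V V' : Opens (Fin p → ℝ)}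

/-- The extension by zero of a smooth function. -/
def toFun (f : Smooth V) : (Fin p → ℝ) → ℝ := Function.extend Subtype.val f.1 0

theorem toFun_apply (f : Smooth V) {x : Fin p → ℝ} (hx : x ∈ V) : f.toFun x = f.1 ⟨x, hx⟩ :=
  extend_eq V f.1 hx

theorem contDiffAt (f : Smooth V) {x : Fin p → ℝ} (hx : x ∈ V) : ContDiffAt ℝ ∞ f.toFun x :=
  (show ContDiffOn ℝ ∞ f.toFun V from f.2).contDiffAt (V.2.mem_nhds hx)

theorem differentiableAt (f : Smooth V) {x : Fin p → ℝ} (hx : x ∈ V) :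
    DifferentiableAt ℝ f.toFun x := (f.contDiffAt hx).differentiableAt (by simp)

theorem pderiv_apply (a : Fin p) (f : Smooth V) (x : V) :
    (pderiv a f).1 x = fderiv ℝ f.toFun x (Pi.single a 1) := rfl

theorem pderiv_apply_of_eq (a : Fin p) {f : Smooth V} {g : (Fin p → ℝ) → ℝ}
    (h : ∀ x : V, f.1 x = g x) (x : V) : (pderiv a f).1 x = fderiv ℝ g x (Pi.single a 1) := by
  rw [pderiv_apply, Filter.EventuallyEq.fderiv_eq]
  filter_upwards [V.2.mem_nhds x.2] with y hy
  rw [toFun_apply f hy, h]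

theorem pderiv_add (a : Fin p) (f g : Smooth V) : pderiv a (f + g) = pderiv a f + pderiv a g := by
  ext x
  rw [pderiv_apply_of_eq a (g := fun y => f.toFun y + g.toFun y)]
  · rw [fderiv_fun_add (f.differentiableAt x.2) (g.differentiableAt x.2)]
    rfl
  · intro y
    simp [toFun_apply _ y.2]

theorem pderiv_mul (a : Fin p) (f g : Smooth V) :
    pderiv a (f * g) = pderiv a f * g + f * pderiv a g := by
  ext x
  rw [pderiv_apply_of_eq a (g := fun y => f.toFun y * g.toFun y)]
  · rw [fderiv_fun_mul (f.differentiableAt x.2) (g.differentiableAt x.2)]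
    simp [pderiv_apply, toFun_apply _ x.2]
    ring
  · intro y
    simp [toFun_apply _ y.2]

theorem pderiv_zero (a : Fin p) : pderiv a (0 : Smooth V) = 0 := by
  simpa using pderiv_add a (0 : Smooth V) 0

theorem pderiv_one (a : Fin p) : pderiv a (1 : Smooth V) = 0 := by
  simpa using pderiv_mul a (1 : Smooth V) 1

/-- The partial derivative as an additive map. -/
def pderivHom (a : Fin p) : Smooth V →+ Smooth V where
  toFun := pderiv a
  map_zero' := pderiv_zero a
  map_add' := pderiv_add a

theorem pderiv_neg (a : Fin p) (f : Smooth V) : pderiv a (-f) = -pderiv a f := by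
  have := pderiv_add a f (-f)
  rw [add_neg_cancel, pderiv_zero] at this
  exact (neg_eq_of_add_eq_zero_right this.symm).symm

/-- Both orders are values of the second Fréchet derivative, which is symmetric. -/
theorem pderiv_comm (a b : Fin p) (f : Smooth V) :
    pderiv a (pderiv b f) = pderiv b (pderiv a f) := by
  ext x
  have key : ∀ a b : Fin p, (pderiv a (pderiv b f)).1 x =
      fderiv ℝ (fderiv ℝ f.toFun) x (Pi.single a 1) (Pi.single b 1) := by
    intro a b
    have hd : DifferentiableAt ℝ (fderiv ℝ f.toFun) x :=
      ((f.contDiffAt x.2).fderiv_right (m := ∞) (by simp)).differentiableAt (by simp)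
    rw [pderiv_apply_of_eq a (g := fun y => fderiv ℝ f.toFun y (Pi.single b 1)) (fun y => rfl),
      fderiv_clm_apply hd (by fun_prop)]
    simp
  have hs : IsSymmSndFDerivAt ℝ f.toFun x :=
    (f.contDiffAt x.2).isSymmSndFDerivAt (by
      rw [minSmoothness_of_isRCLikeNormedField]; exact WithTop.coe_le_coe.2 le_top)
  rw [key, key, hs.eq]

theorem pderiv_coord (a b : Fin p) :
    pderiv a (coord V b) = if a = b then 1 else 0 := by
  ext x
  rw [pderiv_apply_of_eq a (g := fun y => y b) (fun y => rfl)]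
  have : fderiv ℝ (fun y : Fin p → ℝ => y b) x = ContinuousLinearMap.proj b :=
    (ContinuousLinearMap.proj (R := ℝ) (φ := fun _ : Fin p => ℝ) b).fderiv
  rw [this]
  by_cases h : a = b
  · subst h; simp
  · simp [h, Ne.symm h]

/-- Restriction as a ring homomorphism. -/
def restrictHom (h : V' ≤ V) : Smooth V →+* Smooth V' where
  toFun := restrict h
  map_one' := rfl
  map_zero' := rfl
  map_add' _ _ := rfl
  map_mul' _ _ := rfl

theorem restrict_pderiv (h : V' ≤ V) (a : Fin p) (f : Smooth V) :
    restrict h (pderiv a f) = pderiv a (restrict h f) := by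
  ext x
  rw [pderiv_apply_of_eq a (g := f.toFun) (fun y => (toFun_apply f (h y.2)).symm)]
  rfl

end Smooth

/-! ### Signs -/

theorem par_inl (a : Fin p) : par (Sum.inl a : Fin p ⊕ Fin q) = 0 := rfl

theorem par_eq (a : Fin p ⊕ Fin q) : par a = 0 ∨ par a = 1 := by
  rcases a with a | a
  · exact Or.inl rfl
  · exact Or.inr rfl

/-! ### Superfunctions -/

namespace SuperFun

variable {V : Opens (Fin p → ℝ)}

theorem isDer_pderiv (a : Fin p ⊕ Fin q) :
    Grass.IsDer id (par a) (pderiv a : SuperFun q V → SuperFun q V) := by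
  rcases a with a | a
  · exact Grass.isDer_map (Smooth.pderiv_add a) (Smooth.pderiv_mul a)
  · exact Grass.isDer_leftDeriv a

theorem parity_pderiv (a : Fin p ⊕ Fin q) (f : SuperFun q V) :
    Grass.parity (pderiv a f) = (-1 : ℤ) ^ par a • pderiv a (Grass.parity f) := by
  rcases a with a | a
  · simpa [par, pderiv] using Grass.parity_map (Smooth.pderiv_neg a) f
  · simpa [par, pderiv] using Grass.parity_leftDeriv a f

theorem pderiv_pderiv (a b : Fin p ⊕ Fin q) (f : SuperFun q V) :
    pderiv a (pderiv b f) = (-1 : ℤ) ^ (par a * par b) • pderiv b (pderiv a f) := by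
  rcases a with a | a <;> rcases b with b | b
  · simp only [par, pderiv, Sum.elim_inl, mul_zero, pow_zero, one_smul]
    exact funext fun I => Smooth.pderiv_comm a b (f I)
  · simp only [par, pderiv, Sum.elim_inl, zero_mul, pow_zero, one_smul]
    exact (Grass.leftDeriv_map (Smooth.pderiv_zero a) (Smooth.pderiv_neg a) b f).symm
  · simp only [par, pderiv, Sum.elim_inl, mul_zero, pow_zero, one_smul]
    exact Grass.leftDeriv_map (Smooth.pderiv_zero b) (Smooth.pderiv_neg b) a f
  · simpa [par, pderiv] using Grass.leftDeriv_leftDeriv a b f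

theorem pderiv_coord (a b : Fin p ⊕ Fin q) :
    pderiv a (coord q V b) = if a = b then 1 else 0 := by
  rcases a with a | a <;> rcases b with b | b
  · simp only [pderiv, coord]
    rw [Grass.map_C (Smooth.pderiv_zero a), Smooth.pderiv_coord]
    by_cases h : a = b
    · simp only [h, if_true]; rfl
    · rw [if_neg h, if_neg (by simpa using h)]; exact map_zero (Grass.CHom q (Smooth V))
  · simp only [pderiv, coord]
    rw [Grass.map_gen (Smooth.pderiv_zero a), Smooth.pderiv_one, ← Grass.CHom_apply, map_zero]
    simp
  · simp [pderiv, coord, Grass.leftDeriv_C]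
  · simp [pderiv, coord, Grass.leftDeriv_gen]

theorem hasPar_coord (a : Fin p ⊕ Fin q) : Grass.HasPar (par a) (coord q V a) := by
  rcases a with a | a
  · exact Grass.hasPar_C _
  · exact Grass.hasPar_gen _

end SuperFun

/-! ### Polynomial fibre functions -/

namespace Fib

variable {n : ℕ} {F : Type*} [CommRing F]

open Grass MvPolynomial

/-- Apply a map to all coefficients of a polynomial. -/
def polyMap {G : Type*} [CommRing G] (D : F → G) (P : MvPolynomial (Fin q) F) :
    MvPolynomial (Fin q) G := ∑ m ∈ P.support, monomial m (D (P.coeff m))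

theorem coeff_polyMap {G : Type*} [CommRing G] {D : F → G} (h : D 0 = 0)
    (P : MvPolynomial (Fin q) F) (m : Fin q →₀ ℕ) :
    (polyMap D P).coeff m = D (P.coeff m) := by
  rw [polyMap, coeff_sum]
  simp only [coeff_monomial]
  rw [Finset.sum_ite_eq']
  split_ifs with hm
  · rfl
  · rw [notMem_support_iff.1 hm, h]

theorem coeff_onCoeff {G : Type*} [CommRing G] {D : F → G} (h : D 0 = 0) (f : Fib n q F)
    (I : Finset (Fin n)) (m : Fin q →₀ ℕ) : (onCoeff D f I).coeff m = D ((f I).coeff m) :=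
  coeff_polyMap h _ m

theorem polyMap_eq_map {G : Type*} [CommRing G] (φ : F →+* G) (P : MvPolynomial (Fin q) F) :
    polyMap φ P = MvPolynomial.map φ P := by
  ext m
  rw [coeff_polyMap φ.map_zero, coeff_map]

section Additive

variable {G : Type*} [CommRing G] (D : F →+ G)

/-- `polyMap` of an additive map, as an additive map. -/
def polyMapHom : MvPolynomial (Fin q) F →+ MvPolynomial (Fin q) G where
  toFun := polyMap D
  map_zero' := by ext m; rw [coeff_polyMap D.map_zero]; simp
  map_add' P Q := by ext m; simp [coeff_polyMap D.map_zero]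

theorem polyMapHom_apply (P : MvPolynomial (Fin q) F) : polyMapHom D P = polyMap D P := rfl

theorem polyMap_C (a : F) : polyMap D (MvPolynomial.C a : MvPolynomial (Fin q) F) =
    MvPolynomial.C (D a) := by
  ext m
  rw [coeff_polyMap D.map_zero, coeff_C, coeff_C]
  split_ifs <;> simp

theorem polyMap_X (h : D 1 = 0) (α : Fin q) : polyMap D (X α : MvPolynomial (Fin q) F) = 0 := by
  ext m
  rw [coeff_polyMap D.map_zero, coeff_X, coeff_zero]
  split_ifs <;> simp [h]

theorem mul_natCast_succ (c : F) (k : ℕ) : c * ((k : F) + 1) = (k + 1) • c := by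
  rw [nsmul_eq_mul]
  push_cast
  ring

theorem polyMap_pderiv (α : Fin q) (P : MvPolynomial (Fin q) F) :
    polyMap D (MvPolynomial.pderiv α P) = MvPolynomial.pderiv α (polyMap D P) := by
  ext m
  rw [coeff_polyMap D.map_zero, coeff_pderiv, coeff_pderiv, coeff_polyMap D.map_zero]
  rw [mul_natCast_succ, mul_natCast_succ, map_nsmul]

variable {D : F →+ F}

theorem polyMap_mul (h : ∀ a b, D (a * b) = D a * b + a * D b) (P Q : MvPolynomial (Fin q) F) :
    polyMap D (P * Q) = polyMap D P * Q + P * polyMap D Q := by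
  ext m
  rw [coeff_polyMap D.map_zero, coeff_add, coeff_mul, coeff_mul, coeff_mul, map_sum,
    ← Finset.sum_add_distrib]
  refine Finset.sum_congr rfl fun x _ => ?_
  rw [h, coeff_polyMap D.map_zero, coeff_polyMap D.map_zero]

theorem isDer_onCoeff (h : ∀ a b, D (a * b) = D a * b + a * D b) :
    IsDer (n := n) id 0 (onCoeff (q := q) D) :=
  Grass.isDer_map (polyMapHom (q := q) D).map_add (polyMap_mul h)

end Additive

theorem isDer_pderiv (α : Fin q) :
    IsDer (n := n) (K := MvPolynomial (Fin q) F) id 0 (Grass.map (MvPolynomial.pderiv α)) :=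
  Grass.isDer_map (fun _ _ => map_add _ _ _) fun a b => by
    rw [Derivation.leibniz, smul_eq_mul, smul_eq_mul]; ring

theorem pderiv_pderiv_comm (α β : Fin q) (P : MvPolynomial (Fin q) F) :
    MvPolynomial.pderiv α (MvPolynomial.pderiv β P) =
      MvPolynomial.pderiv β (MvPolynomial.pderiv α P) := by
  ext m
  simp only [coeff_pderiv]
  rw [add_right_comm]
  by_cases h : α = β
  · subst h; rfl
  · simp [Ne.symm h, h]
    ring

/-- A property closed under sums and products holds if it holds for the base and the
generators. -/
theorem induction_gen {P : Fib n q F → Prop} (hbase : ∀ a, P (base a))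
    (hX : ∀ α, P (Grass.C (X α))) (hgen : ∀ i, P (gen i))
    (hadd : ∀ f g, P f → P g → P (f + g)) (hmul : ∀ f g, P f → P g → P (f * g))
    (f : Fib n q F) : P f := by
  refine Grass.induction_gen (fun Q => ?_) hgen hadd hmul f
  induction Q using MvPolynomial.induction_on with
  | C a => exact hbase a
  | add Q R hQ hR =>
    have := hadd _ _ hQ hR
    rwa [← CHom_apply, ← CHom_apply, ← map_add] at this
  | mul_X Q α hQ =>
    have := hmul _ _ hQ (hX α)
    rwa [← CHom_apply, ← CHom_apply, ← map_mul] at this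

/-- The inclusion of the base as a ring homomorphism. -/
def baseHom (n q : ℕ) (F : Type*) [CommRing F] : F →+* Fib n q F :=
  (Grass.CHom n (MvPolynomial (Fin q) F)).comp MvPolynomial.C

section Target

variable {n' : ℕ} {K' : Type*} [CommRing K']

theorem der_ext {T D D' : Fib n q F → Grass n' K'} {m : ℕ} (h : IsDer T m D) (h' : IsDer T m D')
    (hbase : ∀ a, D (base a) = D' (base a))
    (hX : ∀ α, D (Grass.C (X α)) = D' (Grass.C (X α)))
    (hgen : ∀ i, D (gen i) = D' (gen i)) (f : Fib n q F) : D f = D' f := by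
  induction f using induction_gen with
  | hbase a => exact hbase a
  | hX α => exact hX α
  | hgen i => exact hgen i
  | hadd f g hf hg => rw [h.map_add, h'.map_add, hf, hg]
  | hmul f g hf hg => rw [h.map_mul, h'.map_mul, hf, hg]

theorem hom_ext {B : Type*} [Ring B] {T T' : Fib n q F →+* B}
    (hbase : ∀ a, T (base a) = T' (base a))
    (hX : ∀ α, T (Grass.C (X α)) = T' (Grass.C (X α)))
    (hgen : ∀ i, T (gen i) = T' (gen i)) : T = T' := by
  ext f
  induction f using induction_gen with
  | hbase a => exact hbase a
  | hX α => exact hX α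
  | hgen i => exact hgen i
  | hadd f g hf hg => rw [map_add, map_add, hf, hg]
  | hmul f g hf hg => rw [map_mul, map_mul, hf, hg]

variable [Algebra ℝ K'] (κ : F →+* Grass n' K') (η : Fin q → Grass n' K')

/-- Evaluating polynomials requires a commutative target; even elements are central, so the
evaluation can be performed in the centre. -/
theorem mem_center {f : Grass n' K'} (h : HasPar 0 f) : f ∈ Subring.center (Grass n' K') :=
  Subring.mem_center_iff.2 fun g => (h.commute g).symm

variable {κ η}

/-- Evaluation of a polynomial at even elements. -/
def evalHom (hκ : ∀ a, HasPar 0 (κ a)) (hη : ∀ α, HasPar 0 (η α)) :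
    MvPolynomial (Fin q) F →+* Grass n' K' :=
  (Subring.center (Grass n' K')).subtype.comp
    (eval₂Hom (κ.codRestrict _ fun a => mem_center (hκ a)) fun α => ⟨η α, mem_center (hη α)⟩)

theorem evalHom_eq_sum (hκ : ∀ a, HasPar 0 (κ a)) (hη : ∀ α, HasPar 0 (η α))
    (P : MvPolynomial (Fin q) F) : evalHom hκ hη P =
      ∑ m ∈ P.support, κ (P.coeff m) * (List.ofFn fun α => η α ^ m α).prod := by
  rw [evalHom, RingHom.comp_apply, coe_eval₂Hom, eval₂_eq', map_sum]
  refine Finset.sum_congr rfl fun m _ => ?_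
  rw [← List.prod_ofFn, map_mul, map_list_prod, List.map_ofFn]
  rfl

/-- The substitution homomorphism with values in a superalgebra. -/
def substHom (hκ : ∀ a, HasPar 0 (κ a)) (hη : ∀ α, HasPar 0 (η α)) {Θ : Fin n → Grass n' K'}
    (hΘ : ∀ i, HasPar 1 (Θ i)) : Fib n q F →+* Grass n' K' :=
  Grass.substHom (Θ := Θ) (evalHom hκ hη)
    (fun P b => (Subring.mem_center_iff.1 (Subtype.prop (eval₂Hom (κ.codRestrict
      (Subring.center (Grass n' K')) fun a => mem_center (hκ a))
      (fun α => ⟨η α, mem_center (hη α)⟩) P)) b).symm)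
    (fun i => (hΘ i).mul_self) fun i j => (hΘ i).anticomm (hΘ j)

variable (hκ : ∀ a, HasPar 0 (κ a)) (hη : ∀ α, HasPar 0 (η α)) {Θ : Fin n → Grass n' K'}
    (hΘ : ∀ i, HasPar 1 (Θ i))

theorem substHom_apply (f : Fib n q F) : substHom hκ hη hΘ f = subst κ η Θ f := by
  unfold Fib.subst
  rw [← funext (evalHom_eq_sum hκ hη)]
  rfl

theorem substHom_base (a : F) : substHom hκ hη hΘ (base a) = κ a := by
  refine (Grass.subst_C (Θ := Θ) (evalHom hκ hη) _).trans ?_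
  simp [evalHom]

theorem substHom_X (α : Fin q) : substHom hκ hη hΘ (Grass.C (X α)) = η α := by
  refine (Grass.subst_C (Θ := Θ) (evalHom hκ hη) _).trans ?_
  simp [evalHom]

theorem substHom_gen (i : Fin n) : substHom hκ hη hΘ (gen i) = Θ i :=
  Grass.subst_gen (evalHom hκ hη) i

theorem substHom_parity (f : Fib n q F) :
    substHom hκ hη hΘ (parity f) = parity (substHom hκ hη hΘ f) := by
  induction f using induction_gen with
  | hbase a =>
    rw [show parity (base a : Fib n q F) = base a from parity_C _]
    have := hκ a
    rw [← substHom_base hκ hη hΘ] at this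
    simpa [HasPar] using this.symm
  | hX α =>
    rw [parity_C]
    have := hη α
    rw [← substHom_X hκ hη hΘ] at this
    simpa [HasPar] using this.symm
  | hgen i =>
    rw [parity_gen, map_neg]
    have := hΘ i
    rw [← substHom_gen hκ hη hΘ] at this
    simpa [HasPar] using this.symm
  | hadd f g hf hg => rw [parity_add, map_add, map_add, parity_add, hf, hg]
  | hmul f g hf hg => rw [parity_mul, map_mul, map_mul, parity_mul, hf, hg]

end Target

end Fib

theorem sgn_eq (a : Fin p ⊕ Fin q) : sgn a = (-1) ^ par a := rfl

namespace CotFun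

open Grass

variable {V : Opens (Fin p → ℝ)}

/-! ### The derivatives on the odd cotangent bundle -/

theorem isDer_dx (a : Fin p ⊕ Fin q) :
    IsDer id (par a) (dx a : CotFun q V → CotFun q V) := by
  rcases a with a | a
  · exact Fib.isDer_onCoeff (D := Smooth.pderivHom a) (Smooth.pderiv_mul a)
  · exact isDer_leftDeriv _

theorem isDer_dxs (a : Fin p ⊕ Fin q) :
    IsDer id (par a + 1) (dxs a : CotFun q V → CotFun q V) := by
  rcases a with a | a
  · exact isDer_leftDeriv _
  -- The derivative along an even antimomentum has parity `0`, while `par a + 1 = 2` here; only the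
  -- residue modulo 2 matters.
  · exact (Fib.isDer_pderiv a).congr (by simp [par])

theorem parity_dx (a : Fin p ⊕ Fin q) (f : CotFun q V) :
    parity (dx a f) = (-1 : ℤ) ^ par a • dx a (parity f) := by
  rcases a with a | a
  · rw [par_inl, pow_zero, one_smul]
    exact parity_map (Fib.polyMapHom (q := q) (Smooth.pderivHom a)).map_neg f
  · simpa [par, dx] using parity_leftDeriv _ f

theorem parity_dxs (a : Fin p ⊕ Fin q) (f : CotFun q V) :
    parity (dxs a f) = (-1 : ℤ) ^ (par a + 1) • dxs a (parity f) := by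
  rcases a with a | a
  · simpa [par, dxs] using parity_leftDeriv _ f
  · simpa [par, dxs] using parity_map (fun P => map_neg (MvPolynomial.pderiv (R := Smooth V) a) P) f

theorem dx_dx (a b : Fin p ⊕ Fin q) (f : CotFun q V) :
    dx a (dx b f) = (-1 : ℤ) ^ (par a * par b) • dx b (dx a f) := by
  have hz : ∀ a : Fin p, Fib.polyMap (q := q) (Smooth.pderiv (V := V) a) 0 = 0 := fun a =>
    (Fib.polyMapHom (q := q) (Smooth.pderivHom a)).map_zero
  have hn : ∀ (a : Fin p) P, Fib.polyMap (q := q) (Smooth.pderiv (V := V) a) (-P) =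
      -Fib.polyMap (q := q) (Smooth.pderiv (V := V) a) P := fun a =>
    (Fib.polyMapHom (q := q) (Smooth.pderivHom a)).map_neg
  rcases a with a | a <;> rcases b with b | b
  · simp only [par, dx, Sum.elim_inl, mul_zero, pow_zero, one_smul]
    refine funext fun I => ?_
    refine MvPolynomial.ext _ _ fun m => ?_
    simp only [Fib.coeff_onCoeff (Smooth.pderiv_zero _)]
    exact Smooth.pderiv_comm a b _
  · simp only [par, dx, Sum.elim_inl, zero_mul, pow_zero, one_smul]
    exact (leftDeriv_map (hz a) (hn a) _ f).symm
  · simp only [par, dx, Sum.elim_inl, mul_zero, pow_zero, one_smul]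
    exact leftDeriv_map (hz b) (hn b) _ f
  · simpa [par, dx] using leftDeriv_leftDeriv _ _ f

theorem dxs_dxs (a b : Fin p ⊕ Fin q) (f : CotFun q V) :
    dxs a (dxs b f) = (-1 : ℤ) ^ ((par a + 1) * (par b + 1)) • dxs b (dxs a f) := by
  rcases a with a | a <;> rcases b with b | b
  · simpa [par, dxs] using leftDeriv_leftDeriv _ _ f
  · simpa [par, dxs] using
      leftDeriv_map (map_zero _) (map_neg (MvPolynomial.pderiv (R := Smooth V) b)) _ f
  · simpa [par, dxs] using
      (leftDeriv_map (map_zero _) (map_neg (MvPolynomial.pderiv (R := Smooth V) a)) _ f).symm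
  · simp only [par, dxs, Sum.elim_inr]
    norm_num
    exact funext fun I => Fib.pderiv_pderiv_comm a b (f I)

theorem dx_dxs (a b : Fin p ⊕ Fin q) (f : CotFun q V) :
    dx a (dxs b f) = (-1 : ℤ) ^ (par a * (par b + 1)) • dxs b (dx a f) := by
  have hz : ∀ a : Fin p, Fib.polyMap (q := q) (Smooth.pderiv (V := V) a) 0 = 0 := fun a =>
    (Fib.polyMapHom (q := q) (Smooth.pderivHom a)).map_zero
  have hn : ∀ (a : Fin p) P, Fib.polyMap (q := q) (Smooth.pderiv (V := V) a) (-P) =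
      -Fib.polyMap (q := q) (Smooth.pderiv (V := V) a) P := fun a =>
    (Fib.polyMapHom (q := q) (Smooth.pderivHom a)).map_neg
  rcases a with a | a <;> rcases b with b | b
  · simp only [par, dx, dxs, Sum.elim_inl, zero_mul, pow_zero, one_smul]
    exact (leftDeriv_map (hz a) (hn a) _ f).symm
  · simp only [par, dx, dxs, Sum.elim_inl, zero_mul, pow_zero, one_smul]
    exact funext fun I => Fib.polyMap_pderiv (Smooth.pderivHom a) b (f I)
  · simpa [par, dx, dxs] using leftDeriv_leftDeriv _ _ f
  · simpa [par, dx, dxs] using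
      leftDeriv_map (map_zero _) (map_neg (MvPolynomial.pderiv (R := Smooth V) b)) _ f

theorem dxs_dx (a b : Fin p ⊕ Fin q) (f : CotFun q V) :
    dxs a (dx b f) = (-1 : ℤ) ^ (par b * (par a + 1)) • dx b (dxs a f) := by
  rw [dx_dxs b a, smul_smul, ← pow_add, Even.neg_one_pow ⟨_, rfl⟩, one_smul]

theorem hasPar_dx {a : Fin p ⊕ Fin q} {m : ℕ} {f : CotFun q V} (hf : HasPar m f) :
    HasPar (par a + m) (dx a f) := by
  unfold HasPar at *
  rw [parity_dx, hf, (isDer_dx a).map_zsmul, smul_smul, pow_add]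

theorem hasPar_dxs {a : Fin p ⊕ Fin q} {m : ℕ} {f : CotFun q V} (hf : HasPar m f) :
    HasPar (par a + 1 + m) (dxs a f) := by
  unfold HasPar at *
  rw [parity_dxs, hf, (isDer_dxs a).map_zsmul, smul_smul, pow_add _ (par a + 1)]

/-! ### The divergence operator generates the bracket -/

theorem add_add_add_rotate {R : Type*} [AddCommGroup R] (a b c d : R) :
    a + b + (c + d) = a + d + (b + c) := by abel

theorem parity_iterate_dxs (a : Fin p ⊕ Fin q) (f : CotFun q V) :
    parity^[par a] (dxs a f) = dxs a (parity^[par a] f) := by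
  rcases par_eq a with h | h
  · simp only [h, Function.iterate_zero, id]
  · rw [h, Function.iterate_one, parity_dxs, h]
    norm_num

theorem parity_iterate_iterate (a : Fin p ⊕ Fin q) (f : CotFun q V) :
    parity^[par a] (parity^[par a + 1] f) = parity f := by
  rcases par_eq a with h | h
  · simp only [h, Function.iterate_zero, id, zero_add, Function.iterate_one]
  · simp only [h, Function.iterate_succ, Function.comp_apply, Function.iterate_zero, id,
      parity_parity]

theorem dx_dxs_mul (a : Fin p ⊕ Fin q) (f g : CotFun q V) :
    dx a (dxs a (f * g)) = dx a (dxs a f) * g + parity f * dx a (dxs a g) +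
      (dxs a (parity^[par a] f) * dx a g + dx a (parity^[par a + 1] f) * dxs a g) := by
  have h1 : dxs a (f * g) = dxs a f * g + parity^[par a + 1] f * dxs a g :=
    (isDer_dxs a).map_mul f g
  have h2 : ∀ u v : CotFun q V, dx a (u * v) = dx a u * v + parity^[par a] u * dx a v :=
    (isDer_dx a).map_mul
  rw [h1, (isDer_dx a).map_add, h2, h2, parity_iterate_dxs, parity_iterate_iterate]
  exact add_add_add_rotate _ _ _ _

/-- Applying the Leibniz rule twice leaves, besides the two terms where both derivatives hit the
same factor, two mixed terms, which are the summands of the bracket. So the bracket is the failure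
of the second-order operator to be a derivation. -/
theorem divergence_mul (f g : CotFun q V) :
    divergence (f * g) = divergence f * g + parity f * divergence g + bracket f g := by
  have h1 : divergence f * g = ∑ a : Fin p ⊕ Fin q, sgn a • (dx a (dxs a f) * g) := by
    rw [divergence, Finset.sum_mul]
    exact Finset.sum_congr rfl fun a _ => smul_mul_assoc _ _ _
  have h2 : parity f * divergence g =
      ∑ a : Fin p ⊕ Fin q, sgn a • (parity f * dx a (dxs a g)) := by
    rw [divergence, Finset.mul_sum]
    exact Finset.sum_congr rfl fun a _ => mul_smul_comm _ _ _
  rw [h1, h2, bracket, ← Finset.sum_add_distrib, ← Finset.sum_add_distrib, divergence]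
  refine Finset.sum_congr rfl fun a _ => ?_
  rw [dx_dxs_mul, smul_add, smul_add (sgn a) (dx a (dxs a f) * g)]

theorem divergence_add (f g : CotFun q V) :
    divergence (f + g) = divergence f + divergence g := by
  simp only [divergence]
  rw [← Finset.sum_add_distrib]
  exact Finset.sum_congr rfl fun a _ => by
    rw [(isDer_dxs a).map_add, (isDer_dx a).map_add, smul_add]

theorem bracket_add (f g h : CotFun q V) :
    bracket f (g + h) = bracket f g + bracket f h := by
  simp only [bracket]
  rw [← Finset.sum_add_distrib]
  exact Finset.sum_congr rfl fun a _ => by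
    rw [(isDer_dxs a).map_add, (isDer_dx a).map_add, mul_add, mul_add, ← smul_add,
      add_add_add_comm]

theorem bracket_neg (f g : CotFun q V) : bracket f (-g) = -bracket f g := by
  simp only [bracket]
  rw [← Finset.sum_neg_distrib]
  exact Finset.sum_congr rfl fun a _ => by
    rw [(isDer_dxs a).map_neg, (isDer_dx a).map_neg, mul_neg, mul_neg, ← smul_neg, neg_add]

theorem parity_divergence (f : CotFun q V) :
    parity (divergence f) = -divergence (parity f) := by
  simp only [divergence]
  rw [parity_sum, ← Finset.sum_neg_distrib]
  refine Finset.sum_congr rfl fun a _ => ?_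
  rw [parity_zsmul, parity_dx, parity_dxs, (isDer_dx a).map_zsmul, smul_smul (_ ^ par a),
    ← pow_add, Odd.neg_one_pow (by rw [← add_assoc]; exact (Even.add_self _).add_one)]
  simp

/-- Used for the square of the divergence operator, and for the Hessian term in its transformation
law. -/
theorem sum_sum_eq_zero_of_antisymm {R ι : Type*} [AddCommGroup R] [Module ℝ R] [Fintype ι]
    {X : ι → ι → R} (h : ∀ a b, X a b = -X b a) : ∑ a, ∑ b, X a b = 0 := by
  apply eq_zero_of_eq_neg
  nth_rewrite 1 [Finset.sum_comm]
  rw [← Finset.sum_neg_distrib]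
  refine Finset.sum_congr rfl fun a _ => ?_
  rw [← Finset.sum_neg_distrib]
  exact Finset.sum_congr rfl fun b _ => h b a

/-- The operators `∂_a ∂_{a*}` are all odd and anticommute with one another. -/
theorem divergence_divergence (f : CotFun q V) : divergence (divergence f) = 0 := by
  have h : divergence (divergence f) = ∑ a : Fin p ⊕ Fin q, ∑ b : Fin p ⊕ Fin q,
      (sgn a * sgn b) • dx a (dxs a (dx b (dxs b f))) := by
    rw [divergence]
    refine Finset.sum_congr rfl fun a _ => ?_
    rw [divergence, (isDer_dxs a).map_sum, (isDer_dx a).map_sum, Finset.smul_sum]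
    refine Finset.sum_congr rfl fun b _ => ?_
    rw [(isDer_dxs a).map_zsmul, (isDer_dx a).map_zsmul, smul_smul]
  rw [h]
  refine sum_sum_eq_zero_of_antisymm fun a b => ?_
  rw [dxs_dx a b, (isDer_dx a).map_zsmul, dx_dx a b, dxs_dxs a b, (isDer_dx a).map_zsmul,
    (isDer_dx b).map_zsmul, dx_dxs a b, (isDer_dx b).map_zsmul]
  simp only [smul_smul, ← neg_smul, sgn_eq]
  congr 1
  rcases par_eq a with ha | ha <;> rcases par_eq b with hb | hb <;> simp [ha, hb]

/-- With `(s, s) = 0` one has `Δ(s²) = 2 s Δs`. Applying `Δ` again gives `0 = 2 Δ(s Δs)`, and `Δ(s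
Δs) = (s, Δs)` because `Δs` is odd and `Δ² = 0`. -/
theorem bracket_divergence_self {s : CotFun q V} (hs : HasPar 0 s) (h : bracket s s = 0) :
    bracket s (divergence s) = 0 := by
  have hp : parity s = s := by simpa [HasPar] using hs
  have hd : HasPar 1 (divergence s) := by simp [HasPar, parity_divergence, hp]
  have h1 : divergence (s * s) = s * divergence s + s * divergence s := by
    rw [divergence_mul, h, hp, ← hs.commute, add_zero]
  have h2 : divergence (s * divergence s) = bracket s (divergence s) := by
    rw [divergence_mul, divergence_divergence, hd.mul_self]
    simp
  have h3 := divergence_divergence (s * s)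
  rw [h1, divergence_add, h2] at h3
  exact eq_zero_of_eq_neg (eq_neg_of_add_eq_zero_left h3)

/-! ### Values on the coordinates -/

/-- The inclusion of the functions on the superdomain, as a ring homomorphism. -/
def ofBaseHom (q : ℕ) (V : Opens (Fin p → ℝ)) : SuperFun q V →+* CotFun q V :=
  Grass.substHom (Fib.baseHom (q + p) q (Smooth V)) (fun _ b => C_comm _ b)
    (fun i => (hasPar_gen (Fin.castAdd p i)).mul_self)
    (fun i _ => (hasPar_gen (Fin.castAdd p i)).anticomm (hasPar_gen _))

theorem ofBaseHom_apply (f : SuperFun q V) : ofBaseHom q V f = ofBase f := rfl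

theorem ofBase_C (a : Smooth V) : ofBase (Grass.C a : SuperFun q V) = Fib.base a :=
  Grass.subst_C (Fib.baseHom (q + p) q (Smooth V)) a

theorem ofBase_gen (i : Fin q) :
    ofBase (Grass.gen i : SuperFun q V) = Grass.gen (Fin.castAdd p i) :=
  Grass.subst_gen (Fib.baseHom (q + p) q (Smooth V)) i

theorem ofBase_parity (f : SuperFun q V) : ofBase (parity f) = parity (ofBase f) := by
  simp only [← ofBaseHom_apply]
  induction f using Grass.induction_gen with
  | hC a =>
    rw [parity_C, ofBaseHom_apply, ofBase_C]
    exact (parity_C _).symm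
  | hgen i => rw [parity_gen, map_neg, ofBaseHom_apply, ofBase_gen, parity_gen]
  | hadd f g hf hg => rw [parity_add, map_add, map_add, parity_add, hf, hg]
  | hmul f g hf hg => rw [parity_mul, map_mul, map_mul, parity_mul, hf, hg]

theorem hasPar_ofBase {m : ℕ} {f : SuperFun q V} (hf : HasPar m f) : HasPar m (ofBase f) := by
  unfold HasPar at *
  rw [← ofBase_parity, hf, ← ofBaseHom_apply, ← ofBaseHom_apply, map_zsmul]

theorem hasPar_anti (a : Fin p ⊕ Fin q) : HasPar (par a + 1) (anti q V a) := by
  rcases a with a | a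
  · exact hasPar_gen _
  · exact (hasPar_C _).congr (by simp [par])

theorem dx_base (a : Fin p ⊕ Fin q) (h : Smooth V) :
    dx a (Fib.base h : CotFun q V) = ofBase (SuperFun.pderiv a (Grass.C h)) := by
  rcases a with a | a
  · rw [SuperFun.pderiv, Grass.map_C (Smooth.pderiv_zero a), ofBase_C]
    refine (Grass.map_C (Fib.polyMapHom (q := q) (Smooth.pderivHom a)).map_zero _).trans ?_
    exact congrArg Grass.C (Fib.polyMap_C (Smooth.pderivHom a) h)
  · rw [SuperFun.pderiv, Grass.leftDeriv_C, ← ofBaseHom_apply, map_zero]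
    exact Grass.leftDeriv_C _ _

theorem dxs_base (a : Fin p ⊕ Fin q) (h : Smooth V) : dxs a (Fib.base h : CotFun q V) = 0 := by
  rcases a with a | a
  · exact Grass.leftDeriv_C _ _
  · refine (Grass.map_C (map_zero _) _).trans ?_
    rw [MvPolynomial.pderiv_C]
    exact map_zero (Grass.CHom _ _)

theorem dx_gen (a : Fin p ⊕ Fin q) (i : Fin q) :
    dx a (Grass.gen (Fin.castAdd p i) : CotFun q V) = if a = Sum.inr i then 1 else 0 := by
  rcases a with a | a
  · refine (Grass.map_gen (Fib.polyMapHom (q := q) (Smooth.pderivHom a)).map_zero _).trans ?_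
    have : Fib.polyMapHom (q := q) (Smooth.pderivHom (V := V) a) 1 = 0 :=
      (Fib.polyMap_C (Smooth.pderivHom a) 1).trans (by
        rw [show Smooth.pderivHom a (1 : Smooth V) = 0 from Smooth.pderiv_one a, map_zero])
    rw [this, ← CHom_apply, map_zero]
    simp
  · exact (Grass.leftDeriv_gen _ _).trans (by simp)

theorem dxs_gen (a : Fin p ⊕ Fin q) (i : Fin q) :
    dxs a (Grass.gen (Fin.castAdd p i) : CotFun q V) = 0 := by
  rcases a with a | a
  · refine (Grass.leftDeriv_gen _ _).trans (if_neg ?_)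
    intro h
    have := congrArg Fin.val h
    simp at this
    omega
  · refine (Grass.map_gen (map_zero _) _).trans ?_
    rw [Derivation.map_one_eq_zero, ← CHom_apply, map_zero]
    simp

theorem dx_anti (a b : Fin p ⊕ Fin q) : dx a (anti q V b) = 0 := by
  have h1 : ∀ a, Fib.polyMapHom (q := q) (Smooth.pderivHom (V := V) a) 1 = 0 := fun a =>
    (Fib.polyMap_C (Smooth.pderivHom a) 1).trans (by
      rw [show Smooth.pderivHom a (1 : Smooth V) = 0 from Smooth.pderiv_one a, map_zero])
  rcases a with a | a <;> rcases b with b | b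
  · refine (Grass.map_gen (Fib.polyMapHom (q := q) (Smooth.pderivHom a)).map_zero _).trans ?_
    rw [h1, ← CHom_apply, map_zero]
    simp
  · refine (Grass.map_C (Fib.polyMapHom (q := q) (Smooth.pderivHom a)).map_zero _).trans ?_
    rw [Fib.polyMapHom_apply, Fib.polyMap_X _ (Smooth.pderiv_one a)]
    exact map_zero (Grass.CHom _ _)
  · refine (Grass.leftDeriv_gen _ _).trans (if_neg ?_)
    intro h
    have := congrArg Fin.val h
    simp at this
    omega
  · exact Grass.leftDeriv_C _ _

theorem dxs_anti (a b : Fin p ⊕ Fin q) :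
    dxs a (anti q V b) = if a = b then 1 else 0 := by
  rcases a with a | a <;> rcases b with b | b
  · exact (Grass.leftDeriv_gen _ _).trans (by simp)
  · exact (Grass.leftDeriv_C _ _).trans (by simp)
  · refine (Grass.map_gen (map_zero _) _).trans ?_
    rw [Derivation.map_one_eq_zero, ← CHom_apply, map_zero]
    simp
  · refine (Grass.map_C (map_zero _) _).trans ?_
    by_cases h : a = b
    · subst h
      rw [MvPolynomial.pderiv_X_self, if_pos rfl]
      rfl
    · rw [MvPolynomial.pderiv_X_of_ne (Ne.symm h), if_neg (by simpa using h)]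
      exact map_zero (Grass.CHom _ _)

theorem dx_ofBase (a : Fin p ⊕ Fin q) (f : SuperFun q V) :
    dx a (ofBase f) = ofBase (SuperFun.pderiv a f) := by
  have h1 : IsDer (ofBaseHom q V) (par a) fun f => dx a (ofBaseHom q V f) :=
    (isDer_dx a).comp_hom _ ofBase_parity
  have h2 : IsDer (ofBaseHom q V) (par a) fun f => ofBaseHom q V (SuperFun.pderiv a f) :=
    (SuperFun.isDer_pderiv a).hom_comp _
  refine h1.ext_gen h2 (fun c => ?_) (fun i => ?_) f
  · change dx a (ofBase _) = ofBase _
    rw [ofBase_C, dx_base]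
  · change dx a (ofBase _) = _
    rw [ofBase_gen, dx_gen]
    have := SuperFun.pderiv_coord (V := V) a (Sum.inr i)
    rw [SuperFun.coord] at this
    rw [this]
    split_ifs <;> simp

theorem dxs_ofBase (a : Fin p ⊕ Fin q) (f : SuperFun q V) : dxs a (ofBase f) = 0 := by
  have h1 : IsDer (ofBaseHom q V) (par a + 1) fun f => dxs a (ofBaseHom q V f) :=
    (isDer_dxs a).comp_hom _ ofBase_parity
  refine h1.ext_gen IsDer.zero (fun c => ?_) (fun i => ?_) f
  · change dxs a (ofBase _) = 0
    rw [ofBase_C, dxs_base]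
  · change dxs a (ofBase _) = 0
    rw [ofBase_gen, dxs_gen]

/-! ### Restriction -/

variable {V' : Opens (Fin p → ℝ)}

theorem restrict_parity (h : V' ≤ V) (f : CotFun q V) :
    restrict h (parity f) = parity (restrict h f) :=
  (parity_map (Fib.polyMapHom (q := q) (Smooth.restrictHom h).toAddMonoidHom).map_neg f).symm

theorem restrict_add (h : V' ≤ V) (f g : CotFun q V) :
    restrict h (f + g) = restrict h f + restrict h g :=
  funext fun _ => (Fib.polyMapHom (q := q) (Smooth.restrictHom h).toAddMonoidHom).map_add _ _

theorem restrict_zsmul (h : V' ≤ V) (k : ℤ) (f : CotFun q V) :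
    restrict h (k • f) = k • restrict h f :=
  funext fun _ => (Fib.polyMapHom (q := q) (Smooth.restrictHom h).toAddMonoidHom).map_zsmul _ _

theorem restrict_sum (h : V' ≤ V) {ι : Type*} (s : Finset ι) (f : ι → CotFun q V) :
    restrict h (∑ i ∈ s, f i) = ∑ i ∈ s, restrict h (f i) := by
  ext1 I
  have := map_sum (Fib.polyMapHom (q := q) (Smooth.restrictHom h).toAddMonoidHom)
    (fun i => f i I) s
  rw [← Grass.sum_apply] at this
  exact this.trans (Grass.sum_apply s (fun i => restrict h (f i)) I).symm

theorem restrict_dx (h : V' ≤ V) (a : Fin p ⊕ Fin q) (f : CotFun q V) :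
    restrict h (dx a f) = dx a (restrict h f) := by
  rcases a with a | a
  · refine funext fun I => ?_
    refine MvPolynomial.ext _ _ fun m => ?_
    simp only [restrict, dx, Fib.coeff_onCoeff (Smooth.pderiv_zero _),
      Fib.coeff_onCoeff (D := Smooth.restrict h) (Smooth.restrictHom h).map_zero]
    exact Smooth.restrict_pderiv h a _
  · exact (leftDeriv_map (Fib.polyMapHom (q := q) (Smooth.restrictHom h).toAddMonoidHom).map_zero
      (Fib.polyMapHom (q := q) (Smooth.restrictHom h).toAddMonoidHom).map_neg _ f).symm

theorem restrict_dxs (h : V' ≤ V) (a : Fin p ⊕ Fin q) (f : CotFun q V) :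
    restrict h (dxs a f) = dxs a (restrict h f) := by
  rcases a with a | a
  · exact (leftDeriv_map (Fib.polyMapHom (q := q) (Smooth.restrictHom h).toAddMonoidHom).map_zero
      (Fib.polyMapHom (q := q) (Smooth.restrictHom h).toAddMonoidHom).map_neg _ f).symm
  · exact funext fun I => Fib.polyMap_pderiv (Smooth.restrictHom h).toAddMonoidHom a (f I)

theorem restrict_divergence (h : V' ≤ V) (f : CotFun q V) :
    restrict h (divergence f) = divergence (restrict h f) := by
  simp only [divergence, restrict_sum, restrict_zsmul, restrict_dx, restrict_dxs]

end CotFun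

/-! ### The Hadamard lemma -/

/-- An integral over `[0, 1]` depending smoothly on a parameter is smooth. -/
theorem contDiff_parametric_integral {E F : Type} [NormedAddCommGroup E] [NormedSpace ℝ E]
    [ProperSpace E] [NormedAddCommGroup F] [NormedSpace ℝ F] [CompleteSpace F] {Φ : E → ℝ → F}
    (hΦ : ContDiff ℝ ∞ (Function.uncurry Φ)) :
    ContDiff ℝ ∞ fun y => ∫ t in (0 : ℝ)..1, Φ y t := by
  refine contDiff_infty.2 fun n => ?_
  -- The derivative takes values in a different space, `E →L[ℝ] F`, so the target is generalised.
  induction n generalizing F with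
  | zero =>
    exact contDiff_zero.2
      (intervalIntegral.continuous_parametric_intervalIntegral_of_continuous' hΦ.continuous 0 1)
  | succ n ih =>
    have hΦ' : ContDiff ℝ ∞ (Function.uncurry fun (y : E) (t : ℝ) =>
        fderiv ℝ (fun z => Φ z t) y) := by
      have h1 : ContDiff ℝ ∞ (Function.uncurry fun (x : E × ℝ) (z : E) => Φ z x.2) :=
        hΦ.comp (contDiff_snd.prodMk (contDiff_snd.comp contDiff_fst))
      exact h1.fderiv contDiff_fst (by simp)
    refine contDiff_succ_iff_hasFDerivAt.2
      ⟨fun y => ∫ t in (0 : ℝ)..1, fderiv ℝ (fun z => Φ z t) y, ih hΦ', fun y => ?_⟩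
    -- A constant dominates the derivative near `y`, by compactness of the unit ball times the
    -- interval; this justifies differentiating under the integral.
    obtain ⟨C, hC⟩ := ((isCompact_closedBall y 1).prod (isCompact_Icc (a := (0 : ℝ))
      (b := 1))).exists_bound_of_continuousOn hΦ'.continuous.continuousOn
    have hc : ∀ y, Continuous (Φ y) := fun y =>
      hΦ.continuous.comp (continuous_const.prodMk continuous_id)
    refine intervalIntegral.hasFDerivAt_integral_of_dominated_of_fderiv_le (𝕜 := ℝ)
      (F := Φ) (F' := fun y t => fderiv ℝ (fun z => Φ z t) y) (bound := fun _ => C)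
      (Metric.closedBall_mem_nhds y one_pos) ?_ ?_ ?_ ?_ ?_ ?_
    · exact Filter.Eventually.of_forall fun z => (hc z).aestronglyMeasurable
    · exact (hc y).intervalIntegrable _ _
    · exact (hΦ'.continuous.comp
        (continuous_const.prodMk continuous_id)).aestronglyMeasurable
    · refine Filter.Eventually.of_forall fun t ht z hz => hC (z, t) ⟨hz, ?_⟩
      rw [Set.uIoc_of_le zero_le_one] at ht
      exact Set.Ioc_subset_Icc_self ht
    · exact intervalIntegrable_const
    · refine Filter.Eventually.of_forall fun t _ z _ => ?_
      have : ContDiff ℝ ∞ fun z => Φ z t := hΦ.comp (contDiff_id.prodMk contDiff_const)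
      exact (this.differentiable (by simp) z).hasFDerivAt

/-- Hadamard's lemma for smooth functions on `ℝᵖ`. -/
theorem exists_hadamard {G : (Fin p → ℝ) → ℝ} (hG : ContDiff ℝ ∞ G) (y₀ : Fin p → ℝ) :
    ∃ g : Fin p → (Fin p → ℝ) → ℝ, (∀ i, ContDiff ℝ ∞ (g i)) ∧
      ∀ y, G y = G y₀ + ∑ i, (y i - y₀ i) * g i y := by
  have hG' : ContDiff ℝ ∞ (fderiv ℝ G) := hG.fderiv_right (by simp)
  -- The segment from `y₀` to `y`. The fundamental theorem of calculus along it yields the quotients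
  -- as integrals of the partial derivatives.
  let γ : (Fin p → ℝ) → ℝ → (Fin p → ℝ) := fun y t => y₀ + t • (y - y₀)
  have hγ : ContDiff ℝ ∞ (Function.uncurry γ) :=
    contDiff_const.add (contDiff_snd.smul (contDiff_fst.sub contDiff_const))
  refine ⟨fun i y => ∫ t in (0 : ℝ)..1, fderiv ℝ G (γ y t) (Pi.single i 1), fun i => ?_,
    fun y => ?_⟩
  · exact contDiff_parametric_integral ((hG'.comp hγ).clm_apply contDiff_const)
  · have hline : ∀ t : ℝ, HasDerivAt (fun t => G (γ y t)) (fderiv ℝ G (γ y t) (y - y₀)) t := by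
      intro t
      have h1 : HasDerivAt (γ y) (y - y₀) t := by
        have := ((hasDerivAt_id t).smul_const (y - y₀)).const_add y₀
        rwa [one_smul] at this
      exact ((hG.differentiable (by simp)) (γ y t)).hasFDerivAt.comp_hasDerivAt t h1
    have hcont : ∀ v, Continuous fun t => fderiv ℝ G (γ y t) v := fun v =>
      (hG'.continuous.comp (hγ.continuous.comp
        (continuous_const.prodMk continuous_id))).clm_apply continuous_const
    have h2 := intervalIntegral.integral_eq_sub_of_hasDerivAt (a := 0) (b := 1)
      (fun t _ => hline t) ((hcont _).intervalIntegrable _ _)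
    have e0 : γ y 0 = y₀ := by simp [γ]
    have e1 : γ y 1 = y := by simp [γ]
    rw [e0, e1] at h2
    have h3 : ∀ t, fderiv ℝ G (γ y t) (y - y₀) =
        ∑ i, (y i - y₀ i) * fderiv ℝ G (γ y t) (Pi.single i 1) := by
      intro t
      conv_lhs => rw [pi_eq_sum_univ' (y - y₀)]
      rw [map_sum]
      refine Finset.sum_congr rfl fun i _ => ?_
      rw [map_smul, smul_eq_mul]
      rfl
    simp only [h3] at h2
    rw [intervalIntegral.integral_finsetSum
      (fun i _ => ((hcont _).const_mul _ |>.intervalIntegrable _ _))] at h2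
    simp only [intervalIntegral.integral_const_mul] at h2
    linarith

namespace Smooth

/-- Hadamard's lemma for smooth functions on an open set. -/
theorem hadamard {V : Opens (Fin p → ℝ)} (f : Smooth V) (y₀ : V) :
    ∃ g : Fin p → Smooth V, f = algebraMap ℝ (Smooth V) (f.1 y₀) +
      ∑ i, (coord V i - algebraMap ℝ (Smooth V) (y₀.1 i)) * g i := by
  obtain ⟨r, hr, hrV⟩ := Metric.nhds_basis_closedBall.mem_iff.1 (V.2.mem_nhds y₀.2)
  -- `V` need not be star-shaped about `y₀`, so `f - f(y₀)` is split by a cutoff. The part `χ k`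
  -- extends smoothly to all of `ℝᵖ`, where the segment argument applies.
  let χ : ContDiffBump y₀.1 := ⟨r / 2, r, half_pos hr, half_lt_self hr⟩
  have hχ : ContDiff ℝ ∞ χ := χ.contDiff
  let k : (Fin p → ℝ) → ℝ := fun y => f.toFun y - f.1 y₀
  have hk : ∀ y ∈ V, ContDiffAt ℝ ∞ k y := fun y hy => (f.contDiffAt hy).sub contDiffAt_const
  have hk0 : k y₀ = 0 := by simp [k, toFun_apply f y₀.2]
  have hG : ContDiff ℝ ∞ fun y => χ y * k y := by
    rw [contDiff_iff_contDiffAt]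
    intro y
    by_cases hy : y ∈ V
    · exact hχ.contDiffAt.mul (hk y hy)
    · have hy' : y ∈ (Metric.closedBall y₀.1 r)ᶜ := fun h => hy (hrV h)
      refine (contDiffAt_const (c := (0 : ℝ))).congr_of_eventuallyEq ?_
      filter_upwards [Metric.isClosed_closedBall.isOpen_compl.mem_nhds hy'] with z hz
      rw [χ.zero_of_le_dist, zero_mul]
      exact (not_le.1 fun h => hz (Metric.mem_closedBall.2 h)).le
  obtain ⟨g, hg, hgG⟩ := exists_hadamard hG y₀.1
  let n : (Fin p → ℝ) → ℝ := fun y => ∑ i, (y i - y₀.1 i) ^ 2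
  have hn : ContDiff ℝ ∞ n := by fun_prop
  have hn0 : ∀ y, n y = 0 → y = y₀.1 := by
    intro y hy
    have := (Finset.sum_eq_zero_iff_of_nonneg fun i _ => sq_nonneg (y i - y₀.1 i)).1 hy
    ext i
    have := this i (Finset.mem_univ i)
    nlinarith
  -- The remaining part `(1 - χ) k` vanishes near `y₀`, so it can be divided by the squared distance
  -- `n`; multiplying `u i` by `y i - y₀ i` and summing restores it.
  let u : Fin p → (Fin p → ℝ) → ℝ := fun i y => (1 - χ y) * k y * (y i - y₀.1 i) / n y
  have hu : ∀ i, ContDiffOn ℝ ∞ (u i) V := by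
    intro i y hy
    apply ContDiffAt.contDiffWithinAt
    by_cases hyy : y = y₀.1
    · refine (contDiffAt_const (c := (0 : ℝ))).congr_of_eventuallyEq ?_
      rw [hyy]
      filter_upwards [χ.eventuallyEq_one] with z hz
      simp [u, hz]
    · refine ContDiffAt.div (((contDiffAt_const.sub hχ.contDiffAt).mul (hk y hy)).mul ?_)
        hn.contDiffAt fun h => hyy (hn0 y h)
      fun_prop
  refine ⟨fun i => ⟨fun y => g i y, mem_smooth (hg i).contDiffOn⟩ +
    ⟨fun y => u i y, mem_smooth (hu i)⟩, ?_⟩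
  ext y
  have hsum : ∀ w : Fin p → Smooth V, (∑ i, w i).1 y = ∑ i, (w i).1 y := by
    intro w
    rw [AddSubmonoidClass.coe_finsetSum, Finset.sum_apply]
  change f.1 y = f.1 y₀ + (∑ i, _ : Smooth V).1 y
  rw [hsum]
  change f.1 y = f.1 y₀ + ∑ i, (y.1 i - y₀.1 i) * (g i y + u i y)
  have h1 := hgG y.1
  have h2 : ∑ i, (y.1 i - y₀.1 i) * u i y = (1 - χ y) * k y := by
    by_cases hyy : y.1 = y₀.1
    · simp [hyy, hk0]
    · have hny : n y ≠ 0 := fun h => hyy (hn0 y h)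
      have : ∀ i, (y.1 i - y₀.1 i) * u i y =
          (1 - χ y) * k y / n y * (y.1 i - y₀.1 i) ^ 2 := fun i => by
        simp only [u]
        ring
      rw [Finset.sum_congr rfl fun i _ => this i, ← Finset.mul_sum]
      exact div_mul_cancel₀ _ hny
  simp only [mul_add, Finset.sum_add_distrib, h2]
  have h3 : k y = f.1 y - f.1 y₀ := by simp [k, toFun_apply f y.2]
  simp only [hk0, mul_zero, zero_add, h3] at h1 ⊢
  linarith

end Smooth

/-! ### The chain rule for superalgebra homomorphisms -/

namespace SuperFun

open Grass

variable {V V' : Opens (Fin p → ℝ)}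

/-- The body of a superfunction at a point. -/
def bodyAt (x : V) : SuperFun q V →+* ℝ where
  toFun f := (f ∅).1 x
  map_one' := by simp [one_apply]
  map_zero' := rfl
  map_add' _ _ := rfl
  map_mul' f g := by
    rw [mul_apply]
    simp [Grass.inv]

theorem bodyAt_apply (x : V) (f : SuperFun q V) : bodyAt x f = (f ∅).1 x := rfl

theorem algebraMap_eq_C (r : ℝ) :
    algebraMap ℝ (SuperFun q V) r = C (algebraMap ℝ (Smooth V) r) := by
  ext1 I
  rw [Algebra.algebraMap_eq_smul_one, Grass.smul_apply, one_apply, C]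
  split_ifs
  · rw [Algebra.algebraMap_eq_smul_one]
  · simp

variable (T : SuperFun q V' →ₐ[ℝ] SuperFun q V)

/-- The image of a point under the body of a superalgebra homomorphism. -/
def bodyMap (x : V) : Fin p → ℝ := fun i => bodyAt x (T (C (Smooth.coord V' i)))

theorem bodyAt_algebraMap (x : V) (r : ℝ) : bodyAt (q := q) x (algebraMap ℝ _ r) = r := by
  rw [algebraMap_eq_C]
  simp [bodyAt_apply, C]

/-- If the point lay outside `V'`, the squared distance to it would be invertible in `Smooth V'`.
But the real character `χ`, which takes the body of `T` at `x`, sends it to zero. -/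
theorem bodyMap_mem (x : V) : bodyMap T x ∈ V' := by
  by_contra hx
  let n : (Fin p → ℝ) → ℝ := fun y => ∑ i, (y i - bodyMap T x i) ^ 2
  have hn : ContDiff ℝ ∞ n := by fun_prop
  have hn0 : ∀ y ∈ V', n y ≠ 0 := by
    intro y hy hny
    have := (Finset.sum_eq_zero_iff_of_nonneg fun i _ => sq_nonneg (y i - bodyMap T x i)).1 hny
    apply hx
    have e : y = bodyMap T x := by
      ext i
      have := this i (Finset.mem_univ i)
      nlinarith
    exact e ▸ hy
  let v : Smooth V' := ⟨fun y => (n y)⁻¹, mem_smooth (g := fun y => (n y)⁻¹)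
    (hn.contDiffOn.inv hn0)⟩
  let χ : Smooth V' →+* ℝ := (bodyAt x).comp ((T : SuperFun q V' →+* SuperFun q V).comp
    (CHom q (Smooth V')))
  have hχc : ∀ r : ℝ, χ (algebraMap ℝ _ r) = r := by
    intro r
    change bodyAt x (T (C (algebraMap ℝ _ r))) = r
    rw [← algebraMap_eq_C, AlgHom.commutes, bodyAt_algebraMap]
  have h1 : (∑ i, (Smooth.coord V' i - algebraMap ℝ _ (bodyMap T x i)) ^ 2) * v = 1 := by
    ext y
    have hsum : ∀ w : Fin p → Smooth V', (∑ i, w i).1 y = ∑ i, (w i).1 y := by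
      intro w
      rw [AddSubmonoidClass.coe_finsetSum, Finset.sum_apply]
    change (∑ i, _ : Smooth V').1 y * (n y)⁻¹ = 1
    rw [hsum]
    exact mul_inv_cancel₀ (hn0 y y.2)
  have h2 := congrArg χ h1
  rw [map_mul, map_sum, map_one] at h2
  have h3 : ∀ i, χ ((Smooth.coord V' i - algebraMap ℝ _ (bodyMap T x i)) ^ 2) = 0 := by
    intro i
    rw [map_pow, map_sub, hχc]
    change (bodyMap T x i - bodyMap T x i) ^ 2 = 0
    simp
  simp [h3] at h2

/-- A derivation along a superalgebra homomorphism which vanishes on the coordinates vanishes on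
all smooth functions. -/
theorem derivation_eq_zero {E : Smooth V' → SuperFun q V}
    (hadd : ∀ f g, E (f + g) = E f + E g)
    (hmul : ∀ f g, E (f * g) = E f * T (C g) + T (C f) * E g)
    (hcoord : ∀ i, E (Smooth.coord V' i) = 0)
    (hconst : ∀ r : ℝ, E (algebraMap ℝ _ r) = 0) (f : Smooth V') : E f = 0 := by
  have hz : E 0 = 0 := by simpa using hadd 0 0
  let E' : Smooth V' →+ SuperFun q V := ⟨⟨E, hz⟩, hadd⟩
  -- Coefficientwise and pointwise, by induction on the number of odd generators. All `f` are
  -- treated at once, since the step replaces `f` by its Hadamard quotients.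
  suffices h : ∀ (k : ℕ) (J : Finset (Fin q)), J.card = k → ∀ (x : V) (f : Smooth V'),
      (E f J).1 x = 0 by
    ext J x
    exact h _ J rfl x f
  intro k
  induction k using Nat.strong_induction_on with
  | _ k ih =>
    intro J hJ x f
    -- Expanding at the image point makes the bodies of the linear factors vanish at `x` after
    -- applying `T`.
    obtain ⟨g, hg⟩ := f.hadamard ⟨bodyMap T x, bodyMap_mem T x⟩
    have h1 : E f = ∑ i, T (C (Smooth.coord V' i - algebraMap ℝ _ (bodyMap T x i))) * E (g i) := by
      have h2 : E' f = _ := congrArg E' hg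
      rw [map_add, map_sum] at h2
      refine h2.trans ?_
      rw [show E' (algebraMap ℝ (Smooth V') _) = 0 from hconst _, zero_add]
      refine Finset.sum_congr rfl fun i _ => (hmul _ _).trans ?_
      have h3 : E (Smooth.coord V' i - algebraMap ℝ _ (bodyMap T x i)) = 0 := by
        refine (map_sub E' _ _).trans ?_
        rw [show E' (Smooth.coord V' i) = 0 from hcoord i,
          show E' (algebraMap ℝ (Smooth V') _) = 0 from hconst _, sub_zero]
      rw [h3, zero_mul, zero_add]
    let ev : Smooth V →+* ℝ := (Pi.evalRingHom _ x).comp (smoothSubalgebra V).val.toRingHom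
    change ev (E f J) = 0
    rw [h1, Grass.sum_apply, map_sum]
    refine Finset.sum_eq_zero fun i _ => ?_
    rw [mul_apply, map_sum]
    refine Finset.sum_eq_zero fun L hL => ?_
    rw [map_mul, map_mul]
    -- For `L = ∅` the first factor is that vanishing body; otherwise `J \ L` is smaller than `J`
    -- and the induction hypothesis kills the second factor.
    by_cases hL0 : L = ∅
    · have : ev (T (C (Smooth.coord V' i - algebraMap ℝ _ (bodyMap T x i))) L) = 0 := by
        rw [hL0]
        change bodyAt x _ = 0
        rw [← CHom_apply, map_sub, map_sub, map_sub, CHom_apply, CHom_apply, ← algebraMap_eq_C,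
          AlgHom.commutes, bodyAt_algebraMap]
        exact sub_self _
      rw [this]
      simp
    · have : ev (E (g i) (J \ L)) = 0 := by
        refine ih (J \ L).card ?_ (J \ L) rfl x (g i)
        rw [← hJ]
        refine Finset.card_lt_card ⟨Finset.sdiff_subset, fun h => ?_⟩
        obtain ⟨l, hl⟩ := Finset.nonempty_iff_ne_empty.2 hL0
        exact (Finset.mem_sdiff.1 (h (Finset.mem_powerset.1 hL hl))).2 hl
      rw [this]
      simp

variable {T}

theorem sum_isDer {n n' : ℕ} {K K' : Type*} [CommRing K] [CommRing K'] [Algebra ℝ K']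
    {T : Grass n K →+* Grass n' K'} (hT : ∀ f, T (parity f) = parity (T f)) {ι : Type*} [Fintype ι]
    {m : ℕ} {k l : ι → ℕ} {c : ι → Grass n' K'} (hc : ∀ b, HasPar (k b) (c b))
    {D : ι → Grass n K → Grass n K} (hD : ∀ b, IsDer id (l b) (D b))
    (hm : ∀ b, Even (k b + l b) ↔ Even m) :
    IsDer T m fun f => ∑ b, c b * T (D b f) :=
  IsDer.sum fun b _ => (((hD b).hom_comp T).mul_left hT (hc b) rfl).congr (hm b)

/-- The chain rule. -/
theorem pderiv_hom (hT : ∀ f, T (parity f) = parity (T f)) (a : Fin p ⊕ Fin q)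
    (f : SuperFun q V') :
    pderiv a (T f) = ∑ b, pderiv a (T (coord q V' b)) * T (pderiv b f) := by
  have h1 : IsDer T (par a) fun f => pderiv a (T f) :=
    (isDer_pderiv a).comp_hom (T : SuperFun q V' →+* SuperFun q V) hT
  have hpar : ∀ b, HasPar (par a + par b) (pderiv a (T (coord q V' b))) := by
    intro b
    have := hasPar_coord (q := q) (V := V') b
    unfold HasPar at *
    rw [parity_pderiv, ← hT, this, map_zsmul, (isDer_pderiv a).map_zsmul, smul_smul, pow_add]
  have h2 : IsDer T (par a) fun f => ∑ b, pderiv a (T (coord q V' b)) * T (pderiv b f) :=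
    sum_isDer (T := (T : SuperFun q V' →+* SuperFun q V)) hT hpar (fun b => isDer_pderiv b)
      fun b => by rw [add_assoc, Nat.even_add]; simp
  have hcoord : ∀ b, pderiv a (T (coord q V' b)) =
      ∑ e, pderiv a (T (coord q V' e)) * T (pderiv e (coord q V' b)) := by
    intro b
    rw [Finset.sum_eq_single b]
    · rw [pderiv_coord, if_pos rfl, map_one, mul_one]
    · intro e _ he
      rw [pderiv_coord, if_neg he, map_zero, mul_zero]
    · simp
  refine h1.ext_gen h2 (fun h => ?_) (fun i => hcoord (Sum.inr i)) f
  -- The even coordinates do not generate `Smooth V'` algebraically, so agreement on them is not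
  -- enough by itself. The difference of the two sides is a derivation along `T` that kills
  -- coordinates and constants.
  rw [← sub_eq_zero]
  refine derivation_eq_zero T (E := fun h => pderiv a (T (C h)) -
    ∑ b, pderiv a (T (coord q V' b)) * T (pderiv b (C h))) ?_ ?_ ?_ ?_ h
  · intro f g
    have e : C (f + g) = C f + (C g : SuperFun q V') := map_add (CHom q _) f g
    have e1 := h1.map_add (C f) (C g)
    have e2 := h2.map_add (C f) (C g)
    beta_reduce at e1 e2
    rw [e, e1, e2, add_sub_add_comm]
  · intro f g
    have e : C (f * g) = C f * (C g : SuperFun q V') := map_mul (CHom q _) f g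
    have e1 := h1.map_mul (C f) (C g)
    have e2 := h2.map_mul (C f) (C g)
    have e3 : ∀ k, parity^[k] (C f : SuperFun q V') = C f := by
      intro k
      rw [(hasPar_C f).iterate]
      simp
    simp only [e3] at e1 e2
    rw [e, e1, e2, add_sub_add_comm, ← sub_mul, ← mul_sub]
  · intro i
    exact sub_eq_zero.2 (hcoord (Sum.inl i))
  · intro r
    have e : ∀ (W : Opens (Fin p → ℝ)) b, pderiv b (algebraMap ℝ (SuperFun q W) r) = 0 := by
      intro W b
      rw [algebraMap_eq_C]
      rcases b with b | b
      · rw [pderiv, map_C (Smooth.pderiv_zero b)]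
        have : Smooth.pderiv b (algebraMap ℝ (Smooth W) r) = 0 := by
          ext x
          rw [Smooth.pderiv_apply_of_eq b (g := fun _ => r) fun _ => rfl]
          simp
        rw [this]
        exact map_zero (CHom q _)
      · exact leftDeriv_C _ _
    simp only [← algebraMap_eq_C, AlgHom.commutes, e, map_zero, mul_zero, Finset.sum_const_zero,
      sub_zero]

end SuperFun

/-! ### Changes of coordinates on the odd cotangent bundle -/

namespace Change

open Grass SuperFun

variable {V V' : Opens (Fin p → ℝ)} (T₀ : SuperFun q V' ≃ₐ[ℝ] SuperFun q V)

/-- The Jacobian matrix `∂_{b'} xᵃ` of a change of coordinates. -/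
def jac (b a : Fin p ⊕ Fin q) : SuperFun q V := T₀ (pderiv b (T₀.symm (coord q V a)))

/-- The image of the fibre coordinate `x*_{b'}`. -/
def antiImage (b : Fin p ⊕ Fin q) : CotFun q V :=
  ∑ a : Fin p ⊕ Fin q, CotFun.ofBase (jac T₀ b a) * CotFun.anti q V a

/-- The logarithmic derivative of the Berezinian of a change of coordinates. -/
def logJac (b : Fin p ⊕ Fin q) : SuperFun q V :=
  ∑ e : Fin p ⊕ Fin q, ∑ a : Fin p ⊕ Fin q, sgn e •
    (T₀ (pderiv b (pderiv e (T₀.symm (coord q V a)))) * pderiv a (T₀ (coord q V' e)))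

variable {T₀}
variable (hT₀ : ∀ f, T₀ (parity f) = parity (T₀ f))

theorem symm_parity (hT₀ : ∀ f, T₀ (parity f) = parity (T₀ f))
    (f : SuperFun q V) : T₀.symm (parity f) = parity (T₀.symm f) := by
  rw [AlgEquiv.symm_apply_eq, hT₀, AlgEquiv.apply_symm_apply]

theorem hasPar_map (hT₀ : ∀ f, T₀ (parity f) = parity (T₀ f))
    {m : ℕ} {f : SuperFun q V'} (hf : HasPar m f) : HasPar m (T₀ f) := by
  unfold HasPar at *
  rw [← hT₀, hf, map_zsmul]

theorem hasPar_symm (hT₀ : ∀ f, T₀ (parity f) = parity (T₀ f))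
    {m : ℕ} {f : SuperFun q V} (hf : HasPar m f) : HasPar m (T₀.symm f) := by
  unfold HasPar at *
  rw [← symm_parity hT₀, hf, map_zsmul]

theorem hasPar_pderiv {a : Fin p ⊕ Fin q} {m : ℕ} {f : SuperFun q V} (hf : HasPar m f) :
    HasPar (par a + m) (pderiv a f) := by
  unfold HasPar at *
  rw [parity_pderiv, hf, (isDer_pderiv a).map_zsmul, smul_smul, pow_add]

theorem hasPar_jac (hT₀ : ∀ f, T₀ (parity f) = parity (T₀ f))
    (b a : Fin p ⊕ Fin q) : HasPar (par b + par a) (jac T₀ b a) :=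
  hasPar_map hT₀ (hasPar_pderiv (hasPar_symm hT₀ (hasPar_coord a)))

theorem hasPar_logJac (hT₀ : ∀ f, T₀ (parity f) = parity (T₀ f))
    (b : Fin p ⊕ Fin q) : HasPar (par b) (logJac T₀ b) := by
  refine HasPar.sum fun e _ => HasPar.sum fun a _ => HasPar.smul ?_ _
  refine ((hasPar_map hT₀ (hasPar_pderiv (hasPar_pderiv
    (hasPar_symm hT₀ (hasPar_coord a))))).mul
      (hasPar_pderiv (hasPar_map hT₀ (hasPar_coord e)))).congr ?_
  have : par b + (par e + par a) + (par a + par e) =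
      par b + ((par e + par a) + (par e + par a)) := by
    ring
  rw [this, Nat.even_add]
  simp

theorem hasPar_antiImage (hT₀ : ∀ f, T₀ (parity f) = parity (T₀ f))
    (b : Fin p ⊕ Fin q) : HasPar (par b + 1) (antiImage T₀ b) := by
  refine HasPar.sum fun a _ => ?_
  refine ((CotFun.hasPar_ofBase (hasPar_jac hT₀ b a)).mul (CotFun.hasPar_anti a)).congr ?_
  have : par b + par a + (par a + 1) = (par b + 1) + (par a + par a) := by ring
  rw [this, Nat.even_add]
  simp

/-- The chain rule for the inverse change of coordinates, at `T₀ f`, carried back by `T₀`. It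
expresses `∂_{b'}` through the `∂_a`. -/
theorem sum_jac_mul (hT₀ : ∀ f, T₀ (parity f) = parity (T₀ f))
    (b : Fin p ⊕ Fin q) (f : SuperFun q V') :
    ∑ a, jac T₀ b a * pderiv a (T₀ f) = T₀ (pderiv b f) := by
  have h := pderiv_hom (T := (T₀.symm : SuperFun q V →ₐ[ℝ] SuperFun q V')) (symm_parity hT₀) b
    (T₀ f)
  have h' := congrArg T₀ h
  simp only [AlgEquiv.coe_toAlgHom, AlgEquiv.symm_apply_apply, map_sum, map_mul,
    AlgEquiv.apply_symm_apply] at h'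
  exact h'.symm

theorem pderiv_map (hT₀ : ∀ f, T₀ (parity f) = parity (T₀ f))
    (a : Fin p ⊕ Fin q) (f : SuperFun q V') :
    pderiv a (T₀ f) = ∑ b, pderiv a (T₀ (coord q V' b)) * T₀ (pderiv b f) :=
  pderiv_hom (T := (T₀ : SuperFun q V' →ₐ[ℝ] SuperFun q V)) hT₀ a f

/-- The divergence of the Jacobian matrix. -/
theorem sum_pderiv_jac (hT₀ : ∀ f, T₀ (parity f) = parity (T₀ f)) (b : Fin p ⊕ Fin q) :
    ∑ a, (sgn a * (-1) ^ ((par b + par a) * (par a + 1))) • pderiv a (jac T₀ b a) =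
      sgn b • logJac T₀ b := by
  rw [logJac, Finset.sum_comm, Finset.smul_sum]
  refine Finset.sum_congr rfl fun a _ => ?_
  -- The chain rule produces `(∂_a x^{e'}) (∂_{e'} ∂_{b'} xᵃ)`. Exchanging the two factors and the
  -- two derivatives brings it to the form of `logJac`; the accumulated signs are compared by cases
  -- on the parities.
  rw [jac, pderiv_map hT₀, Finset.smul_sum, Finset.smul_sum]
  refine Finset.sum_congr rfl fun e _ => ?_
  have h1 : HasPar (par a + par e) (pderiv a (T₀ (coord q V' e))) :=
    hasPar_pderiv (hasPar_map hT₀ (hasPar_coord e))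
  have h2 : HasPar (par e + (par b + par a)) (T₀ (pderiv e (pderiv b (T₀.symm (coord q V a))))) :=
    hasPar_map hT₀ (hasPar_pderiv (hasPar_pderiv (hasPar_symm hT₀ (hasPar_coord a))))
  rw [h1.supercomm, h2.iterate, pderiv_pderiv e b, map_zsmul, smul_mul_assoc, smul_mul_assoc]
  simp only [smul_smul, sgn_eq]
  congr 1
  rcases par_eq a with ha | ha <;> rcases par_eq b with hb | hb <;>
    rcases par_eq e with he | he <;> simp [ha, hb, he]

theorem hasPar_kappa (hT₀ : ∀ f, T₀ (parity f) = parity (T₀ f)) (f : Smooth V') :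
    HasPar 0 ((CotFun.ofBaseHom q V).comp
      ((T₀ : SuperFun q V' →+* SuperFun q V).comp (CHom q (Smooth V'))) f) :=
  CotFun.hasPar_ofBase (hasPar_map hT₀ (hasPar_C f))

theorem hasPar_theta (hT₀ : ∀ f, T₀ (parity f) = parity (T₀ f)) (i : Fin (q + p)) :
    HasPar 1 (Fin.addCases (motive := fun _ => CotFun q V)
      (fun α => CotFun.ofBase (T₀ (coord q V' (Sum.inr α)))) (fun a => antiImage T₀ (Sum.inl a))
      i) := by
  induction i using Fin.addCases with
  | left α =>
    rw [Fin.addCases_left]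
    exact CotFun.hasPar_ofBase (hasPar_map hT₀ (hasPar_coord (Sum.inr α)))
  | right a =>
    rw [Fin.addCases_right]
    exact hasPar_antiImage hT₀ (Sum.inl a)

/-- The change of coordinates on the odd cotangent bundle, as a ring homomorphism. -/
def cotHom : CotFun q V' →+* CotFun q V :=
  Fib.substHom (hasPar_kappa hT₀)
    (fun α => (hasPar_antiImage hT₀ (Sum.inr α)).congr (by simp [par])) (hasPar_theta hT₀)

theorem cotHom_apply (f : CotFun q V') : cotHom hT₀ f =
    Fib.subst (fun h => CotFun.ofBase (T₀ (Grass.C h))) (fun α => antiImage T₀ (Sum.inr α))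
      (Fin.addCases (fun α => CotFun.ofBase (T₀ (coord q V' (Sum.inr α))))
        (fun a => antiImage T₀ (Sum.inl a))) f :=
  Fib.substHom_apply _ _ _ f

theorem cotHom_parity (f : CotFun q V') : cotHom hT₀ (parity f) = parity (cotHom hT₀ f) :=
  Fib.substHom_parity _ _ _ f

theorem cotHom_ofBase (f : SuperFun q V') :
    cotHom hT₀ (CotFun.ofBase f) = CotFun.ofBase (T₀ f) := by
  change cotHom hT₀ (CotFun.ofBaseHom q V' f) = CotFun.ofBaseHom q V (T₀ f)
  induction f using Grass.induction_gen with
  | hC a =>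
    rw [CotFun.ofBaseHom_apply, CotFun.ofBase_C]
    exact Fib.substHom_base _ _ _ a
  | hgen i =>
    rw [CotFun.ofBaseHom_apply, CotFun.ofBase_gen]
    refine (Fib.substHom_gen _ _ _ _).trans ?_
    rw [Fin.addCases_left]
    rfl
  | hadd f g hf hg => rw [map_add, map_add, map_add, map_add, hf, hg]
  | hmul f g hf hg => rw [map_mul, map_mul, map_mul, map_mul, hf, hg]

theorem cotHom_anti (b : Fin p ⊕ Fin q) :
    cotHom hT₀ (CotFun.anti q V' b) = antiImage T₀ b := by
  rcases b with b | b
  · refine (Fib.substHom_gen _ _ _ _).trans ?_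
    rw [Fin.addCases_right]
  · exact Fib.substHom_X _ _ _ _

/-- The chain rule on the odd cotangent bundle. -/
theorem cot_chain {m : ℕ} {D : CotFun q V → CotFun q V} (hD : IsDer id m D)
    (hpar : ∀ {k : ℕ} {f : CotFun q V}, HasPar k f → HasPar (m + k) (D f))
    (hbase : ∀ h : Smooth V', D (CotFun.ofBase (T₀ (C h))) =
      ∑ b, D (CotFun.ofBase (T₀ (coord q V' b))) * CotFun.ofBase (T₀ (pderiv b (C h))))
    (f : CotFun q V') : D (cotHom hT₀ f) =
      ∑ b, D (CotFun.ofBase (T₀ (coord q V' b))) * cotHom hT₀ (CotFun.dx b f) +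
        ∑ b, D (antiImage T₀ b) * cotHom hT₀ (CotFun.dxs b f) := by
  have h1 : IsDer (cotHom hT₀) m fun f => D (cotHom hT₀ f) := hD.comp_hom _ (cotHom_parity hT₀)
  have h2 : IsDer (cotHom hT₀) m fun f =>
      ∑ b, D (CotFun.ofBase (T₀ (coord q V' b))) * cotHom hT₀ (CotFun.dx b f) :=
    sum_isDer (cotHom_parity hT₀)
      (fun b => hpar (CotFun.hasPar_ofBase (hasPar_map hT₀ (hasPar_coord b))))
      (fun b => CotFun.isDer_dx b) fun b => by rw [add_assoc, Nat.even_add]; simp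
  have h3 : IsDer (cotHom hT₀) m fun f =>
      ∑ b, D (antiImage T₀ b) * cotHom hT₀ (CotFun.dxs b f) :=
    sum_isDer (cotHom_parity hT₀) (fun b => hpar (hasPar_antiImage hT₀ b))
      (fun b => CotFun.isDer_dxs b) fun b => by rw [add_assoc, Nat.even_add]; simp
  -- All antimomenta are treated together; the even ones are polynomial variables and the odd ones
  -- Grassmann generators.
  have hanti : ∀ e, D (cotHom hT₀ (CotFun.anti q V' e)) =
      ∑ b, D (CotFun.ofBase (T₀ (coord q V' b))) * cotHom hT₀ (CotFun.dx b (CotFun.anti q V' e)) +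
        ∑ b, D (antiImage T₀ b) * cotHom hT₀ (CotFun.dxs b (CotFun.anti q V' e)) := by
    intro e
    simp only [CotFun.dx_anti, CotFun.dxs_anti, map_zero, mul_zero, Finset.sum_const_zero,
      zero_add, cotHom_anti]
    rw [Finset.sum_eq_single e]
    · simp
    · intro b _ hb
      simp [hb]
    · simp
  refine Fib.der_ext h1 (h2.add h3) (fun a => ?_) (fun α => hanti (Sum.inr α)) (fun i => ?_) f
  · simp only [CotFun.dx_base, CotFun.dxs_base, map_zero, mul_zero, Finset.sum_const_zero,
      add_zero, cotHom_ofBase]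
    rw [← CotFun.ofBase_C, cotHom_ofBase, hbase]
  · induction i using Fin.addCases with
    | left α =>
      simp only [CotFun.dx_gen, CotFun.dxs_gen, map_zero, mul_zero, Finset.sum_const_zero,
        add_zero]
      rw [Finset.sum_eq_single (Sum.inr α), ← CotFun.ofBase_gen, cotHom_ofBase]
      · simp [coord]
      · intro b _ hb
        simp [hb]
      · simp
    | right a => exact hanti (Sum.inl a)

theorem dx_cotHom (a : Fin p ⊕ Fin q) (f : CotFun q V') : CotFun.dx a (cotHom hT₀ f) =
    ∑ b, CotFun.ofBase (pderiv a (T₀ (coord q V' b))) * cotHom hT₀ (CotFun.dx b f) +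
      ∑ b, CotFun.dx a (antiImage T₀ b) * cotHom hT₀ (CotFun.dxs b f) := by
  rw [cot_chain hT₀ (CotFun.isDer_dx a) CotFun.hasPar_dx]
  · simp only [CotFun.dx_ofBase]
  · intro h
    simp only [CotFun.dx_ofBase]
    rw [pderiv_map hT₀]
    simp only [← CotFun.ofBaseHom_apply, map_sum, map_mul]

/-- The images of base functions contain no antimomenta, and those of the antimomenta are linear in
them. The sign comes from moving the derivative past the Jacobian entry. -/
theorem dxs_cotHom (a : Fin p ⊕ Fin q) (f : CotFun q V') : CotFun.dxs a (cotHom hT₀ f) =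
    ∑ b, (-1 : ℤ) ^ ((par b + par a) * (par a + 1)) •
      (CotFun.ofBase (jac T₀ b a) * cotHom hT₀ (CotFun.dxs b f)) := by
  rw [cot_chain hT₀ (CotFun.isDer_dxs a) CotFun.hasPar_dxs]
  · simp only [CotFun.dxs_ofBase, zero_mul, Finset.sum_const_zero, zero_add]
    refine Finset.sum_congr rfl fun b _ => ?_
    have : CotFun.dxs a (antiImage T₀ b) =
        (-1 : ℤ) ^ ((par b + par a) * (par a + 1)) • CotFun.ofBase (jac T₀ b a) := by
      rw [antiImage, (CotFun.isDer_dxs a).map_sum, Finset.sum_eq_single a]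
      · rw [(CotFun.isDer_dxs a).map_mul, CotFun.dxs_ofBase, CotFun.dxs_anti, if_pos rfl, zero_mul,
          zero_add, mul_one, (CotFun.hasPar_ofBase (hasPar_jac hT₀ b a)).iterate]
        rfl
      · intro e _ he
        rw [(CotFun.isDer_dxs a).map_mul, CotFun.dxs_ofBase, CotFun.dxs_anti, if_neg he.symm,
          zero_mul, mul_zero, zero_add]
      · simp
    rw [this, smul_mul_assoc]
  · intro h
    simp only [CotFun.dxs_ofBase, zero_mul, Finset.sum_const_zero]

/-! ### The transformation law of the divergence operator -/

theorem dx_antiImage (a e : Fin p ⊕ Fin q) : CotFun.dx a (antiImage T₀ e) =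
    ∑ c, CotFun.ofBase (pderiv a (jac T₀ e c)) * CotFun.anti q V c := by
  rw [antiImage, (CotFun.isDer_dx a).map_sum]
  refine Finset.sum_congr rfl fun c _ => ?_
  rw [(CotFun.isDer_dx a).map_mul, CotFun.dx_ofBase, CotFun.dx_anti, mul_zero, add_zero]
  rfl

/-- The second derivatives of the change of coordinates, contracted with the antimomenta. -/
def hess (b e : Fin p ⊕ Fin q) : CotFun q V :=
  ∑ c, CotFun.ofBase (T₀ (pderiv b (pderiv e (T₀.symm (coord q V c))))) * CotFun.anti q V c

theorem hess_symm (b e : Fin p ⊕ Fin q) :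
    hess (T₀ := T₀) b e = (-1 : ℤ) ^ (par b * par e) • hess (T₀ := T₀) e b := by
  rw [hess, hess, Finset.smul_sum]
  refine Finset.sum_congr rfl fun c _ => ?_
  rw [pderiv_pderiv b e, map_zsmul, ← CotFun.ofBaseHom_apply, map_zsmul, smul_mul_assoc]
  rfl

theorem sum_jac_mul_dx_antiImage (hT₀ : ∀ f, T₀ (parity f) = parity (T₀ f)) (b e : Fin p ⊕ Fin q) :
    ∑ a, CotFun.ofBase (jac T₀ b a) * CotFun.dx a (antiImage T₀ e) = hess (T₀ := T₀) b e := by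
  simp only [dx_antiImage, Finset.mul_sum]
  rw [Finset.sum_comm]
  refine Finset.sum_congr rfl fun c _ => ?_
  rw [← sum_jac_mul hT₀]
  simp only [← CotFun.ofBaseHom_apply, map_sum, map_mul, Finset.sum_mul, mul_assoc]
  rfl

/-- Contraction with the Jacobian turns `∂_a` into `∂_{b'}`, but at fixed `x*` instead of fixed
`x*'`. Since `x*'` depends on `x`, a Hessian correction remains. -/
theorem sum_jac_mul_dx (b : Fin p ⊕ Fin q) (g : CotFun q V') :
    ∑ a, CotFun.ofBase (jac T₀ b a) * CotFun.dx a (cotHom hT₀ g) =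
      cotHom hT₀ (CotFun.dx b g) + ∑ e, hess (T₀ := T₀) b e * cotHom hT₀ (CotFun.dxs e g) := by
  simp only [dx_cotHom, mul_add, Finset.sum_add_distrib, Finset.mul_sum]
  congr 1
  · rw [Finset.sum_comm, Finset.sum_eq_single b]
    · simp only [← mul_assoc]
      rw [← Finset.sum_mul]
      have := congrArg (CotFun.ofBaseHom q V) (sum_jac_mul hT₀ b (coord q V' b))
      rw [pderiv_coord, if_pos rfl, map_one, map_one, map_sum] at this
      simp only [map_mul, CotFun.ofBaseHom_apply] at this
      rw [this, one_mul]
    · intro e _ he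
      simp only [← mul_assoc]
      rw [← Finset.sum_mul]
      have := congrArg (CotFun.ofBaseHom q V) (sum_jac_mul hT₀ b (coord q V' e))
      rw [pderiv_coord, if_neg he.symm, map_zero, map_zero, map_sum] at this
      simp only [map_mul, CotFun.ofBaseHom_apply] at this
      rw [this, zero_mul]
    · simp
  · rw [Finset.sum_comm]
    refine Finset.sum_congr rfl fun e _ => ?_
    simp only [← mul_assoc]
    rw [← Finset.sum_mul, sum_jac_mul_dx_antiImage hT₀]

/-- The derivation that measures the failure of a change of coordinates to preserve the
divergence operator. -/
def shift (f : CotFun q V') : CotFun q V :=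
  ∑ b : Fin p ⊕ Fin q, sgn b • (CotFun.ofBase (logJac T₀ b) * cotHom hT₀ (CotFun.dxs b f))

/-- The transformation law of the divergence operator. -/
theorem divergence_cotHom (f : CotFun q V') :
    CotFun.divergence (cotHom hT₀ f) = cotHom hT₀ (CotFun.divergence f) + shift hT₀ f := by
  -- Either the Jacobian entry is differentiated, which will sum to the logarithmic derivative, or
  -- the function is; in the second case the signs combine to `sgn b`.
  have hterm : ∀ a b : Fin p ⊕ Fin q,
      sgn a • CotFun.dx a ((-1 : ℤ) ^ ((par b + par a) * (par a + 1)) •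
        (CotFun.ofBase (jac T₀ b a) * cotHom hT₀ (CotFun.dxs b f))) =
      CotFun.ofBase ((sgn a * (-1) ^ ((par b + par a) * (par a + 1))) • pderiv a (jac T₀ b a)) *
          cotHom hT₀ (CotFun.dxs b f) +
        sgn b • (CotFun.ofBase (jac T₀ b a) *
          CotFun.dx a (cotHom hT₀ (CotFun.dxs b f))) := by
    intro a b
    have h1 : CotFun.dx a (CotFun.ofBase (jac T₀ b a) * cotHom hT₀ (CotFun.dxs b f)) =
        CotFun.ofBase (pderiv a (jac T₀ b a)) * cotHom hT₀ (CotFun.dxs b f) +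
          (-1 : ℤ) ^ ((par b + par a) * par a) • (CotFun.ofBase (jac T₀ b a) *
            CotFun.dx a (cotHom hT₀ (CotFun.dxs b f))) := by
      refine ((CotFun.isDer_dx a).map_mul _ _).trans ?_
      rw [CotFun.dx_ofBase, (CotFun.hasPar_ofBase (hasPar_jac hT₀ b a)).iterate, id, id,
        smul_mul_assoc]
    rw [(CotFun.isDer_dx a).map_zsmul, h1, smul_smul, smul_add, smul_smul,
      ← CotFun.ofBaseHom_apply (_ • _), map_zsmul, smul_mul_assoc]
    have h2 : sgn a * (-1) ^ ((par b + par a) * (par a + 1)) * (-1) ^ ((par b + par a) * par a) =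
        sgn b := by
      rw [sgn_eq, sgn_eq]
      rcases par_eq a with ha | ha <;> rcases par_eq b with hb | hb <;> simp [ha, hb]
    rw [h2]
    rfl
  have h0 : CotFun.divergence (cotHom hT₀ f) = ∑ b : Fin p ⊕ Fin q, ∑ a : Fin p ⊕ Fin q,
      (CotFun.ofBase ((sgn a * (-1) ^ ((par b + par a) * (par a + 1))) •
          pderiv a (jac T₀ b a)) * cotHom hT₀ (CotFun.dxs b f) +
        sgn b • (CotFun.ofBase (jac T₀ b a) *
          CotFun.dx a (cotHom hT₀ (CotFun.dxs b f)))) := by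
    rw [Finset.sum_comm, CotFun.divergence]
    refine Finset.sum_congr rfl fun a _ => ?_
    rw [dxs_cotHom, (CotFun.isDer_dx a).map_sum, Finset.smul_sum]
    exact Finset.sum_congr rfl fun b _ => hterm a b
  have h1 : ∀ b : Fin p ⊕ Fin q, ∑ a : Fin p ⊕ Fin q,
      (CotFun.ofBase ((sgn a * (-1) ^ ((par b + par a) * (par a + 1))) •
          pderiv a (jac T₀ b a)) * cotHom hT₀ (CotFun.dxs b f) +
        sgn b • (CotFun.ofBase (jac T₀ b a) *
          CotFun.dx a (cotHom hT₀ (CotFun.dxs b f)))) =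
      sgn b • (CotFun.ofBase (logJac T₀ b) * cotHom hT₀ (CotFun.dxs b f)) +
        (cotHom hT₀ (sgn b • CotFun.dx b (CotFun.dxs b f)) +
          ∑ e, sgn b • (hess (T₀ := T₀) b e * cotHom hT₀ (CotFun.dxs e (CotFun.dxs b f)))) := by
    intro b
    rw [Finset.sum_add_distrib, ← Finset.sum_mul, ← Finset.smul_sum, sum_jac_mul_dx, smul_add,
      map_zsmul, Finset.smul_sum, ← smul_mul_assoc]
    congr 2
    simp only [← CotFun.ofBaseHom_apply]
    rw [← map_sum, sum_pderiv_jac hT₀, map_zsmul]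
  have h2 : ∑ b : Fin p ⊕ Fin q, ∑ e : Fin p ⊕ Fin q,
      sgn b • (hess (T₀ := T₀) b e * cotHom hT₀ (CotFun.dxs e (CotFun.dxs b f))) = 0 := by
    refine CotFun.sum_sum_eq_zero_of_antisymm fun b e => ?_
    rw [hess_symm b e, CotFun.dxs_dxs e b, map_zsmul, smul_mul_assoc, mul_smul_comm, ← neg_smul]
    simp only [smul_smul, sgn_eq]
    congr 1
    rcases par_eq b with hb | hb <;> rcases par_eq e with he | he <;> simp [hb, he]
  rw [h0, Finset.sum_congr rfl fun b _ => h1 b, Finset.sum_add_distrib, Finset.sum_add_distrib,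
    h2, add_zero, ← map_sum, add_comm]
  rfl

theorem shift_isDer : IsDer (cotHom hT₀) 1 (shift hT₀) := by
  have := sum_isDer (m := 1) (cotHom_parity hT₀)
    (fun b => (CotFun.hasPar_ofBase (hasPar_logJac hT₀ b)).smul (sgn b))
    (fun b => CotFun.isDer_dxs b) fun b => by rw [← add_assoc, Nat.even_add]; simp
  simp only [smul_mul_assoc] at this
  exact this

end Change

/-! ### Subsets with and without the last generator -/

namespace Grass

variable {n : ℕ} {B : Type*} [Ring B]

theorem eq_map_or_eq_insert (J : Finset (Fin (n + 1))) :
    ∃ I : Finset (Fin n), J = I.map Fin.castSuccEmb ∨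
      J = insert (Fin.last n) (I.map Fin.castSuccEmb) := by
  refine ⟨Finset.univ.filter fun i => Fin.castSucc i ∈ J, ?_⟩
  by_cases h : Fin.last n ∈ J
  · right
    ext j
    induction j using Fin.lastCases with
    | last => simp [h]
    | cast j => simp
  · left
    ext j
    induction j using Fin.lastCases with
    | last => simp [h]
    | cast j => simp

theorem last_notMem_map (I : Finset (Fin n)) : Fin.last n ∉ I.map Fin.castSuccEmb := by
  simp

theorem ordProd_map_castSucc (Θ : Fin (n + 1) → B) (I : Finset (Fin n)) :
    ordProd Θ (I.map Fin.castSuccEmb) = ordProd (fun i => Θ (Fin.castSucc i)) I := by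
  induction I using Finset.induction_on_min with
  | empty => simp
  | insert i I hi ih =>
    rw [ordProd_insert _ hi, Finset.map_insert, ordProd_insert, ih]
    · rfl
    · intro k hk
      obtain ⟨l, hl, rfl⟩ := Finset.mem_map.1 hk
      exact Fin.castSucc_lt_castSucc_iff.2 (hi l hl)

/-- The last generator is the largest, so it stands at the right end without a sign. This is why
elements are normalised as `f + g θ` with `θ` on the right. -/
theorem ordProd_insert_last (Θ : Fin (n + 1) → B) (I : Finset (Fin n)) :
    ordProd Θ (insert (Fin.last n) (I.map Fin.castSuccEmb)) =
      ordProd (fun i => Θ (Fin.castSucc i)) I * Θ (Fin.last n) := by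
  induction I using Finset.induction_on_min with
  | empty => simp
  | insert i I hi ih =>
    rw [ordProd_insert _ hi, Finset.map_insert, Finset.insert_comm, ordProd_insert, ih, mul_assoc]
    · rfl
    · intro k hk
      rcases Finset.mem_insert.1 hk with rfl | hk
      · exact Fin.castSucc_lt_last i
      · obtain ⟨l, hl, rfl⟩ := Finset.mem_map.1 hk
        exact Fin.castSucc_lt_castSucc_iff.2 (hi l hl)

theorem sum_finset_succ (F : Finset (Fin (n + 1)) → B) :
    ∑ J, F J = ∑ I : Finset (Fin n), F (I.map Fin.castSuccEmb) +
      ∑ I : Finset (Fin n), F (insert (Fin.last n) (I.map Fin.castSuccEmb)) := by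
  have h : (Finset.univ : Finset (Finset (Fin (n + 1)))) =
      (insert (Fin.last n) (Finset.univ.map Fin.castSuccEmb)).powerset := by
    ext J
    simp only [Finset.mem_univ, Finset.mem_powerset, true_iff]
    intro j _
    induction j using Fin.lastCases with
    | last => simp
    | cast j => simp
  rw [h, Finset.sum_powerset_insert (by simp)]
  have h2 : ∀ G : Finset (Fin (n + 1)) → B,
      ∑ t ∈ ((Finset.univ : Finset (Fin n)).map Fin.castSuccEmb).powerset, G t =
        ∑ I : Finset (Fin n), G (I.map Fin.castSuccEmb) := by
    intro G
    refine (Finset.sum_bij (fun I _ => I.map Fin.castSuccEmb) ?_ ?_ ?_ ?_).symm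
    · intro I _
      simp only [Finset.mem_powerset]
      exact Finset.map_subset_map.2 (Finset.subset_univ I)
    · intro I _ I' _ h
      exact Finset.map_injective _ h
    · intro J hJ
      rw [Finset.mem_powerset] at hJ
      obtain ⟨I, rfl | rfl⟩ := eq_map_or_eq_insert J
      · exact ⟨I, Finset.mem_univ _, rfl⟩
      · exact absurd (hJ (Finset.mem_insert_self _ _)) (last_notMem_map _)
    · intro I _
      rfl
  rw [h2, h2 fun t => F (insert (Fin.last n) t)]

/-! ### The extension by one odd generator -/

theorem mul_gen_last_apply_map {L : Type*} [CommRing L] (f : Grass (n + 1) L) (I : Finset (Fin n)) :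
    (f * gen (Fin.last n) : Grass (n + 1) L) (I.map Fin.castSuccEmb) = 0 := by
  rw [mul_apply]
  refine Finset.sum_eq_zero fun L _ => ?_
  have : I.map Fin.castSuccEmb \ L ≠ {Fin.last n} := fun h => last_notMem_map I
    (Finset.sdiff_subset (h ▸ Finset.mem_singleton_self (Fin.last n)))
  simp [gen, this]

theorem mul_gen_last_apply_insert {L : Type*} [CommRing L] (f : Grass (n + 1) L)
    (I : Finset (Fin n)) :
    (f * gen (Fin.last n) : Grass (n + 1) L) (insert (Fin.last n) (I.map Fin.castSuccEmb)) =
      f (I.map Fin.castSuccEmb) := by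
  have hl := last_notMem_map I
  rw [mul_apply, Finset.sum_eq_single (I.map Fin.castSuccEmb)]
  · have h1 : insert (Fin.last n) (I.map Fin.castSuccEmb) \ I.map Fin.castSuccEmb =
        {Fin.last n} := by
      rw [Finset.insert_sdiff_of_notMem _ hl]
      simp
    have h2 : (I.map Fin.castSuccEmb).filter (Fin.last n < ·) = ∅ := by
      rw [Finset.filter_eq_empty_iff]
      exact fun k _ => (Fin.le_last k).not_gt
    rw [h1, inv_singleton_right, h2]
    simp [gen]
  · intro L hL hne
    have : insert (Fin.last n) (I.map Fin.castSuccEmb) \ L ≠ {Fin.last n} := by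
      intro h
      apply hne
      rw [Finset.mem_powerset] at hL
      have hlL : Fin.last n ∉ L :=
        (Finset.mem_sdiff.1 (h ▸ Finset.mem_singleton_self (Fin.last n))).2
      rw [Finset.insert_sdiff_of_notMem _ hlL] at h
      refine Finset.Subset.antisymm (fun k hk => ?_) fun k hk => ?_
      · rcases Finset.mem_insert.1 (hL hk) with rfl | h'
        · exact absurd hk hlL
        · exact h'
      · by_contra hkL
        have : k ∈ ({Fin.last n} : Finset _) :=
          h ▸ Finset.mem_insert_of_mem (Finset.mem_sdiff.2 ⟨hk, hkL⟩)
        rw [Finset.mem_singleton] at this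
        exact hl (this ▸ hk)
    simp [gen, this]
  · simp

theorem filter_lt_map_castSucc (j : Fin n) (I : Finset (Fin n)) :
    ((I.map Fin.castSuccEmb).filter (· < Fin.castSucc j)).card = (I.filter (· < j)).card := by
  rw [Finset.filter_map, Finset.card_map]
  rfl

section Extend

variable {K L K' L' : Type*} [CommRing K] [CommRing L] [CommRing K'] [CommRing L']
  (φ : K →+* L) (φ' : K' →+* L') [Algebra ℝ L]

/-- The extension of scalars along `φ`, with one more generator in the target. -/
def extend : Grass n K →+* Grass (n + 1) L :=
  Grass.substHom (Θ := fun i => gen (Fin.castSucc i)) ((CHom (n + 1) L).comp φ)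
    (fun _ b => C_comm _ b) (fun _ => (hasPar_gen _).mul_self)
    fun _ _ => (hasPar_gen _).anticomm (hasPar_gen _)

theorem extend_eq_sum (f : Grass n K) :
    extend φ f = ∑ I : Finset (Fin n), C (φ (f I)) * mono (I.map Fin.castSuccEmb) := by
  change Grass.subst _ _ f = _
  rw [subst_eq_sum]
  refine Finset.sum_congr rfl fun I _ => ?_
  exact congrArg _ (ordProd_gen_comp Fin.castSuccOrderEmb I)

theorem extend_apply_map (f : Grass n K) (I : Finset (Fin n)) :
    extend φ f (I.map Fin.castSuccEmb) = φ (f I) := by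
  rw [extend_eq_sum, Grass.sum_apply, Finset.sum_eq_single I]
  · simp [C_mul_apply, mono]
  · intro L _ hL
    have : I.map Fin.castSuccEmb ≠ L.map Fin.castSuccEmb := fun h =>
      hL (Finset.map_injective _ h).symm
    simp [C_mul_apply, mono, this]
  · simp

theorem extend_apply_insert (f : Grass n K) (I : Finset (Fin n)) :
    extend φ f (insert (Fin.last n) (I.map Fin.castSuccEmb)) = 0 := by
  rw [extend_eq_sum, Grass.sum_apply]
  refine Finset.sum_eq_zero fun L _ => ?_
  have : insert (Fin.last n) (I.map Fin.castSuccEmb) ≠ L.map Fin.castSuccEmb := fun h =>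
    last_notMem_map L (h ▸ Finset.mem_insert_self _ _)
  simp [C_mul_apply, mono, this]

theorem extend_C (a : K) : extend φ (C a : Grass n K) = C (φ a) :=
  subst_C (Θ := fun i : Fin n => gen (Fin.castSucc i)) ((CHom (n + 1) L).comp φ) a

theorem extend_gen (i : Fin n) : extend φ (gen i) = gen (Fin.castSucc i) :=
  subst_gen ((CHom (n + 1) L).comp φ) i

theorem extend_parity (f : Grass n K) : extend φ (parity f) = parity (extend φ f) := by
  ext J
  obtain ⟨I, rfl | rfl⟩ := eq_map_or_eq_insert J
  · simp [parity, extend_apply_map]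
  · simp [parity, extend_apply_insert]

/-- The element `f + g θ`, where `θ` is the last generator. -/
def norm (f g : Grass n K) : Grass (n + 1) L := extend φ f + extend φ g * gen (Fin.last n)

theorem norm_apply_map (f g : Grass n K) (I : Finset (Fin n)) :
    norm φ f g (I.map Fin.castSuccEmb) = φ (f I) := by
  rw [norm, add_apply, extend_apply_map, mul_gen_last_apply_map, add_zero]

theorem norm_apply_insert (f g : Grass n K) (I : Finset (Fin n)) :
    norm φ f g (insert (Fin.last n) (I.map Fin.castSuccEmb)) = φ (g I) := by
  rw [norm, add_apply, extend_apply_insert, mul_gen_last_apply_insert, extend_apply_map, zero_add]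

variable {φ}

theorem eq_norm {F : Grass (n + 1) L} {f g : Grass n K}
    (h1 : ∀ I : Finset (Fin n), F (I.map Fin.castSuccEmb) = φ (f I))
    (h2 : ∀ I : Finset (Fin n), F (insert (Fin.last n) (I.map Fin.castSuccEmb)) = φ (g I)) :
    F = norm φ f g := by
  ext1 J
  obtain ⟨I, rfl | rfl⟩ := eq_map_or_eq_insert J
  · rw [h1, norm_apply_map]
  · rw [h2, norm_apply_insert]

theorem norm_injective (hφ : Function.Injective φ) {f g f' g' : Grass n K}
    (h : norm φ f g = norm φ f' g') : f = f' ∧ g = g' := by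
  constructor
  · ext1 I
    apply hφ
    rw [← norm_apply_map φ f g, h, norm_apply_map]
  · ext1 I
    apply hφ
    rw [← norm_apply_insert φ f g, h, norm_apply_insert]

theorem norm_add (f g f' g' : Grass n K) :
    norm φ f g + norm φ f' g' = norm φ (f + f') (g + g') := by
  simp only [norm, map_add, add_mul]
  abel

theorem norm_zero : norm φ (0 : Grass n K) 0 = 0 := by
  simp only [norm, map_zero, zero_mul, add_zero]

theorem norm_zero_right (f : Grass n K) : norm φ f 0 = extend φ f := by
  simp only [norm, map_zero, zero_mul, add_zero]

theorem norm_zsmul (k : ℤ) (f g : Grass n K) : k • norm φ f g = norm φ (k • f) (k • g) := by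
  simp only [norm, map_zsmul, smul_add, smul_mul_assoc]

theorem norm_sum {ι : Type*} (s : Finset ι) (f g : ι → Grass n K) :
    ∑ i ∈ s, norm φ (f i) (g i) = norm φ (∑ i ∈ s, f i) (∑ i ∈ s, g i) := by
  simp only [norm, map_sum, Finset.sum_add_distrib, Finset.sum_mul]

theorem gen_last_mul_extend (f : Grass n K) :
    gen (Fin.last n) * extend φ f = extend φ (parity f) * gen (Fin.last n) := by
  rw [(hasPar_gen _).supercomm, Function.iterate_one, extend_parity]

theorem parity_norm (f g : Grass n K) :
    parity (norm φ f g) = norm φ (parity f) (-parity g) := by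
  rw [norm, norm, parity_add, parity_mul, ← extend_parity, ← extend_parity, parity_gen, mul_neg,
    map_neg, neg_mul]

theorem extend_mul_gen_mul_extend_mul_gen (f g : Grass n K) :
    extend φ f * gen (Fin.last n) * (extend φ g * gen (Fin.last n)) = 0 := by
  rw [← mul_assoc, mul_assoc (extend φ f), gen_last_mul_extend, ← mul_assoc, mul_assoc,
    (hasPar_gen _).mul_self, mul_zero]

/-- Moving `θ` to the right past `f'` applies the parity involution, and the product of the two
`θ`-terms vanishes. -/
theorem norm_mul (f g f' g' : Grass n K) :
    norm φ f g * norm φ f' g' = norm φ (f * f') (f * g' + g * parity f') := by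
  have e1 : extend φ g * gen (Fin.last n) * extend φ f' =
      extend φ (g * parity f') * gen (Fin.last n) := by
    rw [mul_assoc, gen_last_mul_extend, ← mul_assoc, ← map_mul]
  rw [norm, norm, norm, add_mul, mul_add, mul_add, e1, extend_mul_gen_mul_extend_mul_gen]
  simp only [map_mul, map_add, add_mul, add_zero, ← mul_assoc]
  abel

variable [Algebra ℝ L'] {φ'}

theorem map_norm {D : L → L'} {D' : K → K'} (h : ∀ P, D (φ P) = φ' (D' P)) (f g : Grass n K) :
    map D (norm φ f g) = norm φ' (map D' f) (map D' g) := by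
  refine eq_norm (fun I => ?_) fun I => ?_
  · change D (norm φ f g _) = _
    rw [norm_apply_map, h]
    rfl
  · change D (norm φ f g _) = _
    rw [norm_apply_insert, h]
    rfl

theorem leftDeriv_castSucc_norm (j : Fin n) (f g : Grass n K) :
    leftDeriv (Fin.castSucc j) (norm φ f g) = norm φ (leftDeriv j f) (leftDeriv j g) := by
  have h1 : ∀ I : Finset (Fin n), insert (Fin.castSucc j) (I.map Fin.castSuccEmb) =
      (insert j I).map Fin.castSuccEmb := fun I => (Finset.map_insert _ _ _).symm
  refine eq_norm (fun I => ?_) fun I => ?_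
  · simp only [leftDeriv]
    rw [filter_lt_map_castSucc, h1, norm_apply_map]
    by_cases h : j ∈ I <;> simp [h]
  · simp only [leftDeriv]
    rw [Finset.insert_comm, h1, norm_apply_insert, Finset.filter_insert,
      if_neg (Fin.castSucc_lt_last j).asymm, filter_lt_map_castSucc]
    by_cases h : j ∈ I <;> simp [h, (Fin.castSucc_lt_last j).ne]

/-- A left derivative must cross `g` before reaching `θ`, hence the parity involution. -/
theorem leftDeriv_last_norm (f g : Grass n K) :
    leftDeriv (Fin.last n) (norm φ f g) = extend φ (parity g) := by
  rw [← norm_zero_right]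
  refine eq_norm (fun I => ?_) fun I => ?_
  · simp only [leftDeriv]
    have h1 : (I.map Fin.castSuccEmb).filter (· < Fin.last n) = I.map Fin.castSuccEmb := by
      rw [Finset.filter_eq_self]
      intro k hk
      obtain ⟨l, -, rfl⟩ := Finset.mem_map.1 hk
      exact Fin.castSucc_lt_last l
    rw [if_neg (last_notMem_map I), h1, norm_apply_insert, Finset.card_map, parity, map_mul]
    simp
  · simp [leftDeriv]

end Extend

end Grass

/-! ### Fibre polynomials with one more odd generator -/

namespace Fib

open Grass

variable {n : ℕ} {F G F' G' : Type*} [CommRing F] [CommRing G] [CommRing F'] [CommRing G']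
  [Algebra ℝ G'] [Algebra ℝ G]

/-- Ring homomorphisms of commutative rings. -/
abbrev CRHom (F G : Type*) [CommRing F] [CommRing G] := F →+* G

/-- The extension of scalars along `φ`, with one more odd generator in the target. -/
def extend (q : ℕ) (φ : CRHom F G) (f : Fib n q F) : Fib (n + 1) q G :=
  Grass.extend (MvPolynomial.map φ) f

/-- The element `f + g θ`, where `θ` is the last generator. -/
def norm (φ : CRHom F G) (f g : Fib n q F) : Fib (n + 1) q G :=
  Grass.norm (MvPolynomial.map φ) f g

variable {φ : CRHom F G} {φ' : CRHom F' G'}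

theorem subst_eq_extend (f : Fib n q F) :
    subst (fun c => (base (φ c) : Fib (n + 1) q G)) (fun α => Grass.C (MvPolynomial.X α))
      (fun i => Grass.gen (Fin.castSucc i)) f = extend q φ f := by
  have hbase : ∀ a : F, HasPar 0 ((baseHom (n + 1) q G).comp φ a) := fun a => hasPar_C _
  refine (substHom_apply (κ := (baseHom (n + 1) q G).comp φ) (n := n)
    (η := fun α => Grass.C (MvPolynomial.X α)) (Θ := fun i => Grass.gen (Fin.castSucc i))
    hbase (fun _ => hasPar_C _) (fun _ => hasPar_gen _) f).symm.trans ?_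
  refine RingHom.congr_fun (hom_ext (T' := Grass.extend (MvPolynomial.map φ))
    (fun a => ?_) (fun α => ?_) fun i => ?_) f
  · rw [substHom_base, base, extend_C, MvPolynomial.map_C]
    rfl
  · rw [substHom_X, extend_C, MvPolynomial.map_X]
  · rw [substHom_gen, extend_gen]

theorem extend_mul (f g : Fib n q F) : extend q φ (f * g) = extend q φ f * extend q φ g :=
  map_mul (Grass.extend (MvPolynomial.map φ)) f g

theorem gen_last_mul_extend (f : Fib n q F) :
    gen (Fin.last n) * extend q φ f = extend q φ (parity f) * gen (Fin.last n) :=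
  Grass.gen_last_mul_extend f

theorem norm_zero_right (f : Fib n q F) : norm φ f 0 = extend q φ f :=
  Grass.norm_zero_right f

theorem norm_injective (hφ : Function.Injective φ) {f g f' g' : Fib n q F}
    (h : norm φ f g = norm φ f' g') : f = f' ∧ g = g' :=
  Grass.norm_injective (MvPolynomial.map_injective _ hφ) h

theorem norm_zero : norm φ (0 : Fib n q F) 0 = 0 := Grass.norm_zero

theorem norm_add (f g f' g' : Fib n q F) :
    norm φ f g + norm φ f' g' = norm φ (f + f') (g + g') := Grass.norm_add f g f' g'

theorem norm_mul (f g f' g' : Fib n q F) :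
    norm φ f g * norm φ f' g' = norm φ (f * f') (f * g' + g * parity f') :=
  Grass.norm_mul f g f' g'

theorem norm_zsmul (k : ℤ) (f g : Fib n q F) : k • norm φ f g = norm φ (k • f) (k • g) :=
  Grass.norm_zsmul k f g

theorem norm_sum {ι : Type*} (s : Finset ι) (f g : ι → Fib n q F) :
    ∑ i ∈ s, norm φ (f i) (g i) = norm φ (∑ i ∈ s, f i) (∑ i ∈ s, g i) := Grass.norm_sum s f g

theorem parity_norm (f g : Fib n q F) :
    parity (norm φ f g) = norm φ (parity f) (-parity g) := Grass.parity_norm f g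

theorem leftDeriv_castSucc_norm (j : Fin n) (f g : Fib n q F) :
    leftDeriv (Fin.castSucc j) (norm φ f g) = norm φ (leftDeriv j f) (leftDeriv j g) :=
  Grass.leftDeriv_castSucc_norm j f g

theorem leftDeriv_last_norm (f g : Fib n q F) :
    leftDeriv (Fin.last n) (norm φ f g) = extend q φ (parity g) :=
  Grass.leftDeriv_last_norm f g

theorem pderiv_norm (α : Fin q) (f g : Fib n q F) :
    Grass.map (MvPolynomial.pderiv α) (norm φ f g) =
      norm φ (Grass.map (MvPolynomial.pderiv α) f) (Grass.map (MvPolynomial.pderiv α) g) :=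
  Grass.map_norm (fun _ => MvPolynomial.pderiv_map) f g

theorem onCoeff_norm {D : G → G'} {D' : F → F'} (hD : D 0 = 0) (hD' : D' 0 = 0)
    (h : ∀ c, D (φ c) = φ' (D' c)) (f g : Fib n q F) :
    onCoeff D (norm φ f g) = norm φ' (onCoeff D' f) (onCoeff D' g) := by
  refine Grass.map_norm (fun P => ?_) f g
  change polyMap D _ = _
  refine MvPolynomial.ext _ _ fun m => ?_
  rw [coeff_polyMap hD, MvPolynomial.coeff_map, h, MvPolynomial.coeff_map]
  congr 1
  exact (coeff_polyMap hD' _ _).symm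

theorem onCoeff_norm_eq_zero {D : G → G} (hD : D 0 = 0) (h : ∀ c, D (φ c) = 0) (f g : Fib n q F) :
    onCoeff D (norm φ f g) = 0 := by
  refine (onCoeff_norm (φ' := φ) (D' := fun _ => 0) hD rfl (fun c => (h c).trans ?_) f g).trans ?_
  · exact (map_zero φ).symm
  · have : ∀ f : Fib n q F, onCoeff (fun _ : F => (0 : F)) f = 0 := by
      intro f
      ext1 I
      refine MvPolynomial.ext _ _ fun m => ?_
      rw [coeff_onCoeff rfl]
      rfl
    rw [this, this, norm_zero]

/-- Meant for the product of the derivatives along `t*` and `t`, with `u` and `v` the powers `t` and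
`t⁻¹`: apart from even factors and `θ` it contains `g * g`. -/
theorem base_mul_mul_base_mul {u v : G} {g : Fib n q F} (hg : HasPar 1 g) (hgg : g * g = 0) :
    (base u : Fib (n + 1) q G) * extend q φ (parity g) *
      (base v * (extend q φ g * gen (Fin.last n))) = 0 := by
  have hv : HasPar 0 (base v : Fib (n + 1) q G) := hasPar_C _
  have e : parity g * g = 0 := by
    have := hg
    rw [HasPar, pow_one, neg_smul, one_smul] at this
    rw [this, neg_mul, hgg, neg_zero]
  have e' : extend q φ (parity g) * extend q φ g = 0 := by
    rw [← extend_mul, e]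
    exact map_zero (Grass.extend (MvPolynomial.map φ))
  rw [mul_assoc, ← mul_assoc (extend q φ (parity g)), ← hv.commute (extend q φ (parity g)),
    mul_assoc, ← mul_assoc (extend q φ (parity g)), e', zero_mul, mul_zero, mul_zero]

theorem base_mul_mul_base_mul' {u v : G} {g : Fib n q F} (hgg : g * g = 0) :
    (base v : Fib (n + 1) q G) * (extend q φ g * gen (Fin.last n)) *
      (base u * extend q φ (parity g)) = 0 := by
  have hu : HasPar 0 (base u : Fib (n + 1) q G) := hasPar_C _
  have e' : extend q φ g * extend q φ g = 0 := by
    rw [← extend_mul, hgg]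
    exact map_zero (Grass.extend (MvPolynomial.map φ))
  rw [mul_assoc, ← mul_assoc (extend q φ g * gen (Fin.last n)),
    ← hu.commute (extend q φ g * gen (Fin.last n)), mul_assoc, mul_assoc, gen_last_mul_extend,
    parity_parity, ← mul_assoc (extend q φ g), e', zero_mul, mul_zero, mul_zero]

end Fib

/-! ### The normal form of functions of weight zero -/

namespace HatFun

open Grass

variable {V V' : Opens (Fin p → ℝ)}

/-- The inclusion of the smooth functions as densities of weight zero. -/
def weightZero (V : Opens (Fin p → ℝ)) : Fib.CRHom (Smooth V) (DensityBase V) :=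
  AddMonoidAlgebra.singleZeroRingHom

theorem weightZero_apply (c : Smooth V) : weightZero V c = AddMonoidAlgebra.single 0 c := rfl

theorem weightZero_injective : Function.Injective (weightZero V) := by
  intro a b h
  have := congrArg (fun f : DensityBase V => f.coeff 0) h
  simpa [weightZero_apply] using this

theorem ofCot_eq_extend (f : CotFun q V) : ofCot f = Fib.extend q (weightZero V) f :=
  Fib.subst_eq_extend (φ := weightZero V) f

/-- The function `f(x, x̂*) + g(x, x̂*) w*`. -/
def norm (f g : CotFun q V) : HatFun q V := Fib.norm (weightZero V) f g

theorem ofCot_add_ofCot_mul_wStar (f g : CotFun q V) :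
    ofCot f + ofCot g * wStar q V = norm f g := by
  rw [ofCot_eq_extend, ofCot_eq_extend]
  rfl

theorem wStar_mul_ofCot (f : CotFun q V) :
    wStar q V * ofCot f = ofCot (parity f) * wStar q V := by
  rw [ofCot_eq_extend, ofCot_eq_extend]
  exact Fib.gen_last_mul_extend f

theorem onDensity_single {D : ℝ → Smooth V → Smooth V'} (h : D 0 0 = 0) (c : Smooth V) :
    onDensity D (AddMonoidAlgebra.single 0 c) = AddMonoidAlgebra.single 0 (D 0 c) := by
  rw [onDensity, AddMonoidAlgebra.coeff_single, Finsupp.sum_single_index]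
  rw [h, AddMonoidAlgebra.single_zero]

theorem onDensity_zero (D : ℝ → Smooth V → Smooth V') : onDensity D 0 = 0 := by
  rw [onDensity, AddMonoidAlgebra.coeff_zero, Finsupp.sum_zero_index]

theorem dx_norm (a : Fin p ⊕ Fin q) (f g : CotFun q V) :
    dx a (norm f g) = norm (CotFun.dx a f) (CotFun.dx a g) := by
  rcases a with a | a
  · exact Fib.onCoeff_norm (φ := weightZero V) (φ' := weightZero V) (onDensity_zero _)
      (Smooth.pderiv_zero a) (onDensity_single (D := fun _ => Smooth.pderiv a)
        (Smooth.pderiv_zero a)) f g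
  · exact Fib.leftDeriv_castSucc_norm _ f g

theorem dxs_norm (a : Fin p ⊕ Fin q) (f g : CotFun q V) :
    dxs a (norm f g) = norm (CotFun.dxs a f) (CotFun.dxs a g) := by
  rcases a with a | a
  · exact Fib.leftDeriv_castSucc_norm _ f g
  · exact Fib.pderiv_norm a f g

theorem restrict_norm (h : V' ≤ V) (f g : CotFun q V) :
    restrict h (norm f g) = norm (CotFun.restrict h f) (CotFun.restrict h g) :=
  Fib.onCoeff_norm (φ := weightZero V) (φ' := weightZero V') (onDensity_zero _)
    (Smooth.restrictHom h).map_zero (onDensity_single (D := fun _ => Smooth.restrict h)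
      (Smooth.restrictHom h).map_zero) f g

/-- In weight zero `t` enters only through `w* = t t*`, so `t ∂/∂t` acts as `w* ∂/∂w*`, which
reproduces the `w*` term. -/
theorem dt_norm (f g : CotFun q V) : dt (norm f g) =
    tpow q V (-1) * (Fib.extend q (weightZero V) g * gen (Fin.last (q + p))) := by
  have h : Fib.onCoeff (onDensity fun μ c => μ • c) (norm f g) = 0 := by
    refine Fib.onCoeff_norm_eq_zero (φ := weightZero V) (onDensity_zero _) (fun c => ?_) f g
    rw [weightZero_apply, onDensity_single (D := fun μ c => μ • c) (zero_smul ℝ (0 : Smooth V)),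
      zero_smul ℝ c,
      AddMonoidAlgebra.single_zero]
  have h2 : wStar q V * dw (norm f g) =
      Fib.extend q (weightZero V) g * gen (Fin.last (q + p)) := by
    refine (congrArg _ (Fib.leftDeriv_last_norm f g)).trans
      ((Fib.gen_last_mul_extend _).trans ?_)
    rw [parity_parity]
  rw [dt, h, zero_add, h2]

theorem dts_norm (f g : CotFun q V) :
    dts (norm f g) = tpow q V 1 * Fib.extend q (weightZero V) (parity g) := by
  have h : dw (norm f g) = Fib.extend q (weightZero V) (parity g) := Fib.leftDeriv_last_norm f g
  rw [dts, h]

/-- The contributions of `t` and `t*` contain `g * g = 0`. All other derivatives pass through the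
normal form, and the two cross terms between `s` and `g w*` coincide. -/
theorem bracket_norm {s g : CotFun q V} (hs : HasPar 0 s) (hg : HasPar 1 g) :
    bracket (norm s g) (norm s g) =
      norm (CotFun.bracket s s) (CotFun.bracket s g + CotFun.bracket s g) := by
  have hsk : ∀ k, parity^[k] s = s := fun k => by
    rw [hs.iterate, zero_mul, pow_zero, one_smul]
  have hgp : parity g = -g := by
    have := hg
    rwa [HasPar, pow_one, neg_smul, one_smul] at this
  have hN : parity (norm s g) = norm s g := by
    refine (Fib.parity_norm s g).trans ?_
    rw [hgp, neg_neg, show parity s = s from hsk 1]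
    rfl
  have hNk : ∀ k, parity^[k] (norm s g) = norm s g := fun k => by
    induction k with
    | zero => rfl
    | succ k ih => rw [Function.iterate_succ_apply', ih, hN]
  have e1 : dts (norm s g) * dt (norm s g) = 0 := by
    rw [dts_norm, dt_norm]
    exact Fib.base_mul_mul_base_mul hg hg.mul_self
  have e2 : dt (norm s g) * dts (norm s g) = 0 := by
    rw [dts_norm, dt_norm]
    exact Fib.base_mul_mul_base_mul' hg.mul_self
  have hterm : ∀ a : Fin p ⊕ Fin q, sgn a • (dxs a (norm s g) * dx a (norm s g) +
      dx a (norm s g) * dxs a (norm s g)) =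
      norm (sgn a • (CotFun.dxs a s * CotFun.dx a s + CotFun.dx a s * CotFun.dxs a s))
        (sgn a • (CotFun.dxs a s * CotFun.dx a g + CotFun.dx a s * CotFun.dxs a g) +
          sgn a • (CotFun.dxs a s * CotFun.dx a g + CotFun.dx a s * CotFun.dxs a g)) := by
    intro a
    -- This and `h2` reorder the cross terms in which the `w*` part stands first, so that each half
    -- of the bracket with `g` occurs twice.
    have h1 : CotFun.dxs a g * parity (CotFun.dx a s) = CotFun.dx a s * CotFun.dxs a g := by
      have p1 := CotFun.hasPar_dx (a := a) hs
      have p2 := CotFun.hasPar_dxs (a := a) hg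
      have p1' : parity (CotFun.dx a s) = _ := p1
      rw [p1.supercomm, p2.iterate, p1', mul_smul_comm, smul_mul_assoc]
      congr 1
      rcases par_eq a with ha | ha <;> simp [ha]
    have h2 : CotFun.dx a g * parity (CotFun.dxs a s) = CotFun.dxs a s * CotFun.dx a g := by
      have p1 := CotFun.hasPar_dxs (a := a) hs
      have p2 := CotFun.hasPar_dx (a := a) hg
      have p1' : parity (CotFun.dxs a s) = _ := p1
      rw [p1.supercomm, p2.iterate, p1', mul_smul_comm, smul_mul_assoc]
      congr 1
      rcases par_eq a with ha | ha <;> simp [ha]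
    rw [dx_norm, dxs_norm]
    have e : ∀ f g f' g' : CotFun q V, norm f g * norm f' g' =
      norm (f * f') (f * g' + g * parity f') := Fib.norm_mul
    have e' : ∀ f g f' g' : CotFun q V, norm f g + norm f' g' = norm (f + f') (g + g') :=
      Fib.norm_add
    have e'' : ∀ (k : ℤ) (f g : CotFun q V), k • norm f g = norm (k • f) (k • g) := Fib.norm_zsmul
    rw [e, e, e', e'', h1, h2, ← smul_add, add_comm (CotFun.dx a s * CotFun.dxs a g)]
  rw [bracket, hN, e1, e2, add_zero, add_zero]
  simp only [hNk, hterm]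
  refine (Fib.norm_sum _ _ _).trans ?_
  rw [Finset.sum_add_distrib]
  simp only [CotFun.bracket, hsk]
  rfl

end HatFun

/-! ### Substitution into `f + g θ` -/

namespace Grass

theorem map_ordProd {n : ℕ} {B B' : Type*} [Ring B] [Ring B'] (φ : B →+* B') (Θ : Fin n → B)
    (I : Finset (Fin n)) : φ (ordProd Θ I) = ordProd (fun i => φ (Θ i)) I := by
  rw [ordProd, map_list_prod, List.map_map]
  rfl

end Grass

namespace Fib

open Grass

variable {n : ℕ} {F G : Type*} [CommRing F] [CommRing G] [Algebra ℝ G] {φ : CRHom F G}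

/-- Substitution in an element `f + g θ`. -/
theorem subst_norm {B : Type*} [Ring B] (hφ : Function.Injective φ) (κ : G → B) (η : Fin q → B)
    (Θ : Fin (n + 1) → B) (f g : Fib n q F) :
    subst κ η Θ (norm φ f g) =
      subst (fun a => κ (φ a)) η (fun i => Θ (Fin.castSucc i)) f +
        subst (fun a => κ (φ a)) η (fun i => Θ (Fin.castSucc i)) g * Θ (Fin.last n) := by
  -- `κ` is an arbitrary map and may not send zero to zero, so the sums over supports match only
  -- because injectivity of `φ` preserves the support.
  have h : ∀ P : MvPolynomial (Fin q) F,
      ∑ m ∈ (MvPolynomial.map φ P).support, κ ((MvPolynomial.map φ P).coeff m) *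
        (List.ofFn fun α => η α ^ m α).prod =
      ∑ m ∈ P.support, κ (φ (P.coeff m)) * (List.ofFn fun α => η α ^ m α).prod := by
    intro P
    rw [MvPolynomial.support_map_of_injective P hφ]
    simp only [MvPolynomial.coeff_map]
  simp only [subst, subst_eq_sum]
  rw [sum_finset_succ, Finset.sum_mul]
  simp only [norm, norm_apply_map, norm_apply_insert, h, ordProd_map_castSucc,
    ordProd_insert_last, mul_assoc]

theorem norm_add_norm_mul_gen (f g f' g' : Fib n q F) :
    norm φ f g + norm φ f' g' * gen (Fin.last n) = norm φ f (f' + g) := by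
  have h : (gen (Fin.last n) : Fib (n + 1) q G) = norm φ 0 1 := by
    rw [norm, Grass.norm, map_zero, map_one, one_mul, zero_add]
  rw [h, norm_mul, norm_add, mul_zero, parity_zero, mul_zero, mul_one, add_zero, add_zero]
  exact congrArg (norm φ f) (add_comm _ _)

theorem hasPar_norm {k : ℕ} {f g : Fib n q F} (hf : HasPar k f) (hg : HasPar (k + 1) g) :
    HasPar k (norm φ f g) := by
  unfold HasPar at *
  rw [parity_norm, hf, hg, norm_zsmul, pow_succ, mul_neg_one, neg_smul, neg_neg]

section

variable {m : ℕ} {q' : ℕ} {F' : Type*} [CommRing F'] [Algebra ℝ F] {κ : F' →+* Fib m q F}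
  {η : Fin q' → Fib m q F} {Θ : Fin n → Fib m q F}

/-- A homomorphism and an odd derivation along it combine into a homomorphism to the extension
by one odd generator. -/
def normHom (φ : CRHom F G) {T : Fib n q' F' →+* Fib m q F} {E : Fib n q' F' → Fib m q F}
    (hT : ∀ f, T (parity f) = parity (T f)) (hE : IsDer T 1 E) (hE0 : ∀ a, E (base a) = 0) :
    Fib n q' F' →+* Fib (m + 1) q G where
  toFun f := norm φ (T f) (parity (E f))
  map_zero' := by rw [map_zero, hE.map_zero, parity_zero, norm_zero]
  map_one' := by
    rw [map_one, show E 1 = 0 from hE0 1, parity_zero, norm_zero_right]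
    exact map_one (Grass.extend (MvPolynomial.map φ))
  map_add' f g := by rw [map_add, hE.map_add, parity_add, norm_add]
  map_mul' f g := by
    rw [map_mul, hE.map_mul, parity_add, parity_mul, parity_mul, norm_mul, Function.iterate_one,
      hT, parity_parity]
    exact congrArg (norm φ _) (add_comm _ _)

/-- A Taylor expansion that stops at first order because `θ` squares to zero. Both sides are ring
homomorphisms with the same values on coefficients and generators. -/
theorem subst_eq_normHom (hκ : ∀ a, HasPar 0 (κ a)) (hη : ∀ α, HasPar 0 (η α))
    (hΘ : ∀ i, HasPar 1 (Θ i)) {E : Fib n q' F' → Fib m q F}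
    (hE : IsDer (substHom hκ hη hΘ) 1 E) (hE0 : ∀ a, E (base a) = 0)
    (hEp : ∀ f, parity (E f) = -E (parity f)) (f : Fib n q' F') :
    subst (fun a => extend q φ (κ a))
      (fun α => norm φ (η α) (parity (E (Grass.C (MvPolynomial.X α)))))
      (fun i => norm φ (Θ i) (parity (E (gen i)))) f =
      norm φ (substHom hκ hη hΘ f) (parity (E f)) := by
  have hκ' : ∀ a, HasPar 0 (((Grass.extend (MvPolynomial.map φ)).comp κ) a) := fun a =>
    hasPar_norm (φ := φ) (g := 0) (hκ a) (by simp [HasPar]) |>.congr Iff.rfl |> fun h => by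
      rwa [norm_zero_right] at h
  have hη' : ∀ α, HasPar 0 (norm φ (η α) (parity (E (Grass.C (MvPolynomial.X α))))) := fun α =>
    hasPar_norm (hη α) (by
      unfold HasPar
      rw [parity_parity, hEp, parity_C, smul_neg]
      simp)
  have hΘ' : ∀ i, HasPar 1 (norm φ (Θ i) (parity (E (gen i)))) := fun i =>
    hasPar_norm (hΘ i) (by
      unfold HasPar
      rw [parity_parity, hEp, parity_gen, hE.map_neg, neg_neg]
      simp)
  refine (substHom_apply hκ' hη' hΘ' f).symm.trans ?_
  refine RingHom.congr_fun (hom_ext (T' := normHom φ (substHom_parity hκ hη hΘ) hE hE0)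
    (fun a => ?_) (fun α => ?_) fun i => ?_) f
  · rw [substHom_base]
    change _ = norm φ _ _
    rw [substHom_base, hE0, parity_zero, norm_zero_right]
    rfl
  · rw [substHom_X]
    change _ = norm φ _ _
    rw [substHom_X]
  · rw [substHom_gen]
    change _ = norm φ _ _
    rw [substHom_gen]

end

end Fib

/-! ### Changes of coordinates in weight zero -/

namespace HatFun

open Grass

variable {V V' : Opens (Fin p → ℝ)}

theorem ofBase_eq_extend (f : SuperFun q V) :
    ofBase f = Fib.extend q (weightZero V) (CotFun.ofBase f) := by
  have h : ∀ g : CotFun q V, Fib.extend q (weightZero V) g =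
    Grass.extend (MvPolynomial.map (weightZero V)) g := fun _ => rfl
  rw [h, CotFun.ofBase, ofBase, subst_eq_sum, subst_eq_sum, map_sum]
  refine Finset.sum_congr rfl fun I _ => ?_
  rw [map_mul, map_ordProd]
  congr 1
  · rw [Fib.base, Fib.base, extend_C, MvPolynomial.map_C]
    rfl
  · simp only [extend_gen]

theorem anti_eq_extend (a : Fin p ⊕ Fin q) :
    anti q V a = Fib.extend q (weightZero V) (CotFun.anti q V a) := by
  rcases a with a | a
  · exact (extend_gen _ _).symm
  · refine Eq.trans ?_ (extend_C _ _).symm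
    rw [MvPolynomial.map_X]
    rfl

end HatFun

/-- Makes the Berezinian factor disappear on functions of weight zero; no property of the Berezinian
is needed. -/
theorem SuperFun.absRpow_zero {V : Opens (Fin p → ℝ)} (g : SuperFun q V) :
    SuperFun.absRpow g 0 = 1 := by
  have h1 : Smooth.absRpow (g ∅) 0 = 1 := by
    unfold Smooth.absRpow
    split_ifs
    · ext x
      simp
    · rfl
  rw [SuperFun.absRpow, h1, Finset.sum_eq_single 0]
  · rw [Ring.choose_zero_right, pow_zero, one_smul, mul_one]
    rfl
  · intro k _ hk
    rw [Ring.choose_zero_pos ℝ (Nat.pos_of_ne_zero hk), zero_smul]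
  · simp

namespace Change

open Grass SuperFun

variable {V V' : Opens (Fin p → ℝ)} {T₀ : SuperFun q V' ≃ₐ[ℝ] SuperFun q V}
variable (hT₀ : ∀ f, T₀ (parity f) = parity (T₀ f))

theorem parity_shift (f : CotFun q V') : parity (shift hT₀ f) = -shift hT₀ (parity f) := by
  rw [shift, shift, parity_sum, ← Finset.sum_neg_distrib]
  refine Finset.sum_congr rfl fun b _ => ?_
  have h := CotFun.hasPar_ofBase (hasPar_logJac hT₀ b)
  rw [HasPar] at h
  rw [parity_zsmul, parity_mul, h, ← cotHom_parity, CotFun.parity_dxs, map_zsmul, smul_mul_assoc,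
    mul_smul_comm, smul_smul, smul_smul, mul_assoc, ← pow_add, Odd.neg_one_pow, mul_neg_one,
    neg_smul]
  · rw [← add_assoc]
    exact (Even.add_self _).add_one

theorem shift_base (h : Smooth V') : shift hT₀ (Fib.base h) = 0 := by
  simp only [shift, CotFun.dxs_base, map_zero, mul_zero, smul_zero, Finset.sum_const_zero]

theorem shift_gen (i : Fin q) : shift hT₀ (gen (Fin.castAdd p i)) = 0 := by
  simp only [shift, CotFun.dxs_gen, map_zero, mul_zero, smul_zero, Finset.sum_const_zero]

/-- Identifies the `w*` coefficient in the transformation of `x̂*_b` with the divergence defect on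
`x*_b`. The sign `sgn b` is absorbed by the parity of `logJac`. -/
theorem parity_shift_anti (b : Fin p ⊕ Fin q) :
    parity (shift hT₀ (CotFun.anti q V' b)) = CotFun.ofBase (logJac T₀ b) := by
  rw [shift, Finset.sum_eq_single b]
  · rw [CotFun.dxs_anti, if_pos rfl, map_one, mul_one, parity_zsmul,
      CotFun.hasPar_ofBase (hasPar_logJac hT₀ b), sgn_eq, smul_smul, ← pow_add,
      Even.neg_one_pow (Even.add_self _), one_smul]
  · intro e _ he
    rw [CotFun.dxs_anti, if_neg he, map_zero, mul_zero, smul_zero]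
  · simp

/-- The image of the fibre coordinate `x̂*_{b'}`. -/
theorem hatAnti_eq_norm (b : Fin p ⊕ Fin q) :
    ∑ a : Fin p ⊕ Fin q, HatFun.ofBase (jac T₀ b a) * HatFun.anti q V a +
      HatFun.ofBase (logJac T₀ b) * HatFun.wStar q V =
    HatFun.norm (antiImage T₀ b) (CotFun.ofBase (logJac T₀ b)) := by
  have h : HatFun.norm (antiImage T₀ b) (CotFun.ofBase (logJac T₀ b)) =
      Fib.extend q (HatFun.weightZero V) (antiImage T₀ b) +
        Fib.extend q (HatFun.weightZero V) (CotFun.ofBase (logJac T₀ b)) * HatFun.wStar q V := rfl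
  rw [h, ← HatFun.ofBase_eq_extend]
  congr 1
  have h' : ∀ g : CotFun q V, Fib.extend q (HatFun.weightZero V) g =
    Grass.extend (MvPolynomial.map (HatFun.weightZero V)) g := fun _ => rfl
  rw [antiImage, h', map_sum]
  refine Finset.sum_congr rfl fun a _ => ?_
  rw [map_mul, ← h', ← h', HatFun.ofBase_eq_extend, HatFun.anti_eq_extend]

/-- The change of coordinates on functions of weight zero. -/
theorem hat_subst_norm {κ : DensityBase V' → HatFun q V}
    (hκ : ∀ h : Smooth V', κ (AddMonoidAlgebra.single 0 h) = HatFun.ofBase (T₀ (C h)))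
    {η : Fin q → HatFun q V} {Θ : Fin (q + p + 1) → HatFun q V}
    (hη : ∀ α, η α =
      HatFun.norm (antiImage T₀ (Sum.inr α)) (CotFun.ofBase (logJac T₀ (Sum.inr α))))
    (hΘl : Θ (Fin.last _) = HatFun.wStar q V)
    (hΘ : ∀ α : Fin q, Θ (Fin.castSucc (Fin.castAdd p α)) =
      HatFun.ofBase (T₀ (coord q V' (Sum.inr α))))
    (hΘa : ∀ a : Fin p, Θ (Fin.castSucc (Fin.natAdd q a)) =
      HatFun.norm (antiImage T₀ (Sum.inl a)) (CotFun.ofBase (logJac T₀ (Sum.inl a))))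
    (f g : CotFun q V') :
    Fib.subst κ η Θ (HatFun.norm f g) =
      HatFun.norm (cotHom hT₀ f) (cotHom hT₀ g + parity (shift hT₀ f)) := by
  -- The terms without `w*` already acquire a `w*` part. The given `w*` coefficient acquires one as
  -- well, but multiplication by `w*` removes it.
  have key : ∀ f : CotFun q V', Fib.subst (fun h => κ (HatFun.weightZero V' h)) η
      (fun i => Θ (Fin.castSucc i)) f = HatFun.norm (cotHom hT₀ f) (parity (shift hT₀ f)) := by
    intro f
    refine Eq.trans ?_ (Fib.subst_eq_normHom (φ := HatFun.weightZero V) (hasPar_kappa hT₀)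
      (fun α => (hasPar_antiImage hT₀ (Sum.inr α)).congr (by simp [par])) (hasPar_theta hT₀)
      (shift_isDer hT₀) (shift_base hT₀) (parity_shift hT₀) f)
    congr 1
    · funext h
      exact (hκ h).trans (HatFun.ofBase_eq_extend _)
    · funext α
      rw [hη, ← parity_shift_anti hT₀]
      rfl
    · funext i
      induction i using Fin.addCases with
      | left α =>
        rw [hΘ, HatFun.ofBase_eq_extend, shift_gen, parity_zero, Fin.addCases_left,
          Fib.norm_zero_right]
      | right a =>
        rw [hΘa, ← parity_shift_anti hT₀, Fin.addCases_right]
        rfl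
  refine (Fib.subst_norm (φ := HatFun.weightZero V') HatFun.weightZero_injective κ η Θ f g).trans ?_
  rw [key, key, hΘl]
  exact Fib.norm_add_norm_mul_gen _ _ _ _

end Change

/-! ### Degrees -/

namespace Fib

open Grass

variable {n : ℕ} {F : Type*} [CommRing F]

theorem HasDegree.add {f g : Fib n q F} {k : ℤ} (hf : HasDegree f k) (hg : HasDegree g k) :
    HasDegree (f + g) k := by
  intro I m h
  rw [Grass.add_apply, MvPolynomial.coeff_add] at h
  by_cases hfm : (f I).coeff m = 0
  · exact hg I m fun h' => h (by rw [hfm, h', add_zero])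
  · exact hf I m hfm

theorem HasDegree.zero (k : ℤ) : HasDegree (0 : Fib n q F) k := by
  intro I m h
  exact absurd (MvPolynomial.coeff_zero m) h

theorem HasDegree.of_coeff {f g : Fib n q F} {k : ℤ} (hf : HasDegree f k)
    (h : ∀ I m, (f I).coeff m = 0 → (g I).coeff m = 0) : HasDegree g k :=
  fun I m hm => hf I m fun h' => hm (h I m h')

theorem coeff_neg_one_pow_mul (k : ℕ) (P : MvPolynomial (Fin q) F) (m : Fin q →₀ ℕ) :
    ((-1) ^ k * P).coeff m = 0 ↔ P.coeff m = 0 := by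
  rcases neg_one_pow_eq_or (MvPolynomial (Fin q) F) k with h | h <;> simp [h]

theorem HasDegree.zsmul {f : Fib n q F} {k : ℤ} (hf : HasDegree f k) (c : ℤ) :
    HasDegree (c • f) k :=
  hf.of_coeff fun I m h => by
    change (c • f I).coeff m = 0
    rw [MvPolynomial.coeff_smul, h, smul_zero]

theorem HasDegree.neg {f : Fib n q F} {k : ℤ} (hf : HasDegree f k) : HasDegree (-f) k := by
  simpa using hf.zsmul (-1)

theorem HasDegree.parity {f : Fib n q F} {k : ℤ} (hf : HasDegree f k) :
    HasDegree (Grass.parity f) k :=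
  hf.of_coeff fun _ _ h => (coeff_neg_one_pow_mul _ _ _).2 h

theorem HasDegree.sum {ι : Type*} {s : Finset ι} {f : ι → Fib n q F} {k : ℤ}
    (hf : ∀ i ∈ s, HasDegree (f i) k) : HasDegree (∑ i ∈ s, f i) k :=
  Finset.sum_induction _ (fun f => HasDegree f k) (fun _ _ => HasDegree.add) (HasDegree.zero k) hf

theorem HasDegree.onCoeff {G : Type*} [CommRing G] {D : F → G} (hD : D 0 = 0) {f : Fib n q F}
    {k : ℤ} (hf : HasDegree f k) : HasDegree (onCoeff D f) k := by
  intro I m h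
  refine hf I m fun h' => h ?_
  rw [coeff_onCoeff hD, h', hD]

theorem HasDegree.pderiv {f : Fib n q F} {k : ℤ} (hf : HasDegree f k) (α : Fin q) :
    HasDegree (Grass.map (MvPolynomial.pderiv α) f) (k - 1) := by
  intro I m h
  change (MvPolynomial.pderiv α (f I)).coeff m ≠ 0 at h
  rw [MvPolynomial.coeff_pderiv] at h
  have := hf I _ (left_ne_zero_of_mul h)
  rw [map_add, Finsupp.degree_single] at this
  push_cast at this ⊢
  linarith

theorem HasDegree.leftDeriv {f : Fib n q F} {k : ℤ} (hf : HasDegree f k) (i : Fin n) :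
    HasDegree (Grass.leftDeriv i f) (if q ≤ i.val then k - 1 else k) := by
  intro I m h
  rw [Grass.leftDeriv] at h
  by_cases hi : i ∈ I
  · rw [if_pos hi] at h
    exact absurd (MvPolynomial.coeff_zero m) h
  · rw [if_neg hi, Ne, coeff_neg_one_pow_mul] at h
    have := hf _ _ h
    rw [Finset.filter_insert] at this
    split_ifs at this ⊢
    · rw [Finset.card_insert_of_notMem (by simp [hi])] at this
      push_cast at this ⊢
      linarith
    · exact this

theorem mul_base_one (f : Fib n q F) : f * base 1 = f := mul_one f

theorem coeff_map_ne_zero {G : Type*} [CommRing G] {φ : F →+* G} (hφ : Function.Injective φ)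
    {P : MvPolynomial (Fin q) F} {m : Fin q →₀ ℕ} :
    (MvPolynomial.map φ P).coeff m ≠ 0 ↔ P.coeff m ≠ 0 := by
  rw [MvPolynomial.coeff_map, Ne, map_eq_zero_iff φ hφ]

theorem map_ne_zero {G : Type*} [CommRing G] {φ : F →+* G} (hφ : Function.Injective φ)
    {P : MvPolynomial (Fin q) F} : MvPolynomial.map φ P ≠ 0 ↔ P ≠ 0 := by
  rw [Ne, map_eq_zero_iff (MvPolynomial.map φ) (MvPolynomial.map_injective φ hφ)]

theorem extend_zero {G : Type*} [CommRing G] [Algebra ℝ G] {φ : F →+* G} :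
    extend q φ (0 : Fib n q F) = 0 :=
  map_zero (Grass.extend (MvPolynomial.map φ))

theorem norm_add_right {G : Type*} [CommRing G] [Algebra ℝ G] {φ : F →+* G} (f g h : Fib n q F) :
    norm φ f (g + h) = norm φ f g + extend q φ h * gen (Fin.last n) := by
  simp only [norm, Grass.norm, extend, map_add, add_mul, add_assoc]

end Fib

namespace CotFun

open Grass

variable {V : Opens (Fin p → ℝ)}

theorem hasDegree_dx {f : CotFun q V} {k : ℤ} (hf : Fib.HasDegree f k) (a : Fin p ⊕ Fin q) :
    Fib.HasDegree (dx a f) k := by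
  rcases a with a | a
  · exact hf.onCoeff (Smooth.pderiv_zero a)
  · have := hf.leftDeriv (Fin.castAdd p a)
    rwa [if_neg (by simp)] at this

theorem hasDegree_dxs {f : CotFun q V} {k : ℤ} (hf : Fib.HasDegree f k) (a : Fin p ⊕ Fin q) :
    Fib.HasDegree (dxs a f) (k - 1) := by
  rcases a with a | a
  · have := hf.leftDeriv (Fin.natAdd q a)
    rwa [if_pos (by simp)] at this
  · exact hf.pderiv a

theorem hasDegree_divergence {f : CotFun q V} {k : ℤ} (hf : Fib.HasDegree f k) :
    Fib.HasDegree (divergence f) (k - 1) :=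
  Fib.HasDegree.sum fun a _ => (hasDegree_dx (hasDegree_dxs hf a) a).zsmul _

end CotFun

/-! ### Degree, parity and weight of `f + g w*` -/

namespace HatFun

open Grass

variable {V : Opens (Fin p → ℝ)}

theorem norm_apply_map (f g : CotFun q V) (I : Finset (Fin (q + p))) :
    norm f g (I.map Fin.castSuccEmb) = MvPolynomial.map (weightZero V) (f I) :=
  Grass.norm_apply_map _ f g I

theorem norm_apply_insert (f g : CotFun q V) (I : Finset (Fin (q + p))) :
    norm f g (insert (Fin.last _) (I.map Fin.castSuccEmb)) =
      MvPolynomial.map (weightZero V) (g I) :=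
  Grass.norm_apply_insert _ f g I

theorem coeff_map_weightZero_ne_zero {P : MvPolynomial (Fin q) (Smooth V)} {m : Fin q →₀ ℕ} :
    (MvPolynomial.map (weightZero V) P).coeff m ≠ 0 ↔ P.coeff m ≠ 0 :=
  Fib.coeff_map_ne_zero weightZero_injective

theorem map_weightZero_ne_zero {P : MvPolynomial (Fin q) (Smooth V)} :
    MvPolynomial.map (weightZero V) P ≠ 0 ↔ P ≠ 0 :=
  Fib.map_ne_zero weightZero_injective

theorem norm_add_right (f g h : CotFun q V) :
    norm f (g + h) = norm f g + ofCot h * wStar q V := by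
  rw [ofCot_eq_extend]
  exact Fib.norm_add_right f g h

theorem ofBase_zero : ofBase (0 : SuperFun q V) = 0 := by
  rw [ofBase_eq_extend, ← CotFun.ofBaseHom_apply, map_zero]
  exact Fib.extend_zero

theorem sum_single_zero {V' : Opens (Fin p → ℝ)} (T₀ : SuperFun q V' ≃ₐ[ℝ] SuperFun q V)
    (u : SuperFun q V) (h : Smooth V') :
    ((AddMonoidAlgebra.single 0 h : DensityBase V').coeff.sum fun μ g =>
      ofBase (T₀ (C g) * SuperFun.absRpow u μ) * tpow q V μ) = ofBase (T₀ (C h)) := by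
  have h0 : ofBase (T₀ (C 0) * SuperFun.absRpow u 0) * tpow q V 0 = 0 := by
    rw [← CHom_apply, map_zero, map_zero, zero_mul, ofBase_zero, zero_mul]
  rw [AddMonoidAlgebra.coeff_single, Finsupp.sum_single_index h0, SuperFun.absRpow_zero, mul_one]
  exact Fib.mul_base_one _

/-- `w*` is itself a fibre coordinate and takes up one degree. With integer degrees the case `k = 0`
is included: degree `-1` forces `g = 0`. -/
theorem hasDegree_norm {f g : CotFun q V} {k : ℤ} :
    Fib.HasDegree (norm f g) k ↔ Fib.HasDegree f k ∧ Fib.HasDegree g (k - 1) := by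
  have h1 : ∀ I : Finset (Fin (q + p)),
      ((I.map Fin.castSuccEmb).filter fun i : Fin (q + p + 1) => q ≤ i.val).card =
        (I.filter fun i : Fin (q + p) => q ≤ i.val).card := by
    intro I
    rw [Finset.filter_map, Finset.card_map]
    rfl
  have h2 : ∀ I : Finset (Fin (q + p)),
      ((insert (Fin.last _) (I.map Fin.castSuccEmb)).filter
        fun i : Fin (q + p + 1) => q ≤ i.val).card =
        (I.filter fun i : Fin (q + p) => q ≤ i.val).card + 1 := by
    intro I
    rw [Finset.filter_insert, if_pos (by simp), Finset.card_insert_of_notMem (by simp), h1]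
  constructor
  · intro h
    refine ⟨fun I m hm => ?_, fun I m hm => ?_⟩
    · have := h (I.map Fin.castSuccEmb) m
      rw [norm_apply_map, h1] at this
      exact this (coeff_map_weightZero_ne_zero.2 hm)
    · have := h (insert (Fin.last _) (I.map Fin.castSuccEmb)) m
      rw [norm_apply_insert, h2] at this
      have := this (coeff_map_weightZero_ne_zero.2 hm)
      push_cast at this ⊢
      linarith
  · rintro ⟨hf, hg⟩ J m hm
    obtain ⟨I, rfl | rfl⟩ := eq_map_or_eq_insert J
    · rw [norm_apply_map] at hm
      rw [h1]
      exact hf I m (coeff_map_weightZero_ne_zero.1 hm)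
    · rw [norm_apply_insert] at hm
      have := hg I m (coeff_map_weightZero_ne_zero.1 hm)
      rw [h2]
      push_cast at this ⊢
      linarith

theorem isEven_norm {f g : CotFun q V} : IsEven (norm f g) ↔ IsEven f ∧ IsOdd g := by
  have h2 : ∀ I : Finset (Fin (q + p)),
      (insert (Fin.last _) (I.map Fin.castSuccEmb)).card = I.card + 1 := by
    intro I
    rw [Finset.card_insert_of_notMem (last_notMem_map I), Finset.card_map]
  constructor
  · intro h
    refine ⟨fun I hI => ?_, fun I hI => ?_⟩
    · have := h (I.map Fin.castSuccEmb)
      rw [norm_apply_map, Finset.card_map] at this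
      exact this (map_weightZero_ne_zero.2 hI)
    · have := h (insert (Fin.last _) (I.map Fin.castSuccEmb))
      rw [norm_apply_insert, h2, Nat.even_add_one, Nat.not_even_iff_odd] at this
      exact this (map_weightZero_ne_zero.2 hI)
  · rintro ⟨hf, hg⟩ J hJ
    obtain ⟨I, rfl | rfl⟩ := eq_map_or_eq_insert J
    · rw [norm_apply_map] at hJ
      rw [Finset.card_map]
      exact hf I (map_weightZero_ne_zero.1 hJ)
    · rw [norm_apply_insert] at hJ
      rw [h2, Nat.even_add_one, Nat.not_even_iff_odd]
      exact hg I (map_weightZero_ne_zero.1 hJ)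

theorem hasWeight_norm (f g : CotFun q V) : HasWeight (norm f g) 0 := by
  have h : ∀ (c : Smooth V) (ν : ℝ), (weightZero V c).coeff ν ≠ 0 → ν = 0 := by
    intro c ν hν
    rw [weightZero_apply, AddMonoidAlgebra.coeff_single] at hν
    by_contra h
    exact hν (Finsupp.single_eq_of_ne h)
  intro J m ν hν
  obtain ⟨I, rfl | rfl⟩ := eq_map_or_eq_insert J
  · rw [norm_apply_map, MvPolynomial.coeff_map] at hν
    exact h _ _ hν
  · rw [norm_apply_insert, MvPolynomial.coeff_map] at hν
    exact h _ _ hν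

theorem onCoeff_single_apply (f : CotFun q V) (I : Finset (Fin (q + p))) :
    (Fib.onCoeff (AddMonoidAlgebra.single 0) f : Fib (q + p) q (DensityBase V)) I =
      MvPolynomial.map (weightZero V) (f I) :=
  Fib.polyMap_eq_map (weightZero V) (f I)

theorem proj_norm (f g : CotFun q V) :
    proj (norm f g) = Fib.onCoeff (AddMonoidAlgebra.single 0) f := by
  ext1 I
  rw [onCoeff_single_apply]
  exact norm_apply_map f g I

/-- The coefficient of `w*` of a function of weight zero. -/
def wCoeff (F : HatFun q V) : CotFun q V := fun I =>
  Fib.polyMap (fun d : DensityBase V => d.coeff 0)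
    (F (insert (Fin.last _) (I.map Fin.castSuccEmb)))

/-- The projection fixes the part free of `w*`, and weight zero leaves only the exponent `0` of `t`
in the other part. This gives surjectivity at the level of charts. -/
theorem eq_norm_wCoeff {F : HatFun q V} {f : CotFun q V}
    (hp : proj F = Fib.onCoeff (AddMonoidAlgebra.single 0) f) (hw : HasWeight F 0) :
    F = norm f (wCoeff F) := by
  refine Grass.eq_norm (fun I => ?_) fun I => ?_
  · exact (congrFun hp I).trans (onCoeff_single_apply f I)
  · refine MvPolynomial.ext _ _ fun m => ?_
    have hc : ((wCoeff F) I).coeff m =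
        ((F (insert (Fin.last _) (I.map Fin.castSuccEmb))).coeff m).coeff 0 :=
      Fib.coeff_polyMap rfl _ m
    rw [MvPolynomial.coeff_map, hc, weightZero_apply]
    refine AddMonoidAlgebra.coeff_injective (Finsupp.ext fun ν => ?_)
    rw [AddMonoidAlgebra.coeff_single]
    by_cases hν : ν = 0
    · subst hν
      rw [Finsupp.single_eq_same]
    · rw [Finsupp.single_eq_of_ne hν]
      by_contra h
      exact hν (hw _ m ν h)

end HatFun

/-! ### Supermanifolds -/

namespace Supermanifold

open Grass

variable {M : Supermanifold p q}

namespace Chart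

theorem trans_parity (c d : M.Chart) (f : SuperFun q (right c d)) :
    trans c d (parity f) = parity (trans c d f) := by
  have h1 : (d.iso (overlap c d) Set.inter_subset_right).symm (parity f) =
      (M.γ.app (op (overlap c d))).hom
        ((d.iso (overlap c d) Set.inter_subset_right).symm f) := by
    exact (AlgEquiv.symm_apply_eq _).2 (((d.iso_parity _ _ _).trans
      (congrArg parity (AlgEquiv.apply_symm_apply _ _))).symm)
  change c.iso _ _ ((d.iso _ _).symm (parity f)) = _
  rw [h1]
  exact c.iso_parity _ _ _

theorem cotTrans_eq (c d : M.Chart) (f : CotFun q (right c d)) :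
    cotTrans c d f = Change.cotHom (trans_parity c d) f :=
  (Change.cotHom_apply (trans_parity c d) f).symm

theorem hatTrans_norm (c d : M.Chart) (f g : CotFun q (right c d)) :
    hatTrans c d (HatFun.norm f g) = HatFun.norm (Change.cotHom (trans_parity c d) f)
      (Change.cotHom (trans_parity c d) g + parity (Change.shift (trans_parity c d) f)) := by
  unfold hatTrans
  refine Change.hat_subst_norm (trans_parity c d)
    (HatFun.sum_single_zero (trans c d) (ber c d)) (fun α => ?_) ?_ (fun α => ?_)
    (fun a => ?_) f g
  · exact Change.hatAnti_eq_norm (Sum.inr α)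
  · rw [Fin.lastCases_last]
  · rw [Fin.lastCases_castSucc, Fin.addCases_left]
    rfl
  · rw [Fin.lastCases_castSucc, Fin.addCases_right]
    exact Change.hatAnti_eq_norm (Sum.inl a)

end Chart

open Chart

/-- The local expressions `ŝ + Q w*` glue if and only if the local expressions `Q` do. -/
theorem hat_compat_iff (s : M.Cot) (Q : ∀ c : M.Chart, CotFun q (target c)) (c d : M.Chart) :
    hatTrans c d (HatFun.restrict (right_le c d)
        (HatFun.norm (s.loc d) (parity (CotFun.divergence (s.loc d)) + Q d))) =
      HatFun.restrict (left_le c d)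
        (HatFun.norm (s.loc c) (parity (CotFun.divergence (s.loc c)) + Q c)) ↔
    cotTrans c d (CotFun.restrict (right_le c d) (Q d)) =
      CotFun.restrict (left_le c d) (Q c) := by
  have hs := s.compat c d
  rw [cotTrans_eq] at hs
  -- By the compatibility of `s`, this expresses the divergence in the chart `c` as the transformed
  -- divergence from `d` plus the shift, which is the defect produced by `hatTrans`. The common term
  -- then cancels by injectivity of the normal form.
  have hd := congrArg parity (Change.divergence_cotHom (trans_parity c d)
    (CotFun.restrict (right_le c d) (s.loc d)))
  rw [hs, parity_add, ← Change.cotHom_parity] at hd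
  rw [HatFun.restrict_norm, HatFun.restrict_norm, hatTrans_norm, cotTrans_eq, hs,
    CotFun.restrict_add, CotFun.restrict_add, CotFun.restrict_parity, CotFun.restrict_parity,
    CotFun.restrict_divergence, CotFun.restrict_divergence, hd, map_add, add_right_comm]
  constructor
  · intro h
    exact add_left_cancel (Fib.norm_injective HatFun.weightZero_injective h).2
  · intro h
    rw [h]

/-- The function with the local expressions `ŝ + Q w*`. -/
def Cot.shiftedLift (s Q : M.Cot) : M.Hat where
  loc c := HatFun.norm (s.loc c) (parity (CotFun.divergence (s.loc c)) + Q.loc c)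
  compat c d := (hat_compat_iff s Q.loc c d).2 (Q.compat c d)

/-- The zero function. -/
def Cot.zero (M : Supermanifold p q) : M.Cot where
  loc _ := 0
  compat c d := by
    have h : ∀ {V V' : Opens (Fin p → ℝ)} (h : V' ≤ V),
        CotFun.restrict h (0 : CotFun q V) = 0 := fun h => by
      have := CotFun.restrict_zsmul h 0 (0 : CotFun q _)
      rwa [zero_smul, zero_smul] at this
    rw [h, h, cotTrans_eq, map_zero]

/-! ### Properties of the shifted lifts -/

namespace Cot

variable {s : M.Cot} {r : ℤ}

theorem parity_divergence_isOdd (heven : s.IsEven) (c : M.Chart) :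
    HasPar 1 (parity (CotFun.divergence (s.loc c))) := by
  have hs : HasPar 0 (s.loc c) := isEven_iff.1 (heven c)
  have hp : parity (s.loc c) = s.loc c := by
    have := hs
    rwa [HasPar, pow_zero, one_smul] at this
  rw [HasPar, parity_parity, CotFun.parity_divergence, hp, smul_neg, pow_one, neg_one_smul,
    neg_neg]

theorem bracket_parity_divergence (heven : s.IsEven) (hpoisson : s.BracketZero s) (c : M.Chart) :
    CotFun.bracket (s.loc c) (parity (CotFun.divergence (s.loc c))) = 0 := by
  have hs : HasPar 0 (s.loc c) := isEven_iff.1 (heven c)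
  have hp : parity (s.loc c) = s.loc c := by
    have := hs
    rwa [HasPar, pow_zero, one_smul] at this
  rw [CotFun.parity_divergence, hp, CotFun.bracket_neg,
    CotFun.bracket_divergence_self hs (hpoisson c), neg_zero]

/-- As `(s, s)` and `(s, Δs)` vanish, only `2 (s, Q) w*` is left. -/
theorem bracket_norm_eq_zero_iff (heven : s.IsEven) (hpoisson : s.BracketZero s) (c : M.Chart)
    {Q : CotFun q (target c)} (hQ : HasPar 1 Q) :
    HatFun.bracket (HatFun.norm (s.loc c) (parity (CotFun.divergence (s.loc c)) + Q))
      (HatFun.norm (s.loc c) (parity (CotFun.divergence (s.loc c)) + Q)) = 0 ↔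
    CotFun.bracket (s.loc c) Q = 0 := by
  rw [HatFun.bracket_norm (isEven_iff.1 (heven c)) ((parity_divergence_isOdd heven c).add hQ),
    hpoisson c, CotFun.bracket_add, bracket_parity_divergence heven hpoisson, zero_add]
  have h0 : (0 : HatFun q (target c)) = HatFun.norm 0 0 := Fib.norm_zero.symm
  rw [h0]
  constructor
  · intro h
    exact eq_zero_of_eq_neg (eq_neg_of_add_eq_zero_left
      (Fib.norm_injective HatFun.weightZero_injective h).2)
  · intro h
    rw [h, add_zero]

theorem shiftedLift_mem (hdeg : s.HasDegree r) (heven : s.IsEven) (hpoisson : s.BracketZero s)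
    {Q : M.Cot} (hQ : Q.HasDegree (r - 1) ∧ Q.IsOdd ∧ s.BracketZero Q) :
    (s.shiftedLift Q).LiesAbove s ∧ (s.shiftedLift Q).BracketZero (s.shiftedLift Q) ∧
      (s.shiftedLift Q).HasDegree r ∧ (s.shiftedLift Q).HasWeight 0 ∧
        (s.shiftedLift Q).IsEven := by
  obtain ⟨h1, h2, h3⟩ := hQ
  refine ⟨fun c => HatFun.proj_norm _ _, fun c => ?_, fun c => ?_,
    fun c => HatFun.hasWeight_norm _ _, fun c => ?_⟩
  · exact (bracket_norm_eq_zero_iff heven hpoisson c (isOdd_iff.1 (h2 c))).2 (h3 c)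
  · exact HatFun.hasDegree_norm.2 ⟨hdeg c,
      ((CotFun.hasDegree_divergence (hdeg c)).parity).add (h1 c)⟩
  · exact HatFun.isEven_norm.2 ⟨heven c, isOdd_iff.2
      ((parity_divergence_isOdd heven c).add (isOdd_iff.1 (h2 c)))⟩

theorem ext_loc {Q Q' : M.Cot} (h : ∀ c, Q.loc c = Q'.loc c) : Q = Q' := by
  cases Q
  cases Q'
  congr
  exact funext h

theorem shiftedLift_injective : Function.Injective (Cot.shiftedLift s) := by
  intro Q Q' h
  refine ext_loc fun c => ?_
  have := congrArg (fun S : M.Hat => S.loc c) h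
  exact add_left_cancel (Fib.norm_injective HatFun.weightZero_injective this).2

/-- Subtracting the canonical lift in each chart leaves the candidate `Q`. The local pieces glue by
the converse direction of `hat_compat_iff`, and degree, parity and bracket are read off from those
of `S`. -/
theorem exists_eq_shiftedLift (hdeg : s.HasDegree r) (heven : s.IsEven)
    (hpoisson : s.BracketZero s) {S : M.Hat} (hS : S.LiesAbove s ∧ S.BracketZero S ∧
      S.HasDegree r ∧ S.HasWeight 0 ∧ S.IsEven) :
    ∃ Q : M.Cot, (Q.HasDegree (r - 1) ∧ Q.IsOdd ∧ s.BracketZero Q) ∧ s.shiftedLift Q = S := by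
  obtain ⟨h1, h2, h3, h4, h5⟩ := hS
  let Q : ∀ c : M.Chart, CotFun q (target c) := fun c =>
    HatFun.wCoeff (S.loc c) + -parity (CotFun.divergence (s.loc c))
  have hloc : ∀ c, S.loc c =
      HatFun.norm (s.loc c) (parity (CotFun.divergence (s.loc c)) + Q c) := by
    intro c
    have : parity (CotFun.divergence (s.loc c)) + Q c = HatFun.wCoeff (S.loc c) :=
      (add_left_comm _ _ _).trans (by rw [add_neg_cancel, add_zero])
    rw [this]
    exact HatFun.eq_norm_wCoeff (h1 c) (h4 c)
  have hodd : ∀ c, HasPar 1 (Q c) := by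
    intro c
    have h := h5 c
    rw [HatFun.eq_norm_wCoeff (h1 c) (h4 c), HatFun.isEven_norm] at h
    refine (isOdd_iff.1 h.2).add ?_
    have := (parity_divergence_isOdd heven c).smul (-1)
    rwa [neg_one_smul] at this
  refine ⟨⟨Q, fun c d => (hat_compat_iff s Q c d).1 ?_⟩, ⟨fun c => ?_, fun c => ?_, fun c => ?_⟩,
    ?_⟩
  · rw [← hloc, ← hloc]
    exact S.compat c d
  · have h := h3 c
    rw [HatFun.eq_norm_wCoeff (h1 c) (h4 c), HatFun.hasDegree_norm] at h
    exact h.2.add (CotFun.hasDegree_divergence (hdeg c)).parity.neg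
  · exact isOdd_iff.2 (hodd c)
  · have h := h2 c
    rw [hloc] at h
    exact (bracket_norm_eq_zero_iff heven hpoisson c (hodd c)).1 h
  · cases S
    simp only [shiftedLift, Hat.mk.injEq]
    exact funext fun c => (hloc c).symm

theorem shiftedLift_isShift (Q : M.Cot) :
    (s.shiftedLift Q).IsShift (s.shiftedLift (Cot.zero M)) Q := by
  intro c
  change HatFun.norm _ _ = HatFun.norm _ (_ + 0) + _
  rw [add_zero, ← HatFun.norm_add_right]

theorem shiftedLift_zero_isCanonicalLift : (s.shiftedLift (Cot.zero M)).IsCanonicalLift s := by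
  intro c
  change HatFun.norm _ (_ + 0) = _
  rw [add_zero, HatFun.wStar_mul_ofCot, HatFun.ofCot_add_ofCot_mul_wStar]

end Cot

end Supermanifold

end SuperGeom

end

/-! ### The classification of Poisson lifts -/

theorem mainTheorem2 {p q : ℕ} (M : SuperGeom.Supermanifold p q) (r : ℕ) (s : M.Cot)
    (hdeg : s.HasDegree r) (heven : s.IsEven) (hpoisson : s.BracketZero s) :
    ∃ ŝ : M.Hat, ŝ.IsCanonicalLift s ∧
      ∃ Φ : {Q : M.Cot // Q.HasDegree ((r : ℤ) - 1) ∧ Q.IsOdd ∧ s.BracketZero Q} ≃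
          {S : M.Hat // S.LiesAbove s ∧ S.BracketZero S ∧ S.HasDegree r ∧ S.HasWeight 0 ∧
            S.IsEven},
        ∀ Q, (Φ Q).1.IsShift ŝ Q.1 := by
  refine ⟨s.shiftedLift (SuperGeom.Supermanifold.Cot.zero M),
    SuperGeom.Supermanifold.Cot.shiftedLift_zero_isCanonicalLift, Equiv.ofBijective
      (fun Q => ⟨s.shiftedLift Q.1,
        SuperGeom.Supermanifold.Cot.shiftedLift_mem hdeg heven hpoisson Q.2⟩)
      ⟨fun Q Q' h => ?_, fun S => ?_⟩, fun Q => ?_⟩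
  · exact Subtype.ext (SuperGeom.Supermanifold.Cot.shiftedLift_injective (Subtype.ext_iff.1 h))
  · obtain ⟨Q, hQ, h⟩ := SuperGeom.Supermanifold.Cot.exists_eq_shiftedLift hdeg heven hpoisson S.2
    exact ⟨⟨Q, hQ⟩, Subtype.ext h⟩
  · exact SuperGeom.Supermanifold.Cot.shiftedLift_isShift Q.1
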